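/- Let $N$ be a smooth surface without boundary, $\omega$ a symplectic form on $N$ with $\int_N\omega<+\infty$, and $H:N\to\mathbb R$ a smooth proper function with Hamiltonian vector field $X_H$, $\omega(X_H,\cdot)=-dH$. An embedded circle of $H$ at level $c$ is the image $L\subset\{H=c\}$ of a non-constant periodic orbit of $X_H$. An orbit cylinder is a smooth isotopy $c\mapsto L_c$, $c\in I$, over an interval $I\subset\mathbb R$, such that $L_c$ is an embedded circle of $H$ at level $c$ for all $c\in I$; it is maximal if no orbit cylinder over a larger interval extends it. If $c\mapsto L_c$, $c\in I$, is a maximal orbit cylinder and $c_0$ is an interior point of $I$, its restrictions to $J=I\cap[c_0,+\infty)$ and to $J=I\cap(-\infty,c_0]$ are called the maximal forward orbit cylinder starting at $L_{c_0}$ and the maximal backward orbit cylinder ending at $L_{c_0}$. Such a cylinder is resonant if $\frac{dT}{dc}(c)=0$ for all $c\in J$, where $T(c)$ is the (least positive) period of the orbit of $X_H$ on $L_c$. **Lemma 2.8.** (Forward.) Let $c\mapsto L_c$, $c\in J$, be a maximal forward orbit cylinder starting at $L_{c_0}$. If it is resonant, then $J=[c_0,c_+)$ with $c_+<+\infty$,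 and there is a non-degenerate local maximum point $z_\infty\in N$ of $H$ such that $$D:=\{z_\infty\}\cup\bigcup_{c\in(c_0,c_+)}L_c$$ is an embedded open disc in $N$ (an open subset diffeomorphic to the open unit disc). Moreover $H$ generates a Hamiltonian circle action on $D$ with $z_\infty$ as its only fixed point: there is $\tau>0$ such that the flow of $X_H$ restricts to a smooth action of $\mathbb R/\tau\mathbb Z$ on $D$, and $z_\infty$ is its only fixed point. (Backward.) Let $c\mapsto L_c$, $c\in J$, be a maximal backward orbit cylinder ending at $L_{c_0}$. If it is resonant, then $J=(c_-,c_0]$ with $c_->-\infty$, and there is a non-degenerate local minimum point $z_{-\infty}\in N$ of $H$ such that $D:=\{z_{-\infty}\}\cup\bigcup_{c\in(c_-,c_0)}L_c$ is an embedded open disc in $N$ on which $H$ generates, in the same sense, a Hamiltonian circle action with $z_{-\infty}$ as its only fixed point. -/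

import Mathlib

open Set MeasureTheory
open scoped Manifold ContDiff Topology

/-- The Euclidean plane on which surfaces are modelled. -/
abbrev Plane : Type := EuclideanSpace ℝ (Fin 2)

section Symplectic

variable (N : Type*) [TopologicalSpace N] [ChartedSpace Plane N] [IsManifold (𝓡 2) ∞ N]

/-- A symplectic form on a smooth surface: a smooth, alternating, nondegenerate field of bilinear
forms on the tangent spaces. Closedness is automatic, because every `3`-form on a surface
vanishes. -/
structure SymplecticForm where
  /-- the bilinear form on each tangent space -/
  form : ∀ z : N, TangentSpace (𝓡 2) z →L[ℝ] (TangentSpace (𝓡 2) z →L[ℝ] ℝ)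
  alternating : ∀ (z : N) (v : TangentSpace (𝓡 2) z), form z v v = 0
  nondegenerate : ∀ (z : N) (v : TangentSpace (𝓡 2) z), (∀ w, form z v w = 0) → v = 0
  smooth : ContMDiff (𝓡 2) ((𝓡 2).prod 𝓘(ℝ, Plane →L[ℝ] Plane →L[ℝ] ℝ)) ∞
    (fun z ↦ Bundle.TotalSpace.mk' (Plane →L[ℝ] Plane →L[ℝ] ℝ)
      (E := fun z : N ↦ TangentSpace (𝓡 2) z →L[ℝ] (TangentSpace (𝓡 2) z →L[ℝ] ℝ)) z (form z))

variable {N}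

/-- Every covector is of the form `Ω(X, ·)`, for a unique `X`. -/
theorem SymplecticForm.existsUnique_dual (Ω : SymplecticForm N) (z : N)
    (ξ : TangentSpace (𝓡 2) z →L[ℝ] ℝ) : ∃! X : TangentSpace (𝓡 2) z, Ω.form z X = ξ := by
  have hinj : Function.Injective (Ω.form z) := by
    intro v w h
    have h0 : v - w = 0 := by
      apply Ω.nondegenerate z
      intro u
      simp [map_sub, h]
    exact sub_eq_zero.mp h0
  have hsurj : Function.Surjective (Ω.form z) := by
    let f : Plane →ₗ[ℝ] (Plane →L[ℝ] ℝ) := (Ω.form z).toLinearMap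
    have hdim : Module.finrank ℝ Plane = Module.finrank ℝ (Plane →L[ℝ] ℝ) := by
      rw [← (LinearMap.toContinuousLinearMap (𝕜 := ℝ) (E := Plane) (F' := ℝ)).finrank_eq]
      exact (Subspace.dual_finrank_eq (K := ℝ) (V := Plane)).symm
    exact (LinearMap.injective_iff_surjective_of_finrank_eq_finrank (f := f) hdim).mp hinj
  obtain ⟨X, hX⟩ := hsurj ξ
  exact ⟨X, hX, fun Y hY ↦ hinj (hY.trans hX.symm)⟩

/-- The Hamiltonian vector field `X_H`, determined by `Ω(X_H, ·) = -dH`. -/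
noncomputable def hamiltonianVectorField (Ω : SymplecticForm N) (H : N → ℝ) (z : N) :
    TangentSpace (𝓡 2) z :=
  (Ω.existsUnique_dual z (-(mfderiv (𝓡 2) 𝓘(ℝ, ℝ) H z))).choose

theorem hamiltonianVectorField_spec (Ω : SymplecticForm N) (H : N → ℝ) (z : N)
    (v : TangentSpace (𝓡 2) z) :
    Ω.form z (hamiltonianVectorField Ω H z) v = -(mfderiv (𝓡 2) 𝓘(ℝ, ℝ) H z v) :=
  congrArg (fun ξ : TangentSpace (𝓡 2) z →L[ℝ] ℝ ↦ ξ v)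
    (Ω.existsUnique_dual z (-(mfderiv (𝓡 2) 𝓘(ℝ, ℝ) H z))).choose_spec.1

/-- The density `|Ω(∂₁, ∂₂)|` of a symplectic form in a chart `e`. -/
noncomputable def SymplecticForm.chartDensity (Ω : SymplecticForm N)
    (e : OpenPartialHomeomorph N Plane) (x : Plane) : ℝ :=
  |Ω.form (e.symm x)
    (mfderiv (𝓡 2) (𝓡 2) e.symm x (EuclideanSpace.single (0 : Fin 2) (1 : ℝ) : Plane))
    (mfderiv (𝓡 2) (𝓡 2) e.symm x (EuclideanSpace.single (1 : Fin 2) (1 : ℝ) : Plane))|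

/-- The area measure of `Ω` on the domain of a chart `e`, as a measure on the surface: the
Lebesgue measure on the target of `e` with density `|Ω(∂₁, ∂₂)|`, transported by `e⁻¹`. -/
noncomputable def SymplecticForm.chartArea [MeasurableSpace N] (Ω : SymplecticForm N)
    (e : OpenPartialHomeomorph N Plane) : Measure N :=
  (((volume : Measure Plane).restrict e.target).withDensity
    (fun x ↦ ENNReal.ofReal (Ω.chartDensity e x))).map e.symm

/-- The area measure `A ↦ ∫_A Ω` (for the orientation given by `Ω`). The area measures on the
chart domains agree on overlaps, so their supremum is the measure that restricts to each of
them. -/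
noncomputable def SymplecticForm.area [MeasurableSpace N] (Ω : SymplecticForm N) : Measure N :=
  ⨆ e ∈ atlas Plane N, Ω.chartArea e

end Symplectic

section Orbits

variable {N : Type*} [TopologicalSpace N] [ChartedSpace Plane N] [IsManifold (𝓡 2) ∞ N]

/-- `γ` is an orbit of `H`: a solution `γ : ℝ → N` of `γ' = X_H(γ)`. -/
def IsHamiltonianOrbit (Ω : SymplecticForm N) (H : N → ℝ) (γ : ℝ → N) : Prop :=
  IsMIntegralCurve (I := 𝓡 2) γ (hamiltonianVectorField Ω H)

/-- `L` is an embedded circle of `H` at level `c`: the support of a non-constant periodic orbit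
of `H` on which `H = c`. -/
def IsEmbeddedCircle (Ω : SymplecticForm N) (H : N → ℝ) (c : ℝ) (L : Set N) : Prop :=
  ∃ γ : ℝ → N, IsHamiltonianOrbit Ω H γ ∧ (∃ T, 0 < T ∧ Function.Periodic γ T) ∧
    (∃ s t, γ s ≠ γ t) ∧ (∀ t, H (γ t) = c) ∧ L = range γ

/-- The period of the orbit of `H` supported on `L`, that is, its least positive period. -/
noncomputable def orbitPeriod (Ω : SymplecticForm N) (H : N → ℝ) (L : Set N) : ℝ :=
  sInf {T | 0 < T ∧ ∃ γ : ℝ → N, IsHamiltonianOrbit Ω H γ ∧ Function.Periodic γ T ∧ L = range γ}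

/-- The sets `L c`, `c ∈ I`, form a smooth isotopy of embedded circles in `N`: there is a smooth
map `F` on `I × ℝ/ℤ` (here: on `I × ℝ`, with period `1` in the second variable) such that each
`F(c, ·)` is an injective immersion of the circle `ℝ/ℤ` with image `L c`. -/
def IsSmoothIsotopy (I : Set ℝ) (L : ℝ → Set N) : Prop :=
  ∃ F : ℝ × ℝ → N,
    ContMDiffOn 𝓘(ℝ, ℝ × ℝ) (𝓡 2) ∞ F (I ×ˢ univ) ∧
    ∀ c ∈ I, L c = range (fun θ ↦ F (c, θ)) ∧
      (∀ θ θ' : ℝ, F (c, θ) = F (c, θ') ↔ ∃ n : ℤ, θ' = θ + n) ∧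
      ∀ θ : ℝ, mfderiv 𝓘(ℝ, ℝ) (𝓡 2) (fun s ↦ F (c, s)) θ (1 : ℝ) ≠ 0

/-- `c ↦ L c`, `c ∈ I`, is an orbit cylinder of `H`. -/
structure IsOrbitCylinder (Ω : SymplecticForm N) (H : N → ℝ) (I : Set ℝ) (L : ℝ → Set N) :
    Prop where
  interval : I.OrdConnected
  isotopy : IsSmoothIsotopy I L
  circle : ∀ c ∈ I, IsEmbeddedCircle Ω H c (L c)

/-- A maximal orbit cylinder: no orbit cylinder on a larger interval extends it. -/
def IsMaximalOrbitCylinder (Ω : SymplecticForm N) (H : N → ℝ) (I : Set ℝ) (L : ℝ → Set N) :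
    Prop :=
  IsOrbitCylinder Ω H I L ∧
    ∀ (I' : Set ℝ) (L' : ℝ → Set N), IsOrbitCylinder Ω H I' L' → I ⊆ I' →
      (∀ c ∈ I, L' c = L c) → I' = I

/-- `c ↦ L c`, `c ∈ J`, is the maximal forward orbit cylinder starting at `L c₀`: the restriction
to `I ∩ [c₀, ∞)` of a maximal orbit cylinder over `I` that passes through `L c₀`. -/
def IsMaximalForwardCylinder (Ω : SymplecticForm N) (H : N → ℝ) (c₀ : ℝ) (J : Set ℝ)
    (L : ℝ → Set N) : Prop :=
  ∃ (I : Set ℝ) (L' : ℝ → Set N), IsMaximalOrbitCylinder Ω H I L' ∧ c₀ ∈ interior I ∧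
    J = I ∩ Ici c₀ ∧ ∀ c ∈ J, L c = L' c

/-- `c ↦ L c`, `c ∈ J`, is the maximal backward orbit cylinder ending at `L c₀`. -/
def IsMaximalBackwardCylinder (Ω : SymplecticForm N) (H : N → ℝ) (c₀ : ℝ) (J : Set ℝ)
    (L : ℝ → Set N) : Prop :=
  ∃ (I : Set ℝ) (L' : ℝ → Set N), IsMaximalOrbitCylinder Ω H I L' ∧ c₀ ∈ interior I ∧
    J = I ∩ Iic c₀ ∧ ∀ c ∈ J, L c = L' c

/-- The circle `L c` of an orbit cylinder over the interval `J` is non-resonant if `dT/dc ≠ 0`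
at `c`, where `T(c)` is the period of the orbit on `L c`. The derivative is one-sided at an
endpoint of `J`. -/
def IsNonResonantCircle (Ω : SymplecticForm N) (H : N → ℝ) (J : Set ℝ) (L : ℝ → Set N) (c : ℝ) :
    Prop :=
  derivWithin (fun c' ↦ orbitPeriod Ω H (L c')) J c ≠ 0

/-- An orbit cylinder is resonant if all its circles are resonant. -/
def IsResonantCylinder (Ω : SymplecticForm N) (H : N → ℝ) (J : Set ℝ) (L : ℝ → Set N) : Prop :=
  ∀ c ∈ J, ¬ IsNonResonantCircle Ω H J L c

/-- `z` is a non-degenerate critical point of `H`: `dH = 0` at `z` and the Hessian of `H` at `z`,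
computed in a chart around `z`, is a non-degenerate bilinear form. -/
def IsNondegenerateCriticalPoint (H : N → ℝ) (z : N) : Prop :=
  mfderiv (𝓡 2) 𝓘(ℝ, ℝ) H z = 0 ∧
    ∀ v : Plane,
      (∀ w : Plane,
        fderiv ℝ (fderiv ℝ (H ∘ (chartAt Plane z).symm)) (chartAt Plane z z) v w = 0) → v = 0

/-- `D` is an (open) smoothly embedded disc: it is the domain of a smooth chart onto the open unit
disc, equivalently an open subset diffeomorphic to the open unit disc. -/
def IsEmbeddedDisc (D : Set N) : Prop :=
  ∃ e ∈ IsManifold.maximalAtlas (𝓡 2) ∞ N, e.source = D ∧ e.target = Metric.ball (0 : Plane) 1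

/-- `Φ` is a Hamiltonian circle action on `D` generated by `H`: a smooth action of `ℝ` on `D` that
is `τ`-periodic, that is, an action of the circle `ℝ/τℤ`, and whose orbits are the orbits of
`H`. -/
structure IsHamiltonianCircleAction (Ω : SymplecticForm N) (H : N → ℝ) (D : Set N) (τ : ℝ)
    (Φ : ℝ → N → N) : Prop where
  pos : 0 < τ
  smooth : ContMDiffOn (𝓘(ℝ, ℝ).prod (𝓡 2)) (𝓡 2) ∞ (fun p : ℝ × N ↦ Φ p.1 p.2) (univ ×ˢ D)
  mapsTo : ∀ t, MapsTo (Φ t) D D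
  map_zero : ∀ z ∈ D, Φ 0 z = z
  map_add : ∀ s t, ∀ z ∈ D, Φ (s + t) z = Φ s (Φ t z)
  periodic : ∀ z ∈ D, Φ τ z = z
  orbit : ∀ z ∈ D, IsHamiltonianOrbit Ω H (fun t ↦ Φ t z)

/-- `H` generates a Hamiltonian circle action on `D` with `z₀` as the only fixed point. -/
def GeneratesCircleActionWithFixedPoint (Ω : SymplecticForm N) (H : N → ℝ) (D : Set N) (z₀ : N) :
    Prop :=
  ∃ (τ : ℝ) (Φ : ℝ → N → N), IsHamiltonianCircleAction Ω H D τ Φ ∧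
    {z ∈ D | ∀ t, Φ t z = z} = {z₀}

end Orbits

/-! Only the forward half needs an argument: replacing `Ω` and `H` by their negatives keeps the
Hamiltonian vector field and the area, reverses the levels, and turns the backward half into the
forward one.

Let `φ` be the flow, which is complete and smooth because `H` is proper. Along an orbit cylinder the
least period is a smooth function of the level, so resonance makes it a constant `T`
(`exists_common_period`). If `q` is a section of the cylinder, the map `(c, t) ↦ φ t (q c)` pulls
the symplectic form back to `dc ∧ dt`; hence a cylinder over an interval of length `ℓ` occupies area
at least `ℓ * T` (`mul_le_area`), and finite area bounds the levels. Let `cp` be their supremum. By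
properness the points `q c` accumulate, as `c` increases to `cp`, at some `z` on the level `cp`.

The point `z` is critical. Otherwise a section of the level sets passes through `z`, and `z` is
periodic as a limit of `T`-periodic points. The first-return map of that section is the identity,
because the flow preserves `H` and the section meets each level once. So all nearby orbits are
closed and the cylinder continues past `cp` (`exists_extension`), against maximality. The same
argument shows that the level `cp` itself does not belong to the cylinder.

The point `z` is a non-degenerate maximum (`chartHessian_neg`). The linearisation `A` of the vector
field at `z` satisfies `A² = δ • id`, with `δ` a negative multiple of the Hessian determinant. If `δ
≥ 0`, an averaging estimate excludes non-constant orbits of period `T` near `z`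
(`eventually_periodic_orbit_constant`), yet such orbits accumulate there. So the Hessian is
definite, and it is negative because lower levels accumulate at `z`.

In a Morse chart at `z` the nearby levels are round circles. The cylinder is relatively clopen among
the points over its open range of levels, so it contains the whole punctured Morse disc. To pass
from this small disc to the full union of circles, the levels are stretched by a diffeomorphism of
the line that is the identity near `cp`. It lifts to a flow-equivariant map (`levelShift`), well
defined because all orbits have the same period, and identifies the union with the Morse disc
(`isEmbeddedDisc`). The circle action is the flow itself, with period `T`. -/

/-! ### Smooth dependence of local flows on initial conditions -/

section LocalFlow

universe u

open Metric Filter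

/-- Two-sided Grönwall inequality on a symmetric interval. -/
theorem norm_le_of_norm_deriv_le_two_sided {E : Type*} [NormedAddCommGroup E] [NormedSpace ℝ E]
    {e e' : ℝ → E} {ε K η : ℝ} (hK : 0 < K) (hη : 0 ≤ η)
    (he : ∀ t ∈ Ioo (-ε) ε, HasDerivAt e (e' t) t)
    (hb : ∀ t ∈ Ioo (-ε) ε, ‖e' t‖ ≤ K * ‖e t‖ + η) {t : ℝ} (ht : t ∈ Ioo (-ε) ε) :
    ‖e t‖ ≤ ‖e 0‖ * Real.exp (K * ε) + η / K * Real.exp (K * ε) := by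
  have key : ∀ (f f' : ℝ → E), (∀ t ∈ Ioo (-ε) ε, HasDerivAt f (f' t) t) →
      (∀ t ∈ Ioo (-ε) ε, ‖f' t‖ ≤ K * ‖f t‖ + η) → ∀ s, 0 ≤ s → s < ε →
      ‖f s‖ ≤ ‖f 0‖ * Real.exp (K * ε) + η / K * Real.exp (K * ε) := by
    intro f f' hf hfb s hs0 hsε
    have hsub : ∀ r ∈ Icc 0 s, r ∈ Ioo (-ε) ε := fun r hr ↦
      ⟨by linarith [hr.1], by linarith [hr.2]⟩
    have h := norm_le_gronwallBound_of_norm_deriv_right_le (f := f) (f' := f') (δ := ‖f 0‖)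
      (K := K) (ε := η) (a := 0) (b := s)
      (fun r hr ↦ (hf r (hsub r hr)).continuousAt.continuousWithinAt)
      (fun r hr ↦ (hf r (hsub r (Ico_subset_Icc_self hr))).hasDerivWithinAt) le_rfl
      (fun r hr ↦ hfb r (hsub r (Ico_subset_Icc_self hr))) s ⟨hs0, le_rfl⟩
    rw [gronwallBound_of_K_ne_0 hK.ne'] at h
    simp only [sub_zero] at h
    have h1 : Real.exp (K * s) ≤ Real.exp (K * ε) := by
      apply Real.exp_le_exp.mpr; nlinarith
    have h2 : 0 ≤ η / K := by positivity
    calc ‖f s‖ ≤ ‖f 0‖ * Real.exp (K * s) + η / K * (Real.exp (K * s) - 1) := h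
      _ ≤ ‖f 0‖ * Real.exp (K * ε) + η / K * Real.exp (K * ε) := by
        gcongr
        linarith
  rcases le_total 0 t with h0 | h0
  · exact key e e' he hb t h0 ht.2
  · have hm : ∀ r ∈ Ioo (-ε) ε, -r ∈ Ioo (-ε) ε := fun r hr ↦
      ⟨by linarith [hr.2], by linarith [hr.1]⟩
    have := key (fun s ↦ e (-s)) (fun s ↦ - e' (-s)) (fun r hr ↦ by
        simpa [Function.comp_def] using (he (-r) (hm r hr)).scomp r (hasDerivAt_neg r))
      (fun r hr ↦ by simpa using hb (-r) (hm r hr)) (-t) (by linarith) (by linarith [ht.1])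
    simpa using this

/-- Taylor estimate for a map whose derivative is Lipschitz on a convex set. -/
theorem Convex.norm_sub_sub_fderiv_le {E F : Type*} [NormedAddCommGroup E] [NormedSpace ℝ E]
    [NormedAddCommGroup F] [NormedSpace ℝ F] {V : E → F} {B : Set E} (hB : Convex ℝ B)
    {V' : E → E →L[ℝ] F} {K : ℝ} (hK : 0 ≤ K) (hV : ∀ x ∈ B, HasFDerivAt V (V' x) x)
    (hV' : ∀ x ∈ B, ∀ y ∈ B, ‖V' y - V' x‖ ≤ K * ‖y - x‖) {x y : E} (hx : x ∈ B) (hy : y ∈ B) :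
    ‖V y - V x - V' x (y - x)‖ ≤ K * ‖y - x‖ ^ 2 := by
  have hseg : segment ℝ x y ⊆ B := hB.segment_subset hx hy
  have := (convex_segment x y).norm_image_sub_le_of_norm_hasFDerivWithin_le' (f := V) (f' := V')
    (φ := V' x) (C := K * ‖y - x‖)
    (fun z hz ↦ (hV z (hseg hz)).hasFDerivWithinAt)
    (fun z hz ↦ (hV' x hx z (hseg hz)).trans (by
      gcongr
      obtain ⟨a, b, ha, hb, hab, rfl⟩ := hz
      have : a • x + b • y - x = b • (y - x) := by
        rw [← eq_sub_iff_add_eq] at hab; subst hab; module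
      rw [this, norm_smul, Real.norm_of_nonneg hb]
      nlinarith [norm_nonneg (y - x)])) (left_mem_segment ℝ x y) (right_mem_segment ℝ x y)
  nlinarith [this]

/-- Induction on the order of differentiability. The field together with its variational equation is
again a smooth field, on `E × (E →L[ℝ] E)`, and has a flow of class `C^n` by induction. Its second
component is shown to be the space derivative of the first, so the first is `C^(n+1)`. The domain
may shrink at each stage, which is why `n` is finite here. -/
theorem exists_contDiffOn_local_flow (n : ℕ) : ∀ {E : Type u} [NormedAddCommGroup E]
    [NormedSpace ℝ E] [CompleteSpace E] {V : E → E} {U : Set E} (_ : IsOpen U)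
    (_ : ContDiffOn ℝ ∞ V U) {x₀ : E} (_ : x₀ ∈ U),
    ∃ W : Set E, IsOpen W ∧ x₀ ∈ W ∧ ∃ ε > 0, ∃ α : E × ℝ → E,
      ContDiffOn ℝ n α (W ×ˢ Ioo (-ε) ε) ∧ ∀ x ∈ W, α (x, 0) = x ∧
        ∀ t ∈ Ioo (-ε) ε, α (x, t) ∈ U ∧ HasDerivAt (fun s ↦ α (x, s)) (V (α (x, t))) t := by
  induction n with
  | zero =>
    intro E _ _ _ V U hU hV x₀ hx₀
    have hV1 : ContDiffAt ℝ 1 V x₀ :=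
      ((hV x₀ hx₀).contDiffAt (hU.mem_nhds hx₀)).of_le (by exact_mod_cast le_top)
    obtain ⟨ε, hε, a, r, L, K, hr, hpl⟩ := IsPicardLindelof.of_contDiffAt_one hV1
    obtain ⟨α, hα, hcont⟩ :=
      (hpl 0).exists_forall_mem_closedBall_eq_hasDerivWithinAt_continuousOn
    simp only [zero_sub, zero_add] at hα hcont
    have hx0r : x₀ ∈ closedBall x₀ (r : ℝ) := mem_closedBall_self r.2
    have h00 : (x₀, (0 : ℝ)) ∈ ball x₀ r ×ˢ Ioo (-ε) ε :=
      ⟨mem_ball_self hr, by constructor <;> linarith⟩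
    have hcont' : ContinuousOn α (ball x₀ r ×ˢ Ioo (-ε) ε) :=
      hcont.mono (prod_mono ball_subset_closedBall Ioo_subset_Icc_self)
    have hca : ContinuousAt α (x₀, 0) :=
      hcont'.continuousAt ((isOpen_ball.prod isOpen_Ioo).mem_nhds h00)
    have hnh : α ⁻¹' U ∈ 𝓝 (x₀, (0 : ℝ)) := hca (hU.mem_nhds (by
      have : α (x₀, 0) = x₀ := (hα x₀ hx0r).1
      rw [this]; exact hx₀))
    have := inter_mem hnh ((isOpen_ball.prod isOpen_Ioo).mem_nhds h00)
    obtain ⟨W, I, hW, hxW, hI, hI0, hWI⟩ := mem_nhds_prod_iff'.mp this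
    obtain ⟨δ, hδ, hδI⟩ := Metric.isOpen_iff.mp hI 0 hI0
    rw [Real.ball_eq_Ioo, zero_sub, zero_add] at hδI
    refine ⟨W, hW, hxW, δ, hδ, α, ?_, fun x hx ↦ ?_⟩
    · rw [Nat.cast_zero, contDiffOn_zero]
      exact hcont'.mono fun p hp ↦ (hWI ⟨hp.1, hδI hp.2⟩).2
    · have h0 := (hWI (⟨hx, hI0⟩ : (x, (0 : ℝ)) ∈ W ×ˢ I)).2
      refine ⟨(hα x (ball_subset_closedBall h0.1)).1, fun t ht ↦ ?_⟩
      have ht' := hWI (⟨hx, hδI ht⟩ : (x, t) ∈ W ×ˢ I)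
      exact ⟨ht'.1, ((hα x (ball_subset_closedBall h0.1)).2 t
        (Ioo_subset_Icc_self ht'.2.2)).hasDerivAt (Icc_mem_nhds ht'.2.2.1 ht'.2.2.2)⟩
  | succ n ih =>
    intro E _ _ _ V U hU hV x₀ hx₀
    have hDV : ContDiffOn ℝ ∞ (fderiv ℝ V) U := hV.fderiv_of_isOpen hU (by simp)
    have hVd : ∀ x ∈ U, HasFDerivAt V (fderiv ℝ V x) x := fun x hx ↦
      (((hV x hx).contDiffAt (hU.mem_nhds hx)).differentiableAt (by simp)).hasFDerivAt
    -- the field of the variational equation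
    let V2 : E × (E →L[ℝ] E) → E × (E →L[ℝ] E) := fun p ↦ (V p.1, (fderiv ℝ V p.1).comp p.2)
    have hV2 : ContDiffOn ℝ ∞ V2 (U ×ˢ univ) := by
      have h1 : MapsTo Prod.fst (U ×ˢ (univ : Set (E →L[ℝ] E))) U := fun p hp ↦ hp.1
      refine (hV.comp contDiffOn_fst h1).prodMk ?_
      exact (hDV.comp contDiffOn_fst h1).clm_comp contDiffOn_snd
    obtain ⟨W2, hW2, hxW2, ε2, hε2, α2, hα2, hflow2⟩ := ih (hU.prod isOpen_univ) hV2
      (x₀ := (x₀, ContinuousLinearMap.id ℝ E)) ⟨hx₀, mem_univ _⟩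
    -- a ball with Lipschitz bounds
    obtain ⟨K1, s1, hs1, hL1⟩ := (((hV x₀ hx₀).contDiffAt
      (hU.mem_nhds hx₀)).of_le (m := 1) (by exact_mod_cast le_top)).exists_lipschitzOnWith
    obtain ⟨K2, s2, hs2, hL2⟩ := (((hDV x₀ hx₀).contDiffAt
      (hU.mem_nhds hx₀)).of_le (m := 1) (by exact_mod_cast le_top)).exists_lipschitzOnWith
    obtain ⟨r, hr, hrB⟩ := Metric.mem_nhds_iff.mp
      (inter_mem (inter_mem hs1 hs2) (hU.mem_nhds hx₀))
    set B := ball x₀ r with hBdef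
    have hBU : B ⊆ U := fun x hx ↦ (hrB hx).2
    set K : ℝ := K1 + 1 with hKdef
    have hK : 0 < K := by positivity
    have hVLip : ∀ x ∈ B, ∀ y ∈ B, ‖V y - V x‖ ≤ K * ‖y - x‖ := fun x hx y hy ↦ by
      have := hL1.dist_le_mul y (hrB hy).1.1 x (hrB hx).1.1
      rw [dist_eq_norm, dist_eq_norm] at this
      nlinarith [norm_nonneg (y - x)]
    have hDVLip : ∀ x ∈ B, ∀ y ∈ B, ‖fderiv ℝ V y - fderiv ℝ V x‖ ≤ K2 * ‖y - x‖ :=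
      fun x hx y hy ↦ by
        have := hL2.dist_le_mul y (hrB hy).1.2 x (hrB hx).1.2
        rwa [dist_eq_norm, dist_eq_norm] at this
    have hDVbd : ∀ x ∈ B, ‖fderiv ℝ V x‖ ≤ K := fun x hx ↦ by
      have hs : s1 ∈ 𝓝 x := mem_of_superset (isOpen_ball.mem_nhds hx) fun y hy ↦ (hrB hy).1.1
      have := norm_fderiv_le_of_lipschitzOn (𝕜 := ℝ) hs hL1
      linarith
    -- shrink the domain
    have h00 : ((x₀, ContinuousLinearMap.id ℝ E), (0 : ℝ)) ∈ W2 ×ˢ Ioo (-ε2) ε2 :=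
      ⟨hxW2, by constructor <;> linarith⟩
    have hopen2 := hW2.prod (isOpen_Ioo (a := -ε2) (b := ε2))
    -- The derivative of the flow with respect to the initial point starts at the identity.
    let ι : E × ℝ → (E × (E →L[ℝ] E)) × ℝ := fun p ↦ ((p.1, ContinuousLinearMap.id ℝ E), p.2)
    have hι : ContDiff ℝ ∞ ι := (contDiff_fst.prodMk contDiff_const).prodMk contDiff_snd
    let β : E × ℝ → E × (E →L[ℝ] E) := α2 ∘ ι
    have hβ0 : ContinuousAt β (x₀, 0) := by
      have h1 : ContinuousAt α2 (ι (x₀, 0)) :=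
        hα2.continuousOn.continuousAt (hopen2.mem_nhds h00)
      exact h1.comp hι.continuous.continuousAt
    have hβ00 : (β (x₀, 0)).1 ∈ B := by
      have : β (x₀, 0) = (x₀, ContinuousLinearMap.id ℝ E) := (hflow2 _ hxW2).1
      rw [this]; exact mem_ball_self hr
    have hnh1 : ∀ᶠ p in 𝓝 (x₀, (0 : ℝ)), (β p).1 ∈ B :=
      (continuous_fst.continuousAt.comp hβ0).eventually (isOpen_ball.mem_nhds hβ00)
    have hnh2 : ∀ᶠ p in 𝓝 (x₀, (0 : ℝ)), ι p ∈ W2 ×ˢ Ioo (-ε2) ε2 :=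
      hι.continuous.continuousAt.eventually (hopen2.mem_nhds h00)
    obtain ⟨W, I, hW, hxW, hI, hI0, hWI⟩ := mem_nhds_prod_iff'.mp (hnh1.and hnh2)
    obtain ⟨ε, hε, hδI⟩ := Metric.isOpen_iff.mp hI 0 hI0
    rw [Real.ball_eq_Ioo, zero_sub, zero_add] at hδI
    have hdom : ∀ x ∈ W, ∀ t ∈ Ioo (-ε) ε, (β (x, t)).1 ∈ B ∧ ι (x, t) ∈ W2 ×ˢ Ioo (-ε2) ε2 :=
      fun x hx t ht ↦ hWI (⟨hx, hδI ht⟩ : (x, t) ∈ W ×ˢ I)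
    have h0ε : (0 : ℝ) ∈ Ioo (-ε) ε := by constructor <;> linarith
    have hβ_init : ∀ x ∈ W, β (x, 0) = (x, ContinuousLinearMap.id ℝ E) := fun x hx ↦
      (hflow2 _ (hdom x hx 0 h0ε).2.1).1
    have hβ_der : ∀ x ∈ W, ∀ t ∈ Ioo (-ε) ε, HasDerivAt (fun s ↦ β (x, s)) (V2 (β (x, t))) t :=
      fun x hx t ht ↦ ((hflow2 _ (hdom x hx t ht).2.1).2 t (hdom x hx t ht).2.2).2
    have hα_der : ∀ x ∈ W, ∀ t ∈ Ioo (-ε) ε,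
        HasDerivAt (fun s ↦ (β (x, s)).1) (V (β (x, t)).1) t := fun x hx t ht ↦
      (hβ_der x hx t ht).fst
    have hA_der : ∀ x ∈ W, ∀ t ∈ Ioo (-ε) ε,
        HasDerivAt (fun s ↦ (β (x, s)).2) ((fderiv ℝ V (β (x, t)).1).comp (β (x, t)).2) t :=
      fun x hx t ht ↦ (hβ_der x hx t ht).snd
    have hβ_smooth : ContDiffOn ℝ n β (W ×ˢ Ioo (-ε) ε) :=
      hα2.comp (hι.of_le (by exact_mod_cast le_top)).contDiffOn
        fun p hp ↦ (hdom p.1 hp.1 p.2 hp.2).2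
    -- quadratic estimate
    set c := Real.exp (K * ε)
    have hc : 0 < c := Real.exp_pos _
    have hlip : ∀ x ∈ W, ∀ y ∈ W, ∀ t ∈ Ioo (-ε) ε,
        ‖(β (y, t)).1 - (β (x, t)).1‖ ≤ ‖y - x‖ * c := fun x hx y hy t ht ↦ by
      have := norm_le_of_norm_deriv_le_two_sided (e := fun s ↦ (β (y, s)).1 - (β (x, s)).1)
        hK le_rfl (fun s hs ↦ (hα_der y hy s hs).sub (hα_der x hx s hs))
        (fun s hs ↦ by simpa using hVLip _ (hdom x hx s hs).1 _ (hdom y hy s hs).1) ht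
      simpa [hβ_init x hx, hβ_init y hy] using this
    have hquad : ∀ x ∈ W, ∀ y ∈ W, ∀ t ∈ Ioo (-ε) ε,
        ‖(β (y, t)).1 - (β (x, t)).1 - (β (x, t)).2 (y - x)‖ ≤
          (K2 * c ^ 2 / K * c) * ‖y - x‖ ^ 2 := fun x hx y hy t ht ↦ by
      have := norm_le_of_norm_deriv_le_two_sided
        (e := fun s ↦ (β (y, s)).1 - (β (x, s)).1 - (β (x, s)).2 (y - x))
        (e' := fun s ↦ V (β (y, s)).1 - V (β (x, s)).1 -
          (fderiv ℝ V (β (x, s)).1) ((β (x, s)).2 (y - x)))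
        (η := K2 * (‖y - x‖ * c) ^ 2) hK (by positivity)
        (fun s hs ↦ ((hα_der y hy s hs).sub (hα_der x hx s hs)).sub (by
          have := (ContinuousLinearMap.apply ℝ E (y - x)).hasFDerivAt.comp_hasDerivAt s
            (hA_der x hx s hs)
          exact this))
        (fun s hs ↦ by
          have h1 := (convex_ball x₀ r).norm_sub_sub_fderiv_le (V := V) K2.2
            (fun z hz ↦ hVd z (hBU hz)) hDVLip (hdom x hx s hs).1 (hdom y hy s hs).1
          have h2 := hDVbd _ (hdom x hx s hs).1
          have h3 := hlip x hx y hy s hs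
          set D := fderiv ℝ V (β (x, s)).1
          set d := (β (y, s)).1 - (β (x, s)).1
          set a := (β (x, s)).2 (y - x)
          -- The error of the linear approximation satisfies the linearised equation up to the
          -- Taylor remainder of `V`, which is quadratic in `y - x` by `hlip`; Grönwall then keeps
          -- the error quadratic.
          have h4 : V (β (y, s)).1 - V (β (x, s)).1 - D a =
              D (d - a) + (V (β (y, s)).1 - V (β (x, s)).1 - D d) := by
            rw [map_sub]; abel
          rw [h4]
          refine (norm_add_le _ _).trans (add_le_add ?_ (h1.trans ?_))
          · exact (D.le_opNorm _).trans (by gcongr)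
          · exact mul_le_mul_of_nonneg_left (by gcongr) K2.2) ht
      simp only [hβ_init x hx, hβ_init y hy, ContinuousLinearMap.id_apply, sub_self, norm_zero,
        zero_mul, zero_add] at this
      refine this.trans (le_of_eq ?_)
      ring
    have hfd : ∀ p ∈ W ×ˢ Ioo (-ε) ε, HasFDerivAt (fun q ↦ (β q).1)
        (((β p).2).coprod (ContinuousLinearMap.toSpanSingleton ℝ (V (β p).1))) p := by
      rintro ⟨x, t⟩ ⟨hx, ht⟩
      rw [hasFDerivAt_iff_isLittleO_nhds_zero, Asymptotics.isLittleO_iff]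
      intro κ hκ
      set M := K2 * c ^ 2 / K * c
      have hM : 0 ≤ M := by positivity
      have e1 : ∀ᶠ h : E × ℝ in 𝓝 0, x + h.1 ∈ W ∧ t + h.2 ∈ Ioo (-ε) ε := by
        have h1 : Continuous (fun h : E × ℝ ↦ (x + h.1, t + h.2)) := by fun_prop
        exact (h1.tendsto' 0 (x, t) (by simp)).eventually
          ((hW.prod isOpen_Ioo).mem_nhds (⟨hx, ht⟩ : (x, t) ∈ W ×ˢ Ioo (-ε) ε))
      have e2 : ∀ᶠ h : E × ℝ in 𝓝 0, M * ‖h.1‖ < κ / 3 := by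
        have : Tendsto (fun h : E × ℝ ↦ M * ‖h.1‖) (𝓝 0) (𝓝 (M * ‖(0 : E × ℝ).1‖)) :=
          Continuous.tendsto (by fun_prop) _
        simp only [Prod.fst_zero, norm_zero, mul_zero] at this
        exact this.eventually (gt_mem_nhds (by positivity))
      have e3 : ∀ᶠ h : E × ℝ in 𝓝 0,
          ‖(β (x, t + h.2)).1 - (β (x, t)).1 - h.2 • V (β (x, t)).1‖ ≤ κ / 3 * ‖h.2‖ := by
        have := (hasDerivAt_iff_isLittleO_nhds_zero.mp (hα_der x hx t ht))
        rw [Asymptotics.isLittleO_iff] at this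
        exact (continuous_snd.tendsto' (0 : E × ℝ) 0 rfl).eventually (this (by positivity))
      have e4 : ∀ᶠ h : E × ℝ in 𝓝 0, ‖(β (x, t + h.2)).2 - (β (x, t)).2‖ < κ / 3 := by
        have h1 : ContinuousAt (fun s ↦ (β (x, s)).2) t := (hA_der x hx t ht).continuousAt
        have h2 : Tendsto (fun h : E × ℝ ↦ t + h.2) (𝓝 0) (𝓝 t) := by
          have : Continuous (fun h : E × ℝ ↦ t + h.2) := by fun_prop
          exact this.tendsto' _ _ (by simp)
        have h3 := (h1.tendsto.comp h2).sub_const (β (x, t)).2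
        rw [sub_self] at h3
        have h4 := h3.norm
        rw [norm_zero] at h4
        exact h4.eventually (gt_mem_nhds (by positivity))
      filter_upwards [e1, e2, e3, e4] with h h1 h2 h3 h4
      have h5 := hquad x hx (x + h.1) h1.1 (t + h.2) h1.2
      rw [add_sub_cancel_left] at h5
      have hn1 : ‖h.1‖ ≤ ‖h‖ := norm_fst_le h
      have hn2 : ‖h.2‖ ≤ ‖h‖ := norm_snd_le h
      -- Three errors: moving the initial point at time `t + h.2`, moving time at the fixed point
      -- `x`, and replacing the linearisation at time `t + h.2` by that at time `t`.
      have h6 : (β ((x, t) + h)).1 - (β (x, t)).1 -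
          (((β (x, t)).2).coprod (ContinuousLinearMap.toSpanSingleton ℝ (V (β (x, t)).1))) h =
          ((β (x + h.1, t + h.2)).1 - (β (x, t + h.2)).1 - (β (x, t + h.2)).2 h.1) +
          ((β (x, t + h.2)).1 - (β (x, t)).1 - h.2 • V (β (x, t)).1) +
          ((β (x, t + h.2)).2 - (β (x, t)).2) h.1 := by
        have : (x, t) + h = (x + h.1, t + h.2) := rfl
        rw [this, ContinuousLinearMap.coprod_apply,
          ContinuousLinearMap.toSpanSingleton_apply, sub_apply]
        abel
      rw [h6]
      have h7 : ‖((β (x, t + h.2)).2 - (β (x, t)).2) h.1‖ ≤ κ / 3 * ‖h.1‖ :=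
        (ContinuousLinearMap.le_opNorm _ _).trans (by gcongr)
      have h8 : M * ‖h.1‖ ^ 2 ≤ κ / 3 * ‖h.1‖ := by nlinarith [norm_nonneg h.1]
      refine (norm_add₃_le).trans ?_
      nlinarith
    refine ⟨W, hW, hxW, ε, hε, fun q ↦ (β q).1, ?_, fun x hx ↦ ⟨by simp [hβ_init x hx],
      fun t ht ↦ ⟨hBU (hdom x hx t ht).1, hα_der x hx t ht⟩⟩⟩
    have hop : IsOpen (W ×ˢ Ioo (-ε) ε) := hW.prod isOpen_Ioo
    have hs1 : ContDiffOn ℝ n (fun q ↦ (β q).1) (W ×ˢ Ioo (-ε) ε) := hβ_smooth.fst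
    have hs2 : ContDiffOn ℝ n (fun q ↦ (β q).2) (W ×ˢ Ioo (-ε) ε) := hβ_smooth.snd
    rw [Nat.cast_succ, contDiffOn_succ_iff_hasFDerivWithinAt_of_uniqueDiffOn hop.uniqueDiffOn]
    refine ⟨by simp, _, ?_, fun p hp ↦ (hfd p hp).hasFDerivWithinAt⟩
    have hs3 : ContDiffOn ℝ n (fun q ↦ V (β q).1) (W ×ˢ Ioo (-ε) ε) :=
      (hV.of_le (by exact_mod_cast le_top)).comp hs1
        fun p hp ↦ hBU (hdom p.1 hp.1 p.2 hp.2).1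
    have h1 : ContDiffOn ℝ n (fun p ↦ ((β p).2).comp (ContinuousLinearMap.fst ℝ E ℝ) +
        (ContinuousLinearMap.toSpanSingletonCLE (𝕜 := ℝ) (V (β p).1)).comp
          (ContinuousLinearMap.snd ℝ E ℝ)) (W ×ˢ Ioo (-ε) ε) := by
      refine (hs2.clm_comp contDiffOn_const).add (ContDiffOn.clm_comp ?_ contDiffOn_const)
      exact (ContinuousLinearEquiv.contDiff _).comp_contDiffOn hs3
    refine h1.congr fun p hp ↦ ?_
    ext <;> simp

end LocalFlow

/-! ### Differentiation under the integral sign -/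

section ParametricIntegral

universe u

/-- The integration interval is compact, so a bound `C` on the partial derivative at `x` gives the
bound `C + 1` uniformly for all parameters near `x`; this is the dominating function. -/
theorem hasFDerivAt_intervalIntegral_of_contDiffOn {E F : Type u} [NormedAddCommGroup E]
    [NormedSpace ℝ E] [NormedAddCommGroup F] [NormedSpace ℝ F] [CompleteSpace F]
    {U : Set E} {V : Set ℝ} (hU : IsOpen U) (hV : IsOpen V) {a b : ℝ} (hab : uIcc a b ⊆ V)
    {f : E × ℝ → F} (hf : ContDiffOn ℝ ∞ f (U ×ˢ V)) {x : E} (hx : x ∈ U) :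
    HasFDerivAt (fun x ↦ ∫ s in a..b, f (x, s))
      (∫ s in a..b, (fderiv ℝ f (x, s)).comp (ContinuousLinearMap.inl ℝ E ℝ)) x := by
  have hop : IsOpen (U ×ˢ V) := hU.prod hV
  have hD : ContDiffOn ℝ ∞ (fderiv ℝ f) (U ×ˢ V) := hf.fderiv_of_isOpen hop (by simp)
  have hDc : ContinuousOn (fun p ↦ (fderiv ℝ f p).comp (ContinuousLinearMap.inl ℝ E ℝ))
      (U ×ˢ V) := hD.continuousOn.clm_comp continuousOn_const
  have hmeas : ∀ {G : Type u} [NormedAddCommGroup G] (g : E × ℝ → G), ContinuousOn g (U ×ˢ V) →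
      ∀ y ∈ U, ContinuousOn (fun s ↦ g (y, s)) (uIcc a b) := fun g hg y hy ↦
    hg.comp (by fun_prop) fun s hs ↦ ⟨hy, hab hs⟩
  obtain ⟨C, hC⟩ : ∃ C, ∀ s ∈ uIcc a b,
      ‖(fderiv ℝ f (x, s)).comp (ContinuousLinearMap.inl ℝ E ℝ)‖ ≤ C :=
    isCompact_uIcc.exists_bound_of_continuousOn (hmeas _ hDc x hx)
  have hev : ∀ᶠ y in 𝓝 x, ∀ s ∈ uIcc a b, y ∈ U ∧
      ‖(fderiv ℝ f (y, s)).comp (ContinuousLinearMap.inl ℝ E ℝ)‖ < C + 1 := by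
    apply isCompact_uIcc.eventually_forall_of_forall_eventually
    intro s hs
    have h1 : (U ×ˢ V) ∈ 𝓝 (x, s) := hop.mem_nhds ⟨hx, hab hs⟩
    have h2 := ((hDc.continuousAt h1).norm).eventually (gt_mem_nhds (show _ < C + 1 by
      linarith [hC s hs]))
    filter_upwards [h1, h2] with p hp1 hp2 using ⟨hp1.1, hp2⟩
  refine intervalIntegral.hasFDerivAt_integral_of_dominated_of_fderiv_le hev
    (bound := fun _ ↦ C + 1)
    (F' := fun x s ↦ (fderiv ℝ f (x, s)).comp (ContinuousLinearMap.inl ℝ E ℝ))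
    (F := fun x s ↦ f (x, s)) ?_ ?_ ?_ ?_ ?_ ?_
  · filter_upwards [hU.mem_nhds hx] with y hy
    exact ((hmeas f hf.continuousOn y hy).mono uIoc_subset_uIcc).aestronglyMeasurable
      measurableSet_uIoc
  · exact (hmeas f hf.continuousOn x hx).intervalIntegrable
  · exact ((hmeas _ hDc x hx).mono uIoc_subset_uIcc).aestronglyMeasurable measurableSet_uIoc
  · exact Filter.Eventually.of_forall fun s hs y hy ↦ (hy s (uIoc_subset_uIcc hs)).2.le
  · exact intervalIntegrable_const
  · refine Filter.Eventually.of_forall fun s hs y hy ↦ ?_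
    have hs' := uIoc_subset_uIcc hs
    have h1 : (y, s) ∈ U ×ˢ V := ⟨(hy s hs').1, hab hs'⟩
    have h2 : HasFDerivAt f (fderiv ℝ f (y, s)) (y, s) :=
      (((hf _ h1).contDiffAt (hop.mem_nhds h1)).differentiableAt (by simp)).hasFDerivAt
    exact h2.comp y (hasFDerivAt_prodMk_left y s)

/-- Integrals over a compact interval depend smoothly on parameters. -/
theorem ContDiffOn.intervalIntegral_param {E F : Type u} [NormedAddCommGroup E]
    [NormedSpace ℝ E] [NormedAddCommGroup F] [NormedSpace ℝ F] [CompleteSpace F]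
    {U : Set E} {V : Set ℝ} (hU : IsOpen U) (hV : IsOpen V) {a b : ℝ} (hab : uIcc a b ⊆ V)
    {f : E × ℝ → F} (hf : ContDiffOn ℝ ∞ f (U ×ˢ V)) :
    ContDiffOn ℝ ∞ (fun x ↦ ∫ s in a..b, f (x, s)) U := by
  rw [contDiffOn_infty]
  intro n
  -- Differentiating the integrand replaces its value space `F` by `E →L[ℝ] F`, so `F` has to vary
  -- in the induction.
  induction n generalizing F with
  | zero =>
    rw [Nat.cast_zero, contDiffOn_zero]
    exact fun x hx ↦ (hasFDerivAt_intervalIntegral_of_contDiffOn hU hV hab hf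
      hx).continuousAt.continuousWithinAt
  | succ n ih =>
    rw [Nat.cast_succ, contDiffOn_succ_iff_hasFDerivWithinAt_of_uniqueDiffOn hU.uniqueDiffOn]
    refine ⟨by simp, _, ?_, fun x hx ↦
      (hasFDerivAt_intervalIntegral_of_contDiffOn hU hV hab hf hx).hasFDerivWithinAt⟩
    exact ih (f := fun p ↦ (fderiv ℝ f p).comp (ContinuousLinearMap.inl ℝ E ℝ))
      ((hf.fderiv_of_isOpen (hU.prod hV) (by simp)).clm_comp contDiffOn_const)

end ParametricIntegral

/-! ### The inverse function theorem for smooth maps -/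

section InverseFunction

/-- The inverse function theorem in the form: a smooth map with injective derivative at a point,
between spaces of the same finite dimension, restricts to a diffeomorphism of open sets. -/
theorem exists_openPartialHomeomorph_of_injective_fderiv {E F : Type*} [NormedAddCommGroup E]
    [NormedSpace ℝ E] [FiniteDimensional ℝ E] [NormedAddCommGroup F] [NormedSpace ℝ F]
    [FiniteDimensional ℝ F] (hdim : Module.finrank ℝ E = Module.finrank ℝ F)
    {f : E → F} {S : Set E} (hS : IsOpen S) (hf : ContDiffOn ℝ ∞ f S) {x : E} (hx : x ∈ S)
    (hinj : Function.Injective (fderiv ℝ f x)) :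
    ∃ e : OpenPartialHomeomorph E F, x ∈ e.source ∧ e.source ⊆ S ∧ (∀ y, e y = f y) ∧
      ContDiffOn ℝ ∞ e e.source ∧ ContDiffOn ℝ ∞ e.symm e.target := by
  have : CompleteSpace E := FiniteDimensional.complete ℝ E
  have : CompleteSpace F := FiniteDimensional.complete ℝ F
  have hfx : ∀ y ∈ S, ContDiffAt ℝ ∞ f y := fun y hy ↦ (hf y hy).contDiffAt (hS.mem_nhds hy)
  let D : E ≃L[ℝ] F :=
    (LinearEquiv.ofInjectiveOfFinrankEq (fderiv ℝ f x).toLinearMap hinj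
      hdim).toContinuousLinearEquiv
  have hD : (D : E →L[ℝ] F) = fderiv ℝ f x := by ext v; rfl
  have hfD : HasFDerivAt f (D : E →L[ℝ] F) x := by
    rw [hD]; exact ((hfx x hx).differentiableAt (by simp)).hasFDerivAt
  let e₀ := (hfx x hx).toOpenPartialHomeomorph f hfD (by simp)
  have hx₀ : x ∈ e₀.source := (hfx x hx).mem_toOpenPartialHomeomorph_source hfD (by simp)
  have hc : ContinuousOn (fderiv ℝ f) S :=
    (hf.fderiv_of_isOpen (m := ∞) hS (by simp)).continuousOn
  -- Invertibility of the derivative is an open condition; restricting to it makes the inverse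
  -- smooth on the whole target, not just at one point.
  have hS' : IsOpen (S ∩ fderiv ℝ f ⁻¹' range ((↑) : (E ≃L[ℝ] F) → E →L[ℝ] F)) :=
    hc.isOpen_inter_preimage hS ContinuousLinearEquiv.isOpen
  set S' := S ∩ fderiv ℝ f ⁻¹' range ((↑) : (E ≃L[ℝ] F) → E →L[ℝ] F)
  let e := e₀.restrOpen S' hS'
  have hsrc : e.source = e₀.source ∩ S' := rfl
  refine ⟨e, ⟨hx₀, hx, D, hD⟩, fun y hy ↦ hy.2.1, fun y ↦ rfl,
    fun y hy ↦ (hfx y hy.2.1).contDiffWithinAt, fun y hy ↦ ?_⟩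
  have hmem := e.map_target hy
  obtain ⟨D', hD'⟩ := hmem.2.2
  refine (e.contDiffAt_symm (f₀' := D') hy ?_ (hfx _ hmem.2.1)).contDiffWithinAt
  rw [hD']
  exact ((hfx _ hmem.2.1).differentiableAt (by simp)).hasFDerivAt

end InverseFunction

/-! ### The Morse lemma in the plane -/

section Morse

/-- This writes `k` near a critical zero as a quadratic form in `x` whose coefficients are smooth
functions of `x`, the starting point of the Morse lemma. -/
theorem taylor_two_integral {E : Type} [NormedAddCommGroup E] [NormedSpace ℝ E] {k : E → ℝ} {r : ℝ}
    (hk : ContDiffOn ℝ ∞ k (Metric.ball 0 r)) (h0 : k 0 = 0) (h1 : fderiv ℝ k 0 = 0) {x : E}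
    (hx : x ∈ Metric.ball (0 : E) r) :
    k x = ∫ s in (0 : ℝ)..1, (1 - s) * fderiv ℝ (fderiv ℝ k) (s • x) x x := by
  have hop : IsOpen (Metric.ball (0 : E) r) := Metric.isOpen_ball
  have hD : ContDiffOn ℝ ∞ (fderiv ℝ k) (Metric.ball 0 r) := hk.fderiv_of_isOpen hop (by simp)
  have hD2 : ContDiffOn ℝ ∞ (fderiv ℝ (fderiv ℝ k)) (Metric.ball 0 r) :=
    hD.fderiv_of_isOpen hop (by simp)
  have hmem : ∀ s ∈ uIcc (0 : ℝ) 1, s • x ∈ Metric.ball (0 : E) r := fun s hs ↦ by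
    rw [uIcc_of_le zero_le_one] at hs
    rw [mem_ball_zero_iff] at hx ⊢
    rw [norm_smul, Real.norm_of_nonneg hs.1]
    nlinarith [norm_nonneg x, hs.2]
  have hd1 : ∀ s ∈ uIcc (0 : ℝ) 1, HasDerivAt (fun s : ℝ ↦ k (s • x)) (fderiv ℝ k (s • x) x) s :=
    fun s hs ↦ by
      have h := (((hk _ (hmem s hs)).contDiffAt (hop.mem_nhds (hmem s hs))).differentiableAt
        (by simp)).hasFDerivAt
      have h2 : HasDerivAt (fun s : ℝ ↦ s • x) x s := by
        simpa using (hasDerivAt_id s).smul_const x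
      exact h.comp_hasDerivAt s h2
  have hd2 : ∀ s ∈ uIcc (0 : ℝ) 1, HasDerivAt (fun s : ℝ ↦ fderiv ℝ k (s • x) x)
      (fderiv ℝ (fderiv ℝ k) (s • x) x x) s := fun s hs ↦ by
      have h := (((hD _ (hmem s hs)).contDiffAt (hop.mem_nhds (hmem s hs))).differentiableAt
        (by simp)).hasFDerivAt
      have h2 : HasDerivAt (fun s : ℝ ↦ s • x) x s := by
        simpa using (hasDerivAt_id s).smul_const x
      exact (ContinuousLinearMap.apply ℝ ℝ x).hasFDerivAt.comp_hasDerivAt s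
        (h.comp_hasDerivAt s h2)
  have hc : ContinuousOn (fun s : ℝ ↦ fderiv ℝ (fderiv ℝ k) (s • x)) (uIcc (0 : ℝ) 1) :=
    hD2.continuousOn.comp (continuous_id.smul continuous_const).continuousOn hmem
  -- The integrand has this explicit primitive, by integration by parts.
  rw [intervalIntegral.integral_eq_sub_of_hasDerivAt
    (f := fun s ↦ (1 - s) * fderiv ℝ k (s • x) x + k (s • x))]
  · simp [h0, h1]
  · intro s hs
    have := (((hasDerivAt_id s).const_sub 1).mul (hd2 s hs)).add (hd1 s hs)
    refine this.congr_deriv ?_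
    simp only [id]
    ring
  · apply ContinuousOn.intervalIntegrable
    have h3 := (hc.clm_apply (continuousOn_const (c := x))).clm_apply (continuousOn_const (c := x))
    exact ((continuous_const.sub continuous_id).continuousOn (s := uIcc (0 : ℝ) 1)).mul h3

theorem hasFDerivAt_mul_clm_zero {E : Type*} [NormedAddCommGroup E] [NormedSpace ℝ E] {g : E → ℝ}
    (hg : DifferentiableAt ℝ g 0) (p : E →L[ℝ] ℝ) :
    HasFDerivAt (fun x ↦ g x * p x) (g 0 • p) 0 := by
  simpa using hg.hasFDerivAt.fun_mul (p.hasFDerivAt (x := 0))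

/-- Evaluation of the second derivative on fixed vectors is smooth. -/
theorem contDiffOn_fderiv_fderiv_apply {E : Type*} [NormedAddCommGroup E] [NormedSpace ℝ E]
    {k : E → ℝ} {U : Set E} (hU : IsOpen U) (hk : ContDiffOn ℝ ∞ k U) (v w : E) :
    ContDiffOn ℝ ∞ (fun x ↦ fderiv ℝ (fderiv ℝ k) x v w) U :=
  (((hk.fderiv_of_isOpen (m := ∞) hU (by simp)).fderiv_of_isOpen (m := ∞) hU
    (by simp)).clm_apply contDiffOn_const).clm_apply contDiffOn_const

/-- The Morse lemma for a smooth function on the plane at a non-degenerate minimum, centred at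
the origin. -/
theorem exists_morse_chart_aux {k : Plane → ℝ} {r : ℝ} (hr : 0 < r)
    (hk : ContDiffOn ℝ ∞ k (Metric.ball 0 r)) (h0 : k 0 = 0) (h1 : fderiv ℝ k 0 = 0)
    (hpos : ∀ v : Plane, v ≠ 0 → 0 < fderiv ℝ (fderiv ℝ k) 0 v v) :
    ∃ e : OpenPartialHomeomorph Plane Plane, 0 ∈ e.source ∧ e.source ⊆ Metric.ball 0 r ∧
      e 0 = 0 ∧ ContDiffOn ℝ ∞ e e.source ∧ ContDiffOn ℝ ∞ e.symm e.target ∧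
      ∀ x ∈ e.source, k x = ‖e x‖ ^ 2 := by
  have hop : IsOpen (Metric.ball (0 : Plane) r) := Metric.isOpen_ball
  let B : Plane → Plane → Plane → ℝ := fun v w x ↦
    ∫ s in (0 : ℝ)..1, (1 - s) * fderiv ℝ (fderiv ℝ k) (s • x) v w
  have hmem : ∀ p ∈ Metric.ball (0 : Plane) (r / 2) ×ˢ Ioo (-2 : ℝ) 2,
      p.2 • p.1 ∈ Metric.ball (0 : Plane) r := by
    rintro ⟨x, s⟩ ⟨hx, hs⟩
    rw [mem_ball_zero_iff] at hx ⊢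
    rw [norm_smul, Real.norm_eq_abs]
    have := abs_lt.mpr hs
    nlinarith [norm_nonneg x, abs_nonneg s]
  have h01 : uIcc (0 : ℝ) 1 ⊆ Ioo (-2) 2 := by
    rw [uIcc_of_le zero_le_one]
    exact fun s hs ↦ ⟨by linarith [hs.1], by linarith [hs.2]⟩
  have hBs : ∀ v w : Plane, ContDiffOn ℝ ∞
      (fun p : Plane × ℝ ↦ (1 - p.2) * fderiv ℝ (fderiv ℝ k) (p.2 • p.1) v w)
      (Metric.ball (0 : Plane) (r / 2) ×ˢ Ioo (-2 : ℝ) 2) := fun v w ↦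
    (contDiff_const.sub contDiff_snd).contDiffOn.mul
      ((contDiffOn_fderiv_fderiv_apply hop hk v w).comp
        (contDiff_snd.smul contDiff_fst).contDiffOn hmem)
  have hBij : ∀ v w : Plane, ContDiffOn ℝ ∞ (B v w) (Metric.ball 0 (r / 2)) := fun v w ↦
    ContDiffOn.intervalIntegral_param Metric.isOpen_ball isOpen_Ioo h01 (hBs v w)
  let e0 : Plane := EuclideanSpace.single 0 1
  let e1 : Plane := EuclideanSpace.single 1 1
  have hdec : ∀ x : Plane, x = x 0 • e0 + x 1 • e1 := fun x ↦ by
    ext i; fin_cases i <;> simp [e0, e1]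
  let a : Plane → ℝ := B e0 e0
  -- Averaging the two mixed coefficients does not change the quadratic form and makes the symmetry
  -- of second derivatives unnecessary.
  let b : Plane → ℝ := fun x ↦ (B e0 e1 x + B e1 e0 x) / 2
  let d : Plane → ℝ := B e1 e1
  have ha : ContDiffOn ℝ ∞ a (Metric.ball 0 (r / 2)) := hBij _ _
  have hb : ContDiffOn ℝ ∞ b (Metric.ball 0 (r / 2)) := ((hBij _ _).add (hBij _ _)).div_const 2
  have hd : ContDiffOn ℝ ∞ d (Metric.ball 0 (r / 2)) := hBij _ _
  have hquad : ∀ x ∈ Metric.ball (0 : Plane) (r / 2), ∀ v : Plane,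
      B v v x = a x * v 0 ^ 2 + 2 * b x * (v 0 * v 1) + d x * v 1 ^ 2 := by
    intro x hx v
    have hint : ∀ v w : Plane, IntervalIntegrable
        (fun s : ℝ ↦ (1 - s) * fderiv ℝ (fderiv ℝ k) (s • x) v w) volume 0 1 := fun v w ↦
      ((hBs v w).continuousOn.comp (f := fun s : ℝ ↦ (x, s))
        (by fun_prop) fun s hs ↦ ⟨hx, h01 hs⟩).intervalIntegrable
    have h2 : B v v x = ∫ s in (0 : ℝ)..1,
        (v 0 ^ 2 * ((1 - s) * fderiv ℝ (fderiv ℝ k) (s • x) e0 e0) +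
        v 0 * v 1 * ((1 - s) * fderiv ℝ (fderiv ℝ k) (s • x) e0 e1) +
        v 0 * v 1 * ((1 - s) * fderiv ℝ (fderiv ℝ k) (s • x) e1 e0) +
        v 1 ^ 2 * ((1 - s) * fderiv ℝ (fderiv ℝ k) (s • x) e1 e1)) := by
      refine intervalIntegral.integral_congr fun s _ ↦ ?_
      generalize fderiv ℝ (fderiv ℝ k) (s • x) = Q
      conv_lhs => rw [hdec v]
      simp only [map_add, map_smul, add_apply, smul_apply, smul_eq_mul]
      ring
    rw [h2, intervalIntegral.integral_add, intervalIntegral.integral_add,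
      intervalIntegral.integral_add]
    · simp only [intervalIntegral.integral_const_mul, a, b, d, B]
      ring
    all_goals
      first
      | exact (hint _ _).const_mul _
      | exact ((hint _ _).const_mul _).add ((hint _ _).const_mul _)
      | exact (((hint _ _).const_mul _).add ((hint _ _).const_mul _)).add
          ((hint _ _).const_mul _)
  have h0r : (0 : Plane) ∈ Metric.ball 0 (r / 2) := Metric.mem_ball_self (by linarith)
  have hB0 : ∀ v : Plane, v ≠ 0 → 0 < B v v 0 := by
    intro v hv
    have : B v v 0 = (1 / 2 : ℝ) * fderiv ℝ (fderiv ℝ k) 0 v v := by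
      simp only [B, smul_zero]
      rw [intervalIntegral.integral_mul_const]
      congr 1
      rw [intervalIntegral.integral_sub (by simp) (by simp)]
      norm_num
    rw [this]
    have := hpos v hv
    positivity
  have ha0 : 0 < a 0 := hB0 e0 fun h ↦ by simpa [e0] using congrArg (· 0) h
  -- The vector `(-b, a)` is orthogonal to the first basis vector for the form, so its value
  -- isolates the second pivot.
  have hdisc0 : 0 < d 0 - b 0 ^ 2 / a 0 := by
    have h := hB0 (!₂[-b 0, a 0]) fun h ↦ ha0.ne' (by simpa using congrArg (· 1) h)
    rw [hquad 0 h0r] at h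
    simp only [Matrix.cons_val_zero, Matrix.cons_val_one] at h
    have h2 : a 0 * (-b 0) ^ 2 + 2 * b 0 * (-b 0 * a 0) + d 0 * a 0 ^ 2 =
      a 0 ^ 2 * (d 0 - b 0 ^ 2 / a 0) := by field_simp; ring
    rw [h2] at h
    exact pos_of_mul_pos_right h (by positivity)
  let S1 := Metric.ball (0 : Plane) (r / 2) ∩ a ⁻¹' Ioi 0
  have hS1 : IsOpen S1 := ha.continuousOn.isOpen_inter_preimage Metric.isOpen_ball isOpen_Ioi
  have hq : ContDiffOn ℝ ∞ (fun x ↦ d x - b x ^ 2 / a x) S1 :=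
    (hd.mono inter_subset_left).sub (((hb.mono inter_subset_left).pow 2).div
      (ha.mono inter_subset_left) fun x hx ↦ (ne_of_gt hx.2))
  let S := S1 ∩ (fun x ↦ d x - b x ^ 2 / a x) ⁻¹' Ioi 0
  have hS : IsOpen S := hq.continuousOn.isOpen_inter_preimage hS1 isOpen_Ioi
  have h0S : (0 : Plane) ∈ S := ⟨⟨Metric.mem_ball_self (by linarith), ha0⟩, hdisc0⟩
  have hSr : S ⊆ Metric.ball 0 (r / 2) := fun x hx ↦ hx.1.1
  let p0 : Plane →L[ℝ] ℝ := EuclideanSpace.proj 0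
  let p1 : Plane →L[ℝ] ℝ := EuclideanSpace.proj 1
  -- Completing the square: `a v₀² + 2b v₀v₁ + d v₁²` equals `(α v₀ + β v₁)² + (γ v₁)²`. On `S` both
  -- pivots are positive, so the coefficients are smooth.
  let α : Plane → ℝ := fun x ↦ √(a x)
  let β : Plane → ℝ := fun x ↦ √(a x) * (b x / a x)
  let γ : Plane → ℝ := fun x ↦ √(d x - b x ^ 2 / a x)
  have hα : ContDiffOn ℝ ∞ α S := (ha.mono hSr).sqrt fun x hx ↦ ne_of_gt hx.1.2
  have hβ : ContDiffOn ℝ ∞ β S :=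
    hα.mul ((hb.mono hSr).div (ha.mono hSr) fun x hx ↦ ne_of_gt hx.1.2)
  have hγ : ContDiffOn ℝ ∞ γ S := (hq.mono inter_subset_left).sqrt fun x hx ↦ ne_of_gt hx.2
  let f : Plane → Plane := fun x ↦ !₂[α x * p0 x + β x * p1 x, γ x * p1 x]
  have hf : ContDiffOn ℝ ∞ f S := by
    rw [contDiffOn_euclidean]
    intro i
    fin_cases i
    · exact (hα.mul p0.contDiff.contDiffOn).add (hβ.mul p1.contDiff.contDiffOn)
    · exact hγ.mul p1.contDiff.contDiffOn
  have hder : ∀ (g : Plane → ℝ), ContDiffOn ℝ ∞ g S → ∀ p : Plane →L[ℝ] ℝ,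
      HasFDerivAt (fun x ↦ g x * p x) (g 0 • p) 0 := by
    intro g hg p
    have h2 := ((hg 0 h0S).contDiffAt (hS.mem_nhds h0S)).differentiableAt (by simp)
    exact hasFDerivAt_mul_clm_zero h2 p
  have hinj : Function.Injective (fderiv ℝ f 0) := by
    rw [injective_iff_map_eq_zero]
    intro v hv
    have hdf : DifferentiableAt ℝ f 0 :=
      ((hf 0 h0S).contDiffAt (hS.mem_nhds h0S)).differentiableAt (by simp)
    have hc0 : (fderiv ℝ f 0 v) 0 = α 0 * v 0 + β 0 * v 1 := by
      have h2 := p0.hasFDerivAt.comp 0 hdf.hasFDerivAt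
      have h3 := ((hder α hα p0).add (hder β hβ p1)).unique h2
      simpa [p0, p1] using (congrArg (fun L : Plane →L[ℝ] ℝ ↦ L v) h3).symm
    have hc1 : (fderiv ℝ f 0 v) 1 = γ 0 * v 1 := by
      have h2 := p1.hasFDerivAt.comp 0 hdf.hasFDerivAt
      have h3 := (hder γ hγ p1).unique h2
      simpa [p0, p1] using (congrArg (fun L : Plane →L[ℝ] ℝ ↦ L v) h3).symm
    rw [hv] at hc0 hc1
    have hγ0 : 0 < γ 0 := Real.sqrt_pos.mpr hdisc0
    have hα0 : 0 < α 0 := Real.sqrt_pos.mpr ha0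
    have hv1 : v 1 = 0 := by
      have : γ 0 * v 1 = 0 := by simpa using hc1.symm
      exact (mul_eq_zero.mp this).resolve_left hγ0.ne'
    have hv0 : v 0 = 0 := by
      have : α 0 * v 0 = 0 := by simpa [hv1] using hc0.symm
      exact (mul_eq_zero.mp this).resolve_left hα0.ne'
    ext i; fin_cases i <;> simp [hv0, hv1]
  obtain ⟨e, he0, heS, hef, hes, hesym⟩ :=
    exists_openPartialHomeomorph_of_injective_fderiv rfl hS hf h0S hinj
  refine ⟨e, he0, fun x hx ↦ Metric.ball_subset_ball (by linarith) (hSr (heS hx)), ?_, hes, hesym,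
    fun x hx ↦ ?_⟩
  · rw [hef]
    ext i; fin_cases i <;> simp [f]
  · have hxS := heS hx
    have hax : 0 < a x := hxS.1.2
    rw [hef, EuclideanSpace.norm_sq_eq, Fin.sum_univ_two,
      taylor_two_integral hk h0 h1 (Metric.ball_subset_ball (by linarith) (hSr hxS))]
    have h3 : (f x) 0 = √(a x) * (x 0 + b x / a x * x 1) := by
      simp [f, α, β, p0, p1]; ring
    have h4 : (f x) 1 = √(d x - b x ^ 2 / a x) * x 1 := by simp [f, γ, p1]
    rw [h3, h4, Real.norm_eq_abs, Real.norm_eq_abs, sq_abs, sq_abs, mul_pow, mul_pow,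
      Real.sq_sqrt hax.le, Real.sq_sqrt (le_of_lt hxS.2)]
    change B x x x = _
    rw [hquad x (hSr hxS)]
    field_simp
    ring

/-- The Morse lemma at a non-degenerate maximum of a smooth function on the plane. -/
theorem exists_morse_chart {h : Plane → ℝ} {U : Set Plane} (hU : IsOpen U)
    (hh : ContDiffOn ℝ ∞ h U) {p : Plane} (hp : p ∈ U) (h1 : fderiv ℝ h p = 0)
    (hneg : ∀ v : Plane, v ≠ 0 → fderiv ℝ (fderiv ℝ h) p v v < 0) :
    ∃ e : OpenPartialHomeomorph Plane Plane, p ∈ e.source ∧ e.source ⊆ U ∧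
      e p = 0 ∧ ContDiffOn ℝ ∞ e e.source ∧ ContDiffOn ℝ ∞ e.symm e.target ∧
      ∀ x ∈ e.source, h x = h p - ‖e x‖ ^ 2 := by
  obtain ⟨r, hr, hrU⟩ := Metric.isOpen_iff.mp hU p hp
  let k : Plane → ℝ := fun x ↦ h p - h (p + x)
  have hmem : ∀ x ∈ Metric.ball (0 : Plane) r, p + x ∈ U := fun x hx ↦ hrU (by simpa using hx)
  have hk : ContDiffOn ℝ ∞ k (Metric.ball 0 r) :=
    contDiffOn_const.sub (hh.comp (by fun_prop) hmem)
  have hfk : fderiv ℝ k = fun x ↦ - fderiv ℝ h (p + x) := by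
    ext1 x
    simp only [k, fderiv_const_sub, fderiv_comp_add_left]
  obtain ⟨e, he0, her, hee, hes, hesym, hek⟩ := exists_morse_chart_aux hr hk (by simp [k])
    (by rw [hfk]; simp [h1]) (fun v hv ↦ by
      rw [hfk]
      have : fderiv ℝ (fun x ↦ - fderiv ℝ h (p + x)) 0 = - fderiv ℝ (fderiv ℝ h) p := by
        rw [fderiv_fun_neg, fderiv_comp_add_left, add_zero]
      rw [this]
      simpa using hneg v hv)
  let τ : OpenPartialHomeomorph Plane Plane := (Homeomorph.subRight p).toOpenPartialHomeomorph
  have hτ : ContDiff ℝ ∞ τ := contDiff_id.sub contDiff_const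
  have hτs : ContDiff ℝ ∞ τ.symm := contDiff_id.add contDiff_const
  have hsrc : (τ.trans e).source = {x | x - p ∈ e.source} := by
    ext x; simp [τ]
  have htgt : (τ.trans e).target = e.target := by
    ext x; simp [τ]
  refine ⟨τ.trans e, by rw [hsrc]; simpa using he0, ?_, by simpa [τ] using hee, ?_, ?_, ?_⟩
  · rw [hsrc]
    intro x hx
    simpa using hmem _ (her hx)
  · rw [hsrc]
    exact hes.comp hτ.contDiffOn fun x hx ↦ hx
  · rw [htgt]
    exact hτs.comp_contDiffOn hesym
  · rw [hsrc]
    intro x hx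
    have := hek _ hx
    simp only [k, add_sub_cancel] at this
    change h x = h p - ‖e (x - p)‖ ^ 2
    rw [← this]; ring

end Morse

/-! ### Absence of periodic orbits near a non-elliptic zero -/

section ShortPeriod

/-- The normalised variational equation: a `T`-periodic solution with zero mean of a linear equation
`v' = B v` with `B` close to an operator `A` whose square is a non-negative scalar vanishes. -/
theorem eq_zero_of_periodic_of_near_square_nonneg {E : Type*} [NormedAddCommGroup E]
    [InnerProductSpace ℝ E] [CompleteSpace E] {A : E →L[ℝ] E} {δ : ℝ} (hδ : 0 ≤ δ)
    (hA : ∀ v, A (A v) = δ • v) {T κ ε : ℝ} (hT : 0 < T) (hε : 0 ≤ ε)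
    (hκ : ε * (2 * ‖A‖ + ε) ≤ κ) (hκT : T ^ 2 * κ < 1) {v w : ℝ → E} (hw : Continuous w)
    (hv : ∀ t, HasDerivAt v (w t) t) (hwv : ∀ t, ‖w t - A (v t)‖ ≤ ε * ‖v t‖)
    (hper : v T = v 0) (hmean : ∫ t in (0 : ℝ)..T, v t = 0) : ∀ t ∈ Icc 0 T, v t = 0 := by
  have hvc : Continuous v := continuous_iff_continuousAt.mpr fun t ↦ (hv t).continuousAt
  have hκ0 : 0 ≤ κ := le_trans (by positivity) hκ
  -- If `v' = A v` held exactly, this function would have derivative `δ ‖v‖² + ‖v'‖²`, at least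
  -- `‖v'‖²`. The perturbation costs at most `κ ‖v‖²`. Integrating over a period gives `∫ ‖w‖² ≤ κ ∫
  -- ‖v‖²`.
  have hq : ∀ t, HasDerivAt (fun t ↦ inner ℝ (v t) (A (v t)))
      (inner ℝ (v t) (A (w t)) + inner ℝ (w t) (A (v t))) t := fun t ↦
    (hv t).inner ℝ (A.hasFDerivAt.comp_hasDerivAt t (hv t))
  have hlow : ∀ t, ‖w t‖ ^ 2 - κ * ‖v t‖ ^ 2 ≤
      inner ℝ (v t) (A (w t)) + inner ℝ (w t) (A (v t)) := fun t ↦ by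
    set d := w t - A (v t) with hd
    have hd' := hwv t
    have h1 : inner ℝ (w t) (A (v t)) = ‖w t‖ ^ 2 - inner ℝ (w t) d := by
      rw [hd, inner_sub_right, real_inner_self_eq_norm_sq]; ring
    have h2 : inner ℝ (v t) (A (w t)) = δ * ‖v t‖ ^ 2 + inner ℝ (v t) (A d) := by
      have : w t = A (v t) + d := by rw [hd]; abel
      rw [this, map_add, inner_add_right, hA, inner_smul_right, real_inner_self_eq_norm_sq]
    have h3 : ‖w t‖ ≤ (‖A‖ + ε) * ‖v t‖ := by
      have : w t = A (v t) + d := by rw [hd]; abel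
      rw [this]
      refine (norm_add_le _ _).trans ?_
      have := A.le_opNorm (v t)
      linarith
    have h4 : |inner ℝ (w t) d| ≤ (‖A‖ + ε) * ‖v t‖ * (ε * ‖v t‖) :=
      (abs_real_inner_le_norm _ _).trans (by gcongr)
    have h5 : |inner ℝ (v t) (A d)| ≤ ‖v t‖ * (‖A‖ * (ε * ‖v t‖)) :=
      (abs_real_inner_le_norm _ _).trans (by
        gcongr
        exact (A.le_opNorm _).trans (by gcongr))
    have h6 : ε * (2 * ‖A‖ + ε) * ‖v t‖ ^ 2 ≤ κ * ‖v t‖ ^ 2 := by gcongr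
    have h7 : 0 ≤ δ * ‖v t‖ ^ 2 := by positivity
    rw [h1, h2]
    have := abs_le.mp h4
    have := abs_le.mp h5
    nlinarith
  have hqc : Continuous fun t ↦ inner ℝ (v t) (A (w t)) + inner ℝ (w t) (A (v t)) := by fun_prop
  have hint := intervalIntegral.integral_eq_sub_of_hasDerivAt (a := 0) (b := T)
    (fun t _ ↦ hq t) (hqc.intervalIntegrable _ _)
  rw [hper, sub_self] at hint
  have hmono := intervalIntegral.integral_mono_on (μ := volume) hT.le
    (Continuous.intervalIntegrable (by fun_prop) _ _) (hqc.intervalIntegrable 0 T)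
    (fun t _ ↦ hlow t)
  rw [hint, intervalIntegral.integral_sub (Continuous.intervalIntegrable (by fun_prop) _ _)
    (Continuous.intervalIntegrable (by fun_prop) _ _),
    intervalIntegral.integral_const_mul] at hmono
  set I := ∫ t in (0 : ℝ)..T, ‖v t‖ ^ 2
  set P := ∫ t in (0 : ℝ)..T, ‖w t‖ ^ 2
  set m := ∫ t in (0 : ℝ)..T, ‖w t‖
  -- The Cauchy–Schwarz inequality, from the variance of `‖w‖` being non-negative.
  have hm2 : m ^ 2 ≤ T * P := by
    have h1 : 0 ≤ ∫ t in (0 : ℝ)..T, (‖w t‖ - m / T) ^ 2 :=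
      intervalIntegral.integral_nonneg hT.le fun t _ ↦ sq_nonneg _
    have h2 : ∫ t in (0 : ℝ)..T, (‖w t‖ - m / T) ^ 2 =
        P - 2 * (m / T) * m + T * (m / T) ^ 2 := by
      have : ∀ t, (‖w t‖ - m / T) ^ 2 = ‖w t‖ ^ 2 - 2 * (m / T) * ‖w t‖ + (m / T) ^ 2 :=
        fun t ↦ by ring
      simp_rw [this]
      rw [intervalIntegral.integral_add (Continuous.intervalIntegrable (by fun_prop) _ _)
        (Continuous.intervalIntegrable (by fun_prop) _ _),
        intervalIntegral.integral_sub (Continuous.intervalIntegrable (by fun_prop) _ _)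
        (Continuous.intervalIntegrable (by fun_prop) _ _), intervalIntegral.integral_const_mul,
        intervalIntegral.integral_const]
      simp [P, m]
    rw [h2] at h1
    have h3 : P - 2 * (m / T) * m + T * (m / T) ^ 2 = (T * P - m ^ 2) / T := by field_simp; ring
    rw [h3] at h1
    have := mul_nonneg h1 hT.le
    rw [div_mul_cancel₀ _ hT.ne'] at this
    linarith
  have hdiff : ∀ t ∈ Icc 0 T, ∀ s ∈ Icc 0 T, ‖v t - v s‖ ≤ m := by
    intro t ht s hs
    have h1 : v t - v s = ∫ r in s..t, w r :=
      (intervalIntegral.integral_eq_sub_of_hasDerivAt (fun r _ ↦ hv r)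
        (hw.intervalIntegrable _ _)).symm
    rw [h1]
    refine intervalIntegral.norm_integral_le_integral_norm_uIoc.trans ?_
    have h2 : m = ∫ r in Ioc 0 T, ‖w r‖ := intervalIntegral.integral_of_le hT.le
    rw [h2]
    refine setIntegral_mono_set (hw.norm.integrableOn_Icc.mono_set Ioc_subset_Icc_self)
      (Filter.Eventually.of_forall fun _ ↦ norm_nonneg _) ?_
    exact (Ioc_subset_Ioc (le_min hs.1 ht.1) (max_le hs.2 ht.2)).eventuallyLE
  -- Because `v` has zero mean, `v t` is the average of the differences `v t - v s`, each bounded by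
  -- the total variation `m`.
  have hvm : ∀ t ∈ Icc 0 T, ‖v t‖ ≤ m := by
    intro t ht
    have h1 : T • v t = ∫ s in (0 : ℝ)..T, (v t - v s) := by
      rw [intervalIntegral.integral_sub (by simp) (hvc.intervalIntegrable _ _), hmean]
      simp
    have h2 : ‖T • v t‖ ≤ m * |T - 0| := by
      rw [h1]
      refine intervalIntegral.norm_integral_le_of_norm_le_const fun s hs ↦ ?_
      rw [uIoc_of_le hT.le] at hs
      exact hdiff t ht s (Ioc_subset_Icc_self hs)
    rw [norm_smul, Real.norm_of_nonneg hT.le, sub_zero, abs_of_pos hT, mul_comm m] at h2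
    exact le_of_mul_le_mul_left h2 hT
  have hIm : I ≤ m ^ 2 * T := by
    have := intervalIntegral.integral_mono_on (μ := volume) (a := 0) (b := T) hT.le
      (f := fun t ↦ ‖v t‖ ^ 2) (g := fun _ ↦ m ^ 2)
      (Continuous.intervalIntegrable (by fun_prop) _ _) (by simp)
      (fun t ht ↦ by
        have := hvm t ht
        gcongr)
    simpa [mul_comm] using this
  have hI0 : 0 ≤ I := intervalIntegral.integral_nonneg hT.le fun t _ ↦ sq_nonneg _
  -- The estimates close up on `m`, and `T ^ 2 * κ < 1` forces `m = 0`.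
  have hm2' : m ^ 2 ≤ T ^ 2 * κ * m ^ 2 := by
    calc m ^ 2 ≤ T * P := hm2
      _ ≤ T * (κ * (m ^ 2 * T)) := by
        gcongr
        have : κ * I ≤ κ * (m ^ 2 * T) := by gcongr
        linarith
      _ = _ := by ring
  have hm0 : m = 0 := by
    by_contra h
    have : 0 < m ^ 2 := by positivity
    nlinarith
  intro t ht
  have := hvm t ht
  rw [hm0] at this
  exact norm_le_zero_iff.mp this

/-- Near a zero of a vector field whose linear part has a non-negative scalar as its square there
are no periodic orbits of a given period other than zeros. -/
theorem eventually_periodic_orbit_constant {E : Type*} [NormedAddCommGroup E]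
    [InnerProductSpace ℝ E] [CompleteSpace E] {V : E → E} {U : Set E} (hU : IsOpen U)
    (hV : ContDiffOn ℝ ∞ V U) {p : E} (hp : p ∈ U) {δ : ℝ} (hδ : 0 ≤ δ)
    (hA : ∀ v, fderiv ℝ V p (fderiv ℝ V p v) = δ • v) {T : ℝ} (hT : 0 < T) :
    ∃ O ∈ 𝓝 p, ∀ y : ℝ → E, (∀ t, y t ∈ O) → (∀ t, HasDerivAt y (V (y t)) t) →
      y T = y 0 → V (y 0) = 0 := by
  set A := fderiv ℝ V p
  have hlim : Filter.Tendsto (fun ε : ℝ ↦ T ^ 2 * (ε * (2 * ‖A‖ + ε))) (𝓝[>] 0) (𝓝 0) := by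
    have : Continuous (fun ε : ℝ ↦ T ^ 2 * (ε * (2 * ‖A‖ + ε))) := by fun_prop
    exact (this.tendsto' 0 0 (by simp)).mono_left nhdsWithin_le_nhds
  obtain ⟨ε, hεT, hε⟩ := ((hlim.eventually (gt_mem_nhds zero_lt_one)).and
    self_mem_nhdsWithin).exists
  have hε : 0 < ε := hε
  have hDc : ContinuousOn (fderiv ℝ V) U :=
    (hV.fderiv_of_isOpen (m := ∞) hU (by simp)).continuousOn
  have hO : ∀ᶠ x in 𝓝 p, x ∈ U ∧ ‖fderiv ℝ V x - A‖ < ε := by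
    have h1 : ContinuousAt (fun x ↦ ‖fderiv ℝ V x - A‖) p :=
      ((hDc.continuousAt (hU.mem_nhds hp)).sub_const A).norm
    filter_upwards [hU.mem_nhds hp, h1.eventually (gt_mem_nhds (by simpa [A] using hε))]
      with x h1 h2 using ⟨h1, h2⟩
  refine ⟨_, hO, fun y hy hyV hyT ↦ ?_⟩
  have hyc : Continuous y := continuous_iff_continuousAt.mpr fun t ↦ (hyV t).continuousAt
  -- The linear estimate is applied to the velocity rather than to the orbit: the velocity solves
  -- the linearised equation along the orbit, and its mean over a period vanishes because the orbit
  -- closes up.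
  have hd : ∀ t, HasDerivAt (fun t ↦ V (y t)) (fderiv ℝ V (y t) (V (y t))) t := fun t ↦
    (((hV _ (hy t).1).contDiffAt (hU.mem_nhds (hy t).1)).differentiableAt
      (by simp)).hasFDerivAt.comp_hasDerivAt t (hyV t)
  have hVc : Continuous fun t ↦ V (y t) := continuous_iff_continuousAt.mpr fun t ↦
    (hd t).continuousAt
  refine eq_zero_of_periodic_of_near_square_nonneg hδ hA hT hε.le le_rfl hεT ?_ hd ?_
    (by simp [hyT]) ?_ 0 ⟨le_rfl, hT.le⟩
  · exact (hDc.comp_continuous hyc fun t ↦ (hy t).1).clm_apply hVc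
  · intro t
    rw [← sub_apply]
    exact (ContinuousLinearMap.le_opNorm _ _).trans (by gcongr; exact (hy t).2.le)
  · rw [intervalIntegral.integral_eq_sub_of_hasDerivAt (fun t _ ↦ hyV t)
      (hVc.intervalIntegrable _ _), hyT, sub_self]

end ShortPeriod

/-! ### The Hamiltonian vector field in charts -/

section ChartRepresentation

variable {N : Type*} [TopologicalSpace N] [ChartedSpace Plane N] [IsManifold (𝓡 2) ∞ N]

/-- The coordinate vector field with constant coordinates `v` in the chart at `p`. -/
noncomputable def chartFrame (p : N) (v : Plane) (z : N) : TangentSpace (𝓡 2) z :=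
  (trivializationAt Plane (TangentSpace (𝓡 2)) p).symm z v

theorem contMDiffOn_chartFrame_comp (p : N) {f : N → Plane}
    (hf : ContMDiffOn (𝓡 2) (𝓡 2) ∞ f (chartAt Plane p).source) :
    ContMDiffOn (𝓡 2) (𝓡 2).tangent ∞
      (fun z ↦ (⟨z, chartFrame p (f z) z⟩ : TangentBundle (𝓡 2) N)) (chartAt Plane p).source := by
  have h := (trivializationAt Plane (TangentSpace (𝓡 2)) p).contMDiffOn_section_baseSet_iff
    (IB := 𝓡 2) (n := ∞) (s := fun z ↦ chartFrame p (f z) z)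
  rw [TangentBundle.trivializationAt_baseSet] at h
  refine h.mpr (hf.congr fun z hz ↦ ?_)
  simp only [chartFrame]
  rw [Bundle.Trivialization.apply_mk_symm]
  simpa using hz

theorem chartFrame_eq_mfderiv (p : N) (v : Plane) {z : N} (hz : z ∈ (chartAt Plane p).source) :
    chartFrame p v z = mfderiv (𝓡 2) (𝓡 2) (chartAt Plane p).symm (chartAt Plane p z) v := by
  have h := TangentBundle.symmL_trivializationAt (𝕜 := ℝ) (I := 𝓡 2) hz
  have h2 := congrArg (fun L : Plane →L[ℝ] Plane ↦ L v) h
  have h3 : mfderivWithin 𝓘(ℝ, Plane) (𝓡 2) (extChartAt (𝓡 2) p).symm (range (𝓡 2))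
    (extChartAt (𝓡 2) p z) = mfderiv (𝓡 2) (𝓡 2) (chartAt Plane p).symm (chartAt Plane p z) := by
    simp [mfld_simps]
    rfl
  rw [← h3]
  refine Eq.trans ?_ h2
  exact (Bundle.Trivialization.symmL_apply (R := ℝ) (trivializationAt Plane (TangentSpace (𝓡 2)) p)
    (by simpa using hz) v).symm

/-- Contracting a smooth bundle form with two smooth sections is smooth. Applied to coordinate
frames, it gives smoothness of the density in a chart. -/
theorem SymplecticForm.contMDiffOn_apply (Ω : SymplecticForm N)
    {v w : ∀ z : N, TangentSpace (𝓡 2) z} {s : Set N}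
    (hv : ContMDiffOn (𝓡 2) (𝓡 2).tangent ∞ (fun z ↦ (⟨z, v z⟩ : TangentBundle (𝓡 2) N)) s)
    (hw : ContMDiffOn (𝓡 2) (𝓡 2).tangent ∞ (fun z ↦ (⟨z, w z⟩ : TangentBundle (𝓡 2) N)) s) :
    ContMDiffOn (𝓡 2) 𝓘(ℝ, ℝ) ∞ (fun z ↦ Ω.form z (v z) (w z)) s := by
  intro x hx
  have h : ContMDiffWithinAt (𝓡 2) ((𝓡 2).prod 𝓘(ℝ, ℝ)) ∞
      (fun m ↦ Bundle.TotalSpace.mk' ℝ (E := Bundle.Trivial N ℝ) m (Ω.form m (v m) (w m)))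
      s x := by
    apply ContMDiffWithinAt.clm_bundle_apply₂ (F₁ := Plane) (F₂ := Plane)
    · exact Ω.smooth.contMDiffOn x hx
    · exact hv x hx
    · exact hw x hx
  rw [Bundle.contMDiffWithinAt_totalSpace] at h
  exact h.2

/-- The first vector of the standard basis of the plane. -/
noncomputable abbrev planeE0 : Plane := EuclideanSpace.single (0 : Fin 2) (1 : ℝ)

/-- The second vector of the standard basis of the plane. -/
noncomputable abbrev planeE1 : Plane := EuclideanSpace.single (1 : Fin 2) (1 : ℝ)

theorem plane_eq_smul_add_smul (v : Plane) : v = v 0 • planeE0 + v 1 • planeE1 := by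
  ext i; fin_cases i <;> simp

/-- The differential of `H` at `z`, as a functional on the model plane. -/
noncomputable def differential (H : N → ℝ) (z : N) : Plane →L[ℝ] ℝ :=
  mfderiv (𝓡 2) 𝓘(ℝ, ℝ) H z

/-- The derivative of the inverse of the chart at `p`. -/
noncomputable def chartTangent (p : N) (u : Plane) : Plane →L[ℝ] Plane :=
  mfderiv (𝓡 2) (𝓡 2) (chartAt Plane p).symm u

/-- The derivative of the chart at `p`. -/
noncomputable def chartCotangent (p : N) (z : N) : Plane →L[ℝ] Plane :=
  mfderiv (𝓡 2) (𝓡 2) (chartAt Plane p) z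

theorem chartTangent_comp_chartCotangent (p : N) {u : Plane} (hu : u ∈ (chartAt Plane p).target)
    (v : Plane) : chartTangent p u (chartCotangent p ((chartAt Plane p).symm u) v) = v := by
  have h := (mdifferentiable_chart (I := 𝓡 2) p).symm_comp_deriv
    ((chartAt Plane p).map_target hu)
  rw [(chartAt Plane p).right_inv hu] at h
  exact congrArg (fun L : Plane →L[ℝ] Plane ↦ L v) h

theorem chartCotangent_comp_chartTangent (p : N) {u : Plane} (hu : u ∈ (chartAt Plane p).target)
    (v : Plane) : chartCotangent p ((chartAt Plane p).symm u) (chartTangent p u v) = v := by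
  have h := (mdifferentiable_chart (I := 𝓡 2) p).comp_symm_deriv hu
  exact congrArg (fun L : Plane →L[ℝ] Plane ↦ L v) h

/-- The signed density of the symplectic form in the chart at `p`. -/
noncomputable def SymplecticForm.signedDensity (Ω : SymplecticForm N) (p : N) (u : Plane) : ℝ :=
  Ω.form ((chartAt Plane p).symm u) (chartTangent p u planeE0) (chartTangent p u planeE1)

/-- The symplectic form at `z`, as a bilinear map on the model plane. -/
noncomputable def SymplecticForm.bilin (Ω : SymplecticForm N) (z : N) :
    Plane →L[ℝ] Plane →L[ℝ] ℝ := Ω.form z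

/-- The symplectic form at `z`, as a function on the model plane. -/
noncomputable def SymplecticForm.pairing (Ω : SymplecticForm N) (z : N) (v w : Plane) : ℝ :=
  Ω.bilin z v w

theorem SymplecticForm.pairing_self (Ω : SymplecticForm N) (z : N) (v : Plane) :
    Ω.pairing z v v = 0 := Ω.alternating z v

theorem SymplecticForm.pairing_right (Ω : SymplecticForm N) (z : N) (v : Plane) (a b : ℝ)
    (w w' : Plane) :
    Ω.pairing z v (a • w + b • w') = a * Ω.pairing z v w + b * Ω.pairing z v w' := by
  simp [SymplecticForm.pairing]

theorem SymplecticForm.pairing_left (Ω : SymplecticForm N) (z : N) (v : Plane) (a b : ℝ)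
    (w w' : Plane) :
    Ω.pairing z (a • w + b • w') v = a * Ω.pairing z w v + b * Ω.pairing z w' v := by
  simp [SymplecticForm.pairing]

theorem SymplecticForm.pairing_skew (Ω : SymplecticForm N) (z : N) (v w : Plane) :
    Ω.pairing z v w = - Ω.pairing z w v := by
  have h := Ω.pairing_self z ((1 : ℝ) • v + (1 : ℝ) • w)
  rw [Ω.pairing_left, Ω.pairing_right, Ω.pairing_right, Ω.pairing_self, Ω.pairing_self] at h
  linarith

theorem chartTangent_surjective (p : N) {u : Plane} (hu : u ∈ (chartAt Plane p).target)
    (w : Plane) : ∃ a b : ℝ, w = a • chartTangent p u planeE0 + b • chartTangent p u planeE1 := by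
  set k : Plane := chartCotangent p ((chartAt Plane p).symm u) w with hk
  refine ⟨k 0, k 1, ?_⟩
  have h := chartTangent_comp_chartCotangent p hu w
  rw [← hk, plane_eq_smul_add_smul k, map_add, map_smul, map_smul] at h
  exact h.symm

/-- If the density vanished, the first coordinate vector would pair to zero with both coordinate
vectors, which span the tangent plane. -/
theorem SymplecticForm.signedDensity_ne_zero (Ω : SymplecticForm N) (p : N) {u : Plane}
    (hu : u ∈ (chartAt Plane p).target) : Ω.signedDensity p u ≠ 0 := by
  intro h0
  have h1 : chartTangent p u planeE0 = 0 := by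
    refine Ω.nondegenerate ((chartAt Plane p).symm u) _ fun w ↦ ?_
    obtain ⟨a, b, hw⟩ := chartTangent_surjective p hu w
    have h := Ω.pairing_right ((chartAt Plane p).symm u) (chartTangent p u planeE0) a b
      (chartTangent p u planeE0) (chartTangent p u planeE1)
    rw [← hw, Ω.pairing_self] at h
    have h0' : Ω.pairing ((chartAt Plane p).symm u) (chartTangent p u planeE0)
      (chartTangent p u planeE1) = 0 := h0
    rw [h0', mul_zero, mul_zero, add_zero] at h
    exact h
  have h2 := chartCotangent_comp_chartTangent p hu planeE0
  rw [h1, map_zero] at h2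
  have := congrArg (fun v : Plane ↦ v 0) h2
  simp at this

theorem SymplecticForm.contDiffOn_signedDensity (Ω : SymplecticForm N) (p : N) :
    ContDiffOn ℝ ∞ (Ω.signedDensity p) (chartAt Plane p).target := by
  rw [← contMDiffOn_iff_contDiffOn]
  have h := Ω.contMDiffOn_apply
    (contMDiffOn_chartFrame_comp p (contMDiffOn_const (c := planeE0)))
    (contMDiffOn_chartFrame_comp p (contMDiffOn_const (c := planeE1)))
  refine (h.comp (contMDiffOn_chart_symm (I := 𝓡 2) (x := p))
    (chartAt Plane p).symm.mapsTo).congr fun u hu ↦ ?_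
  have hz := (chartAt Plane p).map_target hu
  simp only [Function.comp_def]
  rw [chartFrame_eq_mfderiv p _ hz, chartFrame_eq_mfderiv p _ hz, (chartAt Plane p).right_inv hu]
  rfl

/-- The function `H` in the chart at `p`. -/
def chartFunction (H : N → ℝ) (p : N) (u : Plane) : ℝ := H ((chartAt Plane p).symm u)

theorem contDiffOn_chartFunction {H : N → ℝ} (hH : ContMDiff (𝓡 2) 𝓘(ℝ, ℝ) ∞ H) (p : N) :
    ContDiffOn ℝ ∞ (chartFunction H p) (chartAt Plane p).target := by
  rw [← contMDiffOn_iff_contDiffOn]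
  exact hH.comp_contMDiffOn (contMDiffOn_chart_symm (I := 𝓡 2) (x := p))

theorem differential_chartTangent {H : N → ℝ} (hH : ContMDiff (𝓡 2) 𝓘(ℝ, ℝ) ∞ H) (p : N) {u : Plane}
    (hu : u ∈ (chartAt Plane p).target) (v : Plane) :
    differential H ((chartAt Plane p).symm u) (chartTangent p u v)
      = fderiv ℝ (chartFunction H p) u v := by
  have h1 : MDifferentiableAt (𝓡 2) (𝓡 2) (chartAt Plane p).symm u :=
    (mdifferentiable_chart (I := 𝓡 2) p).mdifferentiableAt_symm hu
  have h2 : MDifferentiableAt (𝓡 2) 𝓘(ℝ, ℝ) H ((chartAt Plane p).symm u) :=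
    (hH _).mdifferentiableAt (by simp)
  have h := mfderiv_comp u h2 h1
  rw [← mfderiv_eq_fderiv]
  have h3 := congrArg (fun L : Plane →L[ℝ] ℝ ↦ L v) h
  exact h3.symm

/-- The Hamiltonian vector field in the chart at `p`. -/
noncomputable def chartVectorField (Ω : SymplecticForm N) (H : N → ℝ) (p : N) (u : Plane) : Plane :=
  (-(fderiv ℝ (chartFunction H p) u planeE1) / Ω.signedDensity p u) • planeE0
    + (fderiv ℝ (chartFunction H p) u planeE0 / Ω.signedDensity p u) • planeE1

theorem contDiffOn_chartVectorField (Ω : SymplecticForm N) {H : N → ℝ}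
    (hH : ContMDiff (𝓡 2) 𝓘(ℝ, ℝ) ∞ H) (p : N) :
    ContDiffOn ℝ ∞ (chartVectorField Ω H p) (chartAt Plane p).target := by
  have hd : ∀ v : Plane, ContDiffOn ℝ ∞ (fun u ↦ fderiv ℝ (chartFunction H p) u v)
      (chartAt Plane p).target := fun v ↦
    ((contDiffOn_chartFunction hH p).fderiv_of_isOpen (chartAt Plane p).open_target
      (m := ∞) le_rfl).clm_apply contDiffOn_const
  have hρ := Ω.contDiffOn_signedDensity p
  have hne := fun u hu ↦ Ω.signedDensity_ne_zero p (u := u) hu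
  exact (((hd _).neg.div hρ hne).smul contDiffOn_const).add
    (((hd _).div hρ hne).smul contDiffOn_const)

/-- In the chart the form is `ρ du₀ ∧ du₁`, so the coordinate expression `(-∂₁h, ∂₀h) / ρ` satisfies
the defining equation, and the dual vector is unique. -/
theorem hamiltonianVectorField_chart (Ω : SymplecticForm N) {H : N → ℝ}
    (hH : ContMDiff (𝓡 2) 𝓘(ℝ, ℝ) ∞ H) (p : N) {u : Plane}
    (hu : u ∈ (chartAt Plane p).target) :
    hamiltonianVectorField Ω H ((chartAt Plane p).symm u) =
      chartTangent p u (chartVectorField Ω H p u) := by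
  refine (Ω.existsUnique_dual ((chartAt Plane p).symm u)
    (-(mfderiv (𝓡 2) 𝓘(ℝ, ℝ) H _))).unique ?_ ?_
  · ext v
    exact hamiltonianVectorField_spec Ω H _ v
  · ext w
    have hne := Ω.signedDensity_ne_zero p hu
    have key : Ω.pairing ((chartAt Plane p).symm u) (chartTangent p u (chartVectorField Ω H p u)) w
        = - differential H ((chartAt Plane p).symm u) w := by
      obtain ⟨a, b, rfl⟩ := chartTangent_surjective p hu w
      have hlin : chartTangent p u (chartVectorField Ω H p u) =
          (-(fderiv ℝ (chartFunction H p) u planeE1) / Ω.signedDensity p u) •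
            chartTangent p u planeE0 +
          (fderiv ℝ (chartFunction H p) u planeE0 / Ω.signedDensity p u) •
            chartTangent p u planeE1 := by
        rw [chartVectorField, map_add, map_smul, map_smul]
      have hH' : differential H ((chartAt Plane p).symm u)
          (a • chartTangent p u planeE0 + b • chartTangent p u planeE1) =
          a * fderiv ℝ (chartFunction H p) u planeE0 +
            b * fderiv ℝ (chartFunction H p) u planeE1 := by
        rw [← differential_chartTangent hH p hu planeE0, ← differential_chartTangent hH p hu planeE1]
        rw [map_add, map_smul, map_smul, smul_eq_mul, smul_eq_mul]
      rw [hlin, hH', Ω.pairing_left, Ω.pairing_right, Ω.pairing_right, Ω.pairing_self,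
        Ω.pairing_self, Ω.pairing_skew _ (chartTangent p u planeE1)]
      have a3 : Ω.pairing ((chartAt Plane p).symm u) (chartTangent p u planeE0)
        (chartTangent p u planeE1) = Ω.signedDensity p u := rfl
      rw [a3]
      field_simp
      ring
    exact key

/-- The Hamiltonian vector field, as a vector of the model plane. -/
noncomputable def hamVec (Ω : SymplecticForm N) (H : N → ℝ) (z : N) : Plane :=
  hamiltonianVectorField Ω H z

theorem hamVec_chart (Ω : SymplecticForm N) {H : N → ℝ}
    (hH : ContMDiff (𝓡 2) 𝓘(ℝ, ℝ) ∞ H) (p : N) {u : Plane}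
    (hu : u ∈ (chartAt Plane p).target) :
    hamVec Ω H ((chartAt Plane p).symm u) = chartTangent p u (chartVectorField Ω H p u) :=
  hamiltonianVectorField_chart Ω hH p hu

theorem contMDiff_hamiltonianVectorField (Ω : SymplecticForm N) {H : N → ℝ}
    (hH : ContMDiff (𝓡 2) 𝓘(ℝ, ℝ) ∞ H) :
    ContMDiff (𝓡 2) (𝓡 2).tangent ∞
      (fun z ↦ (⟨z, hamiltonianVectorField Ω H z⟩ : TangentBundle (𝓡 2) N)) := by
  intro p
  have h := contMDiffOn_chartFrame_comp p (f := fun z ↦ chartVectorField Ω H p (chartAt Plane p z))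
    ((contDiffOn_chartVectorField Ω hH p).contMDiffOn.comp (contMDiffOn_chart (I := 𝓡 2) (x := p))
      (chartAt Plane p).mapsTo)
  refine (h.congr fun z hz ↦ ?_).contMDiffAt
    ((chartAt Plane p).open_source.mem_nhds (mem_chart_source Plane p))
  rw [chartFrame_eq_mfderiv p _ hz]
  have h1 := hamiltonianVectorField_chart Ω hH p ((chartAt Plane p).map_source hz)
  rw [(chartAt Plane p).left_inv hz] at h1
  rw [h1]
  rfl

/-- The linear map of derivative `v`. -/
noncomputable def velocityMap (v : Plane) : ℝ →L[ℝ] Plane := (1 : ℝ →L[ℝ] ℝ).smulRight v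

theorem velocityMap_one (v : Plane) : velocityMap v 1 = v := by simp [velocityMap]

theorem hasDerivAt_chart_of_orbit (Ω : SymplecticForm N) {H : N → ℝ}
    (hH : ContMDiff (𝓡 2) 𝓘(ℝ, ℝ) ∞ H) (p : N) {γ : ℝ → N} {t : ℝ}
    (hγ : HasMFDerivAt 𝓘(ℝ, ℝ) (𝓡 2) γ t
      ((1 : ℝ →L[ℝ] ℝ).smulRight (hamiltonianVectorField Ω H (γ t))))
    (ht : γ t ∈ (chartAt Plane p).source) :
    HasDerivAt (fun s ↦ chartAt Plane p (γ s))
      (chartVectorField Ω H p (chartAt Plane p (γ t))) t := by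
  have h1 := ((mdifferentiable_chart (I := 𝓡 2) p).mdifferentiableAt ht).hasMFDerivAt
  have h2 := (h1.comp t hγ).hasFDerivAt
  have h3 : HasFDerivAt (fun s ↦ chartAt Plane p (γ s))
    ((chartCotangent p (γ t)).comp (velocityMap (hamVec Ω H (γ t)))) t := h2
  have hu := (chartAt Plane p).map_source ht
  have h4 := hamVec_chart Ω hH p hu
  have h5 := chartCotangent_comp_chartTangent p hu (chartVectorField Ω H p (chartAt Plane p (γ t)))
  rw [(chartAt Plane p).left_inv ht] at h4 h5
  have h6 := h3.hasDerivAt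
  rw [ContinuousLinearMap.comp_apply, velocityMap_one, h4, h5] at h6
  exact h6

theorem hasMFDerivAt_of_chart (Ω : SymplecticForm N) {H : N → ℝ}
    (hH : ContMDiff (𝓡 2) 𝓘(ℝ, ℝ) ∞ H) (p : N) {y : ℝ → Plane} {t : ℝ}
    (hy : HasDerivAt y (chartVectorField Ω H p (y t)) t) (ht : y t ∈ (chartAt Plane p).target) :
    HasMFDerivAt 𝓘(ℝ, ℝ) (𝓡 2) (fun s ↦ (chartAt Plane p).symm (y s)) t
      ((1 : ℝ →L[ℝ] ℝ).smulRight
        (hamiltonianVectorField Ω H ((chartAt Plane p).symm (y t)))) := by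
  have h1 := ((mdifferentiable_chart (I := 𝓡 2) p).mdifferentiableAt_symm ht).hasMFDerivAt
  have h2 := h1.comp t hy.hasFDerivAt.hasMFDerivAt
  have h6 : (chartTangent p (y t)).comp (ContinuousLinearMap.toSpanSingleton ℝ
        (chartVectorField Ω H p (y t))) =
      velocityMap (hamVec Ω H ((chartAt Plane p).symm (y t))) := by
    refine ContinuousLinearMap.ext_ring ?_
    rw [velocityMap_one, hamVec_chart Ω hH p ht]
    simp
  exact h2.congr_mfderiv h6

/-- The factor `k` admits orbits of a cut-off multiple of the field, as needed for completeness;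
ordinary orbits have `k = 1`. -/
theorem hasDerivAt_comp_orbit (Ω : SymplecticForm N) {H f : N → ℝ}
    (hf : ContMDiff (𝓡 2) 𝓘(ℝ, ℝ) ∞ f) {γ : ℝ → N} {t : ℝ} {k : ℝ}
    (hγ : HasMFDerivAt 𝓘(ℝ, ℝ) (𝓡 2) γ t
      ((1 : ℝ →L[ℝ] ℝ).smulRight (k • hamiltonianVectorField Ω H (γ t)))) :
    HasDerivAt (fun s ↦ f (γ s)) (k * differential f (γ t) (hamVec Ω H (γ t))) t := by
  have h1 := ((hf (γ t)).mdifferentiableAt (by simp)).hasMFDerivAt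
  have h2 := (h1.comp t hγ).hasFDerivAt
  have h3 : HasFDerivAt (fun s ↦ f (γ s))
    ((differential f (γ t)).comp (velocityMap (k • hamVec Ω H (γ t)))) t := h2
  have h4 := h3.hasDerivAt
  rw [ContinuousLinearMap.comp_apply, velocityMap_one, map_smul] at h4
  exact h4

theorem pairing_hamVec (Ω : SymplecticForm N) (H : N → ℝ) (z : N) (v : Plane) :
    Ω.pairing z (hamVec Ω H z) v = - differential H z v :=
  hamiltonianVectorField_spec Ω H z v

theorem differential_hamVec (Ω : SymplecticForm N) (H : N → ℝ) (z : N) :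
    differential H z (hamVec Ω H z) = 0 := by
  have h := pairing_hamVec Ω H z (hamVec Ω H z)
  rw [Ω.pairing_self] at h
  linarith

theorem hamVec_eq_zero_iff (Ω : SymplecticForm N) (H : N → ℝ) (z : N) :
    hamVec Ω H z = 0 ↔ differential H z = 0 := by
  constructor
  · intro h
    ext v
    have h1 := pairing_hamVec Ω H z v
    rw [h, SymplecticForm.pairing, map_zero, zero_apply] at h1
    rw [zero_apply]; linarith
  · intro h
    have key : ∀ w : Plane, Ω.pairing z (hamVec Ω H z) w = 0 := fun w ↦ by
      rw [pairing_hamVec, h, zero_apply, neg_zero]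
    exact Ω.nondegenerate z _ key

end ChartRepresentation

/-! ### The global smooth flow of a proper Hamiltonian -/

section Flow

variable {N : Type*} [TopologicalSpace N] [ChartedSpace Plane N] [IsManifold (𝓡 2) ∞ N]

/-- The flow of the chart vector field is transported to the surface. The domain depends on `n`;
uniqueness of orbits later identifies the flows for different `n`. -/
theorem exists_local_hamiltonian_flow (Ω : SymplecticForm N) {H : N → ℝ}
    (hH : ContMDiff (𝓡 2) 𝓘(ℝ, ℝ) ∞ H) (n : ℕ) (p : N) :
    ∃ W : Set N, IsOpen W ∧ p ∈ W ∧ ∃ ε > 0, ∃ β : ℝ → N → N,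
      ContMDiffOn (𝓘(ℝ, ℝ).prod (𝓡 2)) (𝓡 2) n (fun q : ℝ × N ↦ β q.1 q.2) (Ioo (-ε) ε ×ˢ W) ∧
      ∀ x ∈ W, β 0 x = x ∧ ∀ t ∈ Ioo (-ε) ε, HasMFDerivAt 𝓘(ℝ, ℝ) (𝓡 2) (fun s ↦ β s x) t
        ((1 : ℝ →L[ℝ] ℝ).smulRight (hamiltonianVectorField Ω H (β t x))) := by
  set e := chartAt Plane p
  obtain ⟨W, hW, hpW, ε, hε, α, hα, hflow⟩ := exists_contDiffOn_local_flow n e.open_target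
    (contDiffOn_chartVectorField Ω hH p) (mem_chart_target Plane p)
  refine ⟨e.source ∩ e ⁻¹' W, e.isOpen_inter_preimage hW, ⟨mem_chart_source Plane p, hpW⟩, ε, hε,
    fun t x ↦ e.symm (α (e x, t)), ?_, fun x hx ↦ ⟨?_, fun t ht ↦ ?_⟩⟩
  · have h1 : ContMDiffOn (𝓘(ℝ, ℝ).prod (𝓡 2)) 𝓘(ℝ, Plane × ℝ) n
        (fun q : ℝ × N ↦ (e q.2, q.1)) (Ioo (-ε) ε ×ˢ (e.source ∩ e ⁻¹' W)) := by
      rw [modelWithCornersSelf_prod, ← chartedSpaceSelf_prod]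
      refine ContMDiffOn.prodMk ?_ contMDiffOn_fst
      refine ((contMDiffOn_chart (I := 𝓡 2) (x := p) (n := ∞)).of_le (by exact_mod_cast le_top)).comp
        contMDiffOn_snd fun q hq ↦ hq.2.1
    have h2 := hα.contMDiffOn.comp h1 fun q hq ↦ ⟨hq.2.2, hq.1⟩
    refine ((contMDiffOn_chart_symm (I := 𝓡 2) (x := p) (n := ∞)).of_le
      (by exact_mod_cast le_top)).comp h2 fun q hq ↦ ?_
    exact ((hflow _ hq.2.2).2 q.1 hq.1).1
  · simp only [(hflow _ hx.2).1]; exact e.left_inv hx.1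
  · have h := (hflow _ hx.2).2 t ht
    exact hasMFDerivAt_of_chart Ω hH p h.2 h.1

theorem IsHamiltonianOrbit.level_eq {Ω : SymplecticForm N} {H : N → ℝ}
    (hH : ContMDiff (𝓡 2) 𝓘(ℝ, ℝ) ∞ H) {γ : ℝ → N} (hγ : IsHamiltonianOrbit Ω H γ) (s t : ℝ) :
    H (γ s) = H (γ t) := by
  refine is_const_of_deriv_eq_zero (f := fun s ↦ H (γ s)) ?_ ?_ s t
  · intro t
    exact (hasDerivAt_comp_orbit Ω (H := H) hH (k := 1)
      (by rw [one_smul]; exact hγ t)).differentiableAt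
  · intro t
    rw [(hasDerivAt_comp_orbit Ω (H := H) hH (k := 1) (by rw [one_smul]; exact hγ t)).deriv,
      differential_hamVec, mul_zero]

variable [T2Space N]

/-- The Hamiltonian vector field of a proper function is complete. -/
theorem exists_hamiltonianOrbit (Ω : SymplecticForm N) {H : N → ℝ}
    (hH : ContMDiff (𝓡 2) 𝓘(ℝ, ℝ) ∞ H) (hproper : IsProperMap H) (x : N) :
    ∃ γ : ℝ → N, γ 0 = x ∧ IsHamiltonianOrbit Ω H γ := by
  -- The field `χ(H) X_H` vanishes outside a compact set, by properness, so a single existence time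
  -- serves all initial points. On the level of `x` it coincides with `X_H`.
  let χ : ContDiffBump (H x) := ⟨1, 2, by norm_num, by norm_num⟩
  have hcpt : IsCompact (H ⁻¹' Metric.closedBall (H x) 2) :=
    hproper.isCompact_preimage (isCompact_closedBall _ _)
  have hX := contMDiff_hamiltonianVectorField Ω hH
  have hχ : ContMDiff (𝓡 2) 𝓘(ℝ, ℝ) ∞ (fun z ↦ χ (H z)) := χ.contDiff.contMDiff.comp hH
  have hY : ContMDiff (𝓡 2) (𝓡 2).tangent 1 (fun z ↦
      (⟨z, χ (H z) • hamiltonianVectorField Ω H z⟩ : TangentBundle (𝓡 2) N)) :=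
    (hχ.smul_section hX).of_le (by exact_mod_cast le_top)
  choose W hW hpW ε hε β hβ hflow using exists_local_hamiltonian_flow Ω hH 1
  obtain ⟨s, hs⟩ := hcpt.elim_finite_subcover (ι := N) W hW fun z _ ↦ mem_iUnion.mpr ⟨z, hpW z⟩
  obtain ⟨δ, hδ, hδs⟩ : ∃ δ > 0, ∀ i ∈ s, δ ≤ ε i := by
    classical
    clear hs
    induction s using Finset.induction_on with
    | empty => exact ⟨1, one_pos, by simp⟩
    | insert a s _ ih =>
      obtain ⟨δ, hδ, h⟩ := ih
      refine ⟨min δ (ε a), lt_min hδ (hε a), fun i hi ↦ ?_⟩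
      rcases Finset.mem_insert.mp hi with rfl | hi
      · exact min_le_right _ _
      · exact (min_le_left _ _).trans (h i hi)
  have hlocal : ∀ y : N, ∃ γ : ℝ → N, γ 0 = y ∧
      IsMIntegralCurveOn (I := 𝓡 2) γ (fun z ↦ χ (H z) • hamiltonianVectorField Ω H z)
        (Ioo (-δ) δ) := by
    intro y
    by_cases hy : χ (H y) = 0
    · refine ⟨fun _ ↦ y, rfl, ?_⟩
      exact (isMIntegralCurve_const (by simp [hy])).isMIntegralCurveOn _
    · have hyK : y ∈ H ⁻¹' Metric.closedBall (H x) 2 := by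
        have : H y ∈ Function.support χ := hy
        rw [χ.support_eq] at this
        exact Metric.ball_subset_closedBall this
      obtain ⟨i, hi, hyi⟩ : ∃ i ∈ s, y ∈ W i := by simpa using hs hyK
      set k := χ (H y) with hk
      have hk0 : 0 ≤ k := χ.nonneg
      have hk1 : k ≤ 1 := χ.le_one
      obtain ⟨h0, h1⟩ := hflow i y hyi
      have hkt : ∀ t ∈ Ioo (-δ) δ, k * t ∈ Ioo (-(ε i)) (ε i) := fun t ht ↦ by
        rw [mem_Ioo, ← abs_lt, abs_mul, abs_of_nonneg hk0]
        have := abs_lt.mpr ht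
        have := hδs i hi
        nlinarith [abs_nonneg t]
      -- Since `H` is conserved, the cut-off factor is constant along each orbit, and an orbit of
      -- the cut-off field is an orbit of `X_H` run at the constant speed `k`.
      have hlev : ∀ t ∈ Ioo (-(ε i)) (ε i), H (β i t y) = H y := by
        intro t ht
        have hd : ∀ t ∈ Ioo (-(ε i)) (ε i), HasDerivAt (fun s ↦ H (β i s y)) 0 t := fun t ht ↦ by
          have := hasDerivAt_comp_orbit Ω (H := H) hH (k := 1) (γ := fun s ↦ β i s y)
            (by rw [one_smul]; exact h1 t ht)
          rwa [differential_hamVec, mul_zero] at this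
        have := (convex_Ioo (-(ε i)) (ε i)).is_const_of_fderivWithin_eq_zero (𝕜 := ℝ)
          (f := fun s ↦ H (β i s y)) (fun t ht ↦ (hd t ht).differentiableAt.differentiableWithinAt)
          (fun t ht ↦ by
            rw [((hd t ht).hasFDerivAt.hasFDerivWithinAt).fderivWithin
              (isOpen_Ioo.uniqueDiffWithinAt ht)]; ext; simp) ht
          (show (0 : ℝ) ∈ Ioo (-(ε i)) (ε i) by simpa using hε i)
        simpa [h0] using this
      refine ⟨fun t ↦ β i (k * t) y, by simpa using h0, fun t ht ↦ ?_⟩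
      have h2 := h1 _ (hkt t ht)
      have h3 : HasDerivAt (fun t ↦ k * t) k t := by simpa using (hasDerivAt_id t).const_mul k
      have h4 := (h2.comp t h3.hasFDerivAt.hasMFDerivAt).hasMFDerivWithinAt (s := Ioo (-δ) δ)
      refine h4.congr_mfderiv ?_
      have h5 : (velocityMap (hamVec Ω H (β i (k * t) y))).comp
          (ContinuousLinearMap.toSpanSingleton ℝ k) =
          velocityMap (χ (H (β i (k * t) y)) • hamVec Ω H (β i (k * t) y)) := by
        refine ContinuousLinearMap.ext_ring ?_
        rw [hlev _ (hkt t ht), velocityMap_one, ← hk]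
        simp [velocityMap]
      exact h5
  obtain ⟨γ, hγ0, hγ⟩ := exists_isMIntegralCurve_of_isMIntegralCurveOn hY hδ hlocal x
  have hlev : ∀ t, H (γ t) = H x := by
    intro t
    have hd : ∀ t, HasDerivAt (fun s ↦ H (γ s)) 0 t := fun t ↦ by
      have := hasDerivAt_comp_orbit Ω (H := H) hH (hγ t)
      rwa [differential_hamVec, mul_zero] at this
    rw [is_const_of_deriv_eq_zero (fun t ↦ (hd t).differentiableAt) (fun t ↦ (hd t).deriv) t 0, hγ0]
  refine ⟨γ, hγ0, fun t ↦ ?_⟩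
  have h := hγ t
  have h1 : χ (H (γ t)) = 1 := by
    rw [hlev]; exact χ.one_of_mem_closedBall (Metric.mem_closedBall_self (by positivity))
  simp only [h1, one_smul] at h
  exact h

/-- `φ` is the global flow of the Hamiltonian vector field. -/
structure IsHamiltonianFlow (Ω : SymplecticForm N) (H : N → ℝ) (φ : ℝ → N → N) : Prop where
  orbit : ∀ x, IsHamiltonianOrbit Ω H (fun t ↦ φ t x)
  flow_zero : ∀ x, φ 0 x = x
  flow_add : ∀ s t x, φ (s + t) x = φ s (φ t x)
  unique : ∀ γ, IsHamiltonianOrbit Ω H γ → ∀ t, γ t = φ t (γ 0)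
  level : ∀ t x, H (φ t x) = H x
  smooth : ContMDiff (𝓘(ℝ, ℝ).prod (𝓡 2)) (𝓡 2) ∞ (fun p : ℝ × N ↦ φ p.1 p.2)

/-- Existence and uniqueness of orbits give the group law. For smoothness, fix `n` and `x`: the set
of times `t` at which the flow is `C^n` at `(t, x)` is clopen, because near `t` the flow is the
composition of the time-`s` map with a short-time local flow. It contains `0`, hence is the whole
line. -/
theorem exists_isHamiltonianFlow (Ω : SymplecticForm N) {H : N → ℝ}
    (hH : ContMDiff (𝓡 2) 𝓘(ℝ, ℝ) ∞ H) (hproper : IsProperMap H) :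
    ∃ φ, IsHamiltonianFlow Ω H φ := by
  choose γ hγ0 hγ using exists_hamiltonianOrbit Ω hH hproper
  have hX : ContMDiff (𝓡 2) (𝓡 2).tangent 1
      (fun z ↦ (⟨z, hamiltonianVectorField Ω H z⟩ : TangentBundle (𝓡 2) N)) :=
    (contMDiff_hamiltonianVectorField Ω hH).of_le (by exact_mod_cast le_top)
  have huniq : ∀ δ, IsHamiltonianOrbit Ω H δ → ∀ t, δ t = γ (δ 0) t := fun δ hδ t ↦
    congrFun (isMIntegralCurve_Ioo_eq_of_contMDiff_boundaryless (t₀ := 0) hX hδ (hγ _)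
      (by rw [hγ0])) t
  have hadd : ∀ s t x, γ x (s + t) = γ (γ x t) s := fun s t x ↦ by
    have := huniq (fun s ↦ γ x (s + t)) (IsMIntegralCurve.comp_add (hγ x) t) s
    simpa using this
  refine ⟨fun t x ↦ γ x t, hγ, hγ0, hadd, huniq, fun t x ↦ ?_, ?_⟩
  · rw [(hγ x).level_eq hH t 0, hγ0]
  rw [contMDiff_infty]
  intro n
  have hloc : ∀ p : N, ∃ O : Set N, IsOpen O ∧ p ∈ O ∧ ∃ ε > 0, ∀ x ∈ O, ∀ t ∈ Ioo (-ε) ε,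
      ContMDiffAt (𝓘(ℝ, ℝ).prod (𝓡 2)) (𝓡 2) n (fun q : ℝ × N ↦ γ q.2 q.1) (t, x) := by
    intro p
    obtain ⟨W, hW, hpW, ε, hε, β, hβ, hflow⟩ := exists_local_hamiltonian_flow Ω hH n p
    refine ⟨W, hW, hpW, ε, hε, fun x hx t ht ↦ ?_⟩
    have hmem : Ioo (-ε) ε ×ˢ W ∈ 𝓝 (t, x) := (isOpen_Ioo.prod hW).mem_nhds ⟨ht, hx⟩
    refine (hβ.contMDiffAt hmem).congr_of_eventuallyEq ?_
    filter_upwards [hmem] with q hq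
    exact isMIntegralCurveOn_Ioo_eqOn_of_contMDiff_boundaryless (t₀ := 0) (by simpa using hε) hX
      ((hγ q.2).isMIntegralCurveOn _)
      (fun t ht ↦ ((hflow q.2 hq.2).2 t ht).hasMFDerivWithinAt)
      (by rw [hγ0, (hflow q.2 hq.2).1]) hq.1
  rintro ⟨t, x⟩
  set S := {t | ContMDiffAt (𝓘(ℝ, ℝ).prod (𝓡 2)) (𝓡 2) n (fun q : ℝ × N ↦ γ q.2 q.1) (t, x)} with hS
  suffices hSu : S = univ by
    have : t ∈ S := hSu ▸ mem_univ t
    exact this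
  have hstep : ∀ s t, s ∈ S → ContMDiffAt (𝓘(ℝ, ℝ).prod (𝓡 2)) (𝓡 2) n
      (fun q : ℝ × N ↦ γ q.2 q.1) (t - s, γ x s) → t ∈ S := by
    intro s t hs ht
    have h1 : ContMDiffAt (𝓘(ℝ, ℝ).prod (𝓡 2)) (𝓡 2) n
        (fun q : ℝ × N ↦ γ q.2 s) (t, x) :=
      ContMDiffAt.comp (t, x) (g := fun q : ℝ × N ↦ γ q.2 q.1) (f := fun q : ℝ × N ↦ (s, q.2)) hs
        (contMDiffAt_const.prodMk contMDiffAt_snd)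
    have h2 : ContMDiffAt (𝓘(ℝ, ℝ).prod (𝓡 2)) 𝓘(ℝ, ℝ) n
        (fun q : ℝ × N ↦ q.1 - s) (t, x) :=
      ((contDiff_id.sub contDiff_const).contMDiff.contMDiffAt).comp (t, x) contMDiffAt_fst
    have h3 := ContMDiffAt.comp (t, x) (g := fun q : ℝ × N ↦ γ q.2 q.1)
      (f := fun q : ℝ × N ↦ (q.1 - s, γ q.2 s)) ht (h2.prodMk h1)
    refine h3.congr_of_eventuallyEq (Filter.Eventually.of_forall fun q ↦ ?_)
    simp only [Function.comp]
    rw [← hadd]; simp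
  have hcont : Continuous (γ x) := continuous_iff_continuousAt.mpr fun t ↦ (hγ x t).continuousAt
  refine IsClopen.eq_univ ⟨?_, ?_⟩ ⟨0, ?_⟩
  · rw [← closure_subset_iff_isClosed]
    -- The local box is taken around the limit point `γ x t`, so that it already contains `γ x s`
    -- for times `s` in the set close to `t`.
    intro t ht
    obtain ⟨O, hO, hpO, ε, hε, h⟩ := hloc (γ x t)
    have hev : ∀ᶠ s in 𝓝 t, γ x s ∈ O ∧ t - s ∈ Ioo (-ε) ε := by
      refine (hcont.continuousAt.eventually_mem (hO.mem_nhds hpO)).and ?_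
      have : ContinuousAt (fun s ↦ t - s) t := by fun_prop
      exact this.eventually_mem (isOpen_Ioo.mem_nhds (by simpa using hε))
    obtain ⟨s, hs, hsS⟩ := (mem_closure_iff_frequently.mp ht).and_eventually hev |>.exists
    exact hstep s t hs (h _ hsS.1 _ hsS.2)
  · rw [isOpen_iff_mem_nhds]
    intro s hs
    obtain ⟨O, hO, hpO, ε, hε, h⟩ := hloc (γ x s)
    have : ContinuousAt (fun t ↦ t - s) s := by fun_prop
    filter_upwards [this.eventually_mem (isOpen_Ioo.mem_nhds (by simpa using hε : s - s ∈ Ioo (-ε) ε))]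
      with t ht
    exact hstep s t hs (h _ hpO _ ht)
  · obtain ⟨O, hO, hpO, ε, hε, h⟩ := hloc x
    exact h x hpO 0 (by simpa using hε)

end Flow

/-! ### Periods of orbits and flow boxes -/

section FlowBox

variable {N : Type*} [TopologicalSpace N] [ChartedSpace Plane N] [IsManifold (𝓡 2) ∞ N]

/-- `τ` is the least positive period of the `φ`-orbit of `x`. -/
def IsLeastPeriod (φ : ℝ → N → N) (x : N) (τ : ℝ) : Prop :=
  0 < τ ∧ φ τ x = x ∧ ∀ t ∈ Ioo 0 τ, φ t x ≠ x

namespace IsHamiltonianFlow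

variable {Ω : SymplecticForm N} {H : N → ℝ} {φ : ℝ → N → N} (hφ : IsHamiltonianFlow Ω H φ)
include hφ

section Smoothness

variable {E' H' M' : Type*} [NormedAddCommGroup E'] [NormedSpace ℝ E'] [TopologicalSpace H']
  {I' : ModelWithCorners ℝ E' H'} [TopologicalSpace M'] [ChartedSpace H' M']
  {f : M' → ℝ} {g : M' → N} {s : Set M'} {x : M'}

theorem contMDiffWithinAt (hf : ContMDiffWithinAt I' 𝓘(ℝ, ℝ) ∞ f s x)
    (hg : ContMDiffWithinAt I' (𝓡 2) ∞ g s x) :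
    ContMDiffWithinAt I' (𝓡 2) ∞ (fun y ↦ φ (f y) (g y)) s x :=
  (hφ.smooth.contMDiffAt (x := (f x, g x))).comp_contMDiffWithinAt x (hf.prodMk hg)

theorem contMDiffOn (hf : ContMDiffOn I' 𝓘(ℝ, ℝ) ∞ f s) (hg : ContMDiffOn I' (𝓡 2) ∞ g s) :
    ContMDiffOn I' (𝓡 2) ∞ (fun y ↦ φ (f y) (g y)) s :=
  fun y hy ↦ hφ.contMDiffWithinAt (hf y hy) (hg y hy)

end Smoothness

theorem continuous : Continuous (fun p : ℝ × N ↦ φ p.1 p.2) := hφ.smooth.continuous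

theorem neg_apply (t : ℝ) (x : N) : φ (-t) (φ t x) = x := by
  rw [← hφ.flow_add, neg_add_cancel, hφ.flow_zero]

theorem comm (s t : ℝ) (x : N) : φ s (φ t x) = φ t (φ s x) := by
  rw [← hφ.flow_add, ← hφ.flow_add, add_comm]

theorem eq_iff (s t : ℝ) (x : N) : φ s x = φ t x ↔ φ (s - t) x = x := by
  constructor
  · intro h
    rw [sub_eq_add_neg, add_comm, hφ.flow_add, h, hφ.neg_apply]
  · intro h
    conv_rhs => rw [← h, ← hφ.flow_add]
    simp

theorem periodic {x : N} {τ : ℝ} (h : φ τ x = x) (n : ℤ) : φ (n * τ) x = x := by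
  have hnat : ∀ k : ℕ, φ (k * τ) x = x := by
    intro k
    induction k with
    | zero => simpa using hφ.flow_zero x
    | succ k ih => push_cast; rw [add_mul, one_mul, hφ.flow_add, h, ih]
  obtain ⟨k, rfl | rfl⟩ := n.eq_nat_or_neg
  · exact_mod_cast hnat k
  · have := hφ.neg_apply (k * τ) x
    rw [hnat] at this
    push_cast
    rwa [neg_mul]

theorem _root_.IsLeastPeriod.period_iff {x : N} {τ : ℝ} (h : IsLeastPeriod φ x τ) (t : ℝ) :
    φ t x = x ↔ ∃ n : ℤ, t = n * τ := by
  constructor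
  · intro ht
    obtain ⟨h0, h1, h2⟩ := h
    refine ⟨⌊t / τ⌋, ?_⟩
    by_contra hne
    have h3 : φ (t - ⌊t / τ⌋ * τ) x = x := by
      rw [← hφ.eq_iff, ht, hφ.periodic h1]
    refine h2 _ ⟨?_, ?_⟩ h3
    · refine lt_of_le_of_ne ?_ fun h ↦ hne (by linarith)
      have := (le_div_iff₀ h0).mp (Int.floor_le (t / τ))
      linarith
    · have := (div_lt_iff₀ h0).mp (Int.lt_floor_add_one (t / τ))
      linarith
  · rintro ⟨n, rfl⟩
    exact hφ.periodic h.2.1 n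

theorem range_eq {x y : N} (h : y ∈ range (fun t ↦ φ t x)) :
    range (fun t ↦ φ t y) = range (fun t ↦ φ t x) := by
  obtain ⟨s, rfl⟩ := h
  ext w
  constructor
  · rintro ⟨t, rfl⟩
    exact ⟨t + s, hφ.flow_add t s x⟩
  · rintro ⟨t, rfl⟩
    refine ⟨t - s, ?_⟩
    simp only
    rw [← hφ.flow_add]; simp

theorem isLeastPeriod_apply {x : N} {τ : ℝ} (h : IsLeastPeriod φ x τ) (s : ℝ) :
    IsLeastPeriod φ (φ s x) τ := by
  refine ⟨h.1, by rw [hφ.comm, h.2.1], fun t ht heq ↦ h.2.2 t ht ?_⟩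
  rw [hφ.comm] at heq
  rw [← hφ.neg_apply s (φ t x), heq, hφ.neg_apply]

/-- Any parametrisation of the same circle as an orbit is a time shift of the flow orbit, so its
periods are return times of `x`. -/
theorem orbitPeriod_eq {x : N} {τ : ℝ} (h : IsLeastPeriod φ x τ) :
    orbitPeriod Ω H (range (fun t ↦ φ t x)) = τ := by
  refine IsLeast.csInf_eq ⟨⟨h.1, fun t ↦ φ t x, hφ.orbit x, fun t ↦ ?_, rfl⟩, ?_⟩
  · simp only
    rw [hφ.flow_add, h.2.1]
  · rintro T ⟨hT, γ, hγ, hper, hr⟩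
    have hx : x ∈ range γ := hr ▸ ⟨0, hφ.flow_zero x⟩
    obtain ⟨s, rfl⟩ := hx
    by_contra hlt
    refine h.2.2 T ⟨hT, not_le.mp hlt⟩ ?_
    have h1 := hφ.unique γ hγ (T + s)
    rw [hφ.flow_add, ← hφ.unique γ hγ s, add_comm, hper] at h1
    exact h1.symm

theorem hasDerivAt_chart {p : N} (hH : ContMDiff (𝓡 2) 𝓘(ℝ, ℝ) ∞ H) {t : ℝ} {x : N}
    (ht : φ t x ∈ (chartAt Plane p).source) :
    HasDerivAt (fun s ↦ chartAt Plane p (φ s x))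
      (chartVectorField Ω H p (chartAt Plane p (φ t x))) t :=
  hasDerivAt_chart_of_orbit Ω hH p (hφ.orbit x t) ht

theorem fixed_of_hamVec_eq_zero {x : N} (h : hamVec Ω H x = 0) (t : ℝ) : φ t x = x := by
  have hc : IsHamiltonianOrbit Ω H (fun _ ↦ x) := isMIntegralCurve_const h
  exact (hφ.unique _ hc t).symm

theorem _root_.IsLeastPeriod.hamVec_ne_zero {x : N} {τ : ℝ} (h : IsLeastPeriod φ x τ) : hamVec Ω H x ≠ 0 := fun h0 ↦
  h.2.2 (τ / 2) ⟨by linarith [h.1], by linarith [h.1]⟩ (hφ.fixed_of_hamVec_eq_zero h0 _)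

/-- The flow box around a transversal section of the level sets. -/
theorem exists_flowBox (hH : ContMDiff (𝓡 2) 𝓘(ℝ, ℝ) ∞ H) {σ : ℝ → N} {A : Set ℝ}
    (hA : IsOpen A) (hσ : ContMDiffOn 𝓘(ℝ, ℝ) (𝓡 2) ∞ σ A) (hlev : ∀ c ∈ A, H (σ c) = c)
    {c₁ : ℝ} (hc₁ : c₁ ∈ A) (hreg : hamVec Ω H (σ c₁) ≠ 0) :
    ∃ ε > 0, Ioo (c₁ - ε) (c₁ + ε) ⊆ A ∧ ∃ U : Set N, IsOpen U ∧ σ c₁ ∈ U ∧ ∃ s : N → ℝ,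
      ContMDiffOn (𝓡 2) 𝓘(ℝ, ℝ) ∞ s U ∧
      (∀ y ∈ U, H y ∈ Ioo (c₁ - ε) (c₁ + ε) ∧ s y ∈ Ioo (-ε) ε ∧ φ (s y) (σ (H y)) = y) ∧
      ∀ c ∈ Ioo (c₁ - ε) (c₁ + ε), ∀ t ∈ Ioo (-ε) ε, φ t (σ c) ∈ U ∧ s (φ t (σ c)) = t := by
  set p := σ c₁ with hp
  set e := chartAt Plane p with he
  have hG : ContMDiffOn 𝓘(ℝ, ℝ × ℝ) (𝓡 2) ∞ (fun q : ℝ × ℝ ↦ φ q.2 (σ q.1)) (A ×ˢ univ) :=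
    hφ.contMDiffOn contDiff_snd.contMDiff.contMDiffOn
      (hσ.comp contDiff_fst.contMDiff.contMDiffOn fun q hq ↦ hq.1)
  set S : Set (ℝ × ℝ) := (A ×ˢ univ) ∩ (fun q : ℝ × ℝ ↦ φ q.2 (σ q.1)) ⁻¹' e.source with hSdef
  have hS : IsOpen S :=
    hG.continuousOn.isOpen_inter_preimage (hA.prod isOpen_univ) e.open_source
  set g : ℝ × ℝ → Plane := fun q ↦ e (φ q.2 (σ q.1)) with hg
  have hgS : ContDiffOn ℝ ∞ g S := by
    rw [← contMDiffOn_iff_contDiffOn]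
    exact (contMDiffOn_chart (I := 𝓡 2) (x := p)).comp (hG.mono inter_subset_left)
      fun q hq ↦ hq.2
  have hcS : (c₁, (0 : ℝ)) ∈ S := ⟨⟨hc₁, mem_univ _⟩, by
    simp only [mem_preimage]; rw [hφ.flow_zero]; exact mem_chart_source Plane p⟩
  have hgd : DifferentiableAt ℝ g (c₁, 0) :=
    (hgS.contDiffAt (hS.mem_nhds hcS)).differentiableAt (by simp)
  have hVne : chartVectorField Ω H p (e p) ≠ 0 := fun h0 ↦ hreg (by
    have := hamVec_chart Ω hH p (mem_chart_target Plane p)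
    rw [← he, h0, map_zero, e.left_inv (mem_chart_source Plane p)] at this
    exact this)
  -- Composing with `H` returns the level coordinate, which kills the first component of a kernel
  -- vector; what remains is a multiple of the non-zero Hamiltonian vector.
  have hinj : Function.Injective (fderiv ℝ g (c₁, 0)) := by
    rw [injective_iff_map_eq_zero]
    rintro ⟨a, b⟩ hab
    have h1 : HasFDerivAt (fun q : ℝ × ℝ ↦ chartFunction H p (g q))
        ((fderiv ℝ (chartFunction H p) (g (c₁, 0))).comp (fderiv ℝ g (c₁, 0))) (c₁, 0) := by
      refine HasFDerivAt.comp (g := chartFunction H p) _ (DifferentiableAt.hasFDerivAt ?_)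
        hgd.hasFDerivAt
      exact ((contDiffOn_chartFunction hH p).contDiffAt
        (e.open_target.mem_nhds (e.map_source hcS.2))).differentiableAt (by simp)
    have h2 : HasFDerivAt (fun q : ℝ × ℝ ↦ chartFunction H p (g q))
        (ContinuousLinearMap.fst ℝ ℝ ℝ) (c₁, 0) := by
      refine hasFDerivAt_fst.congr_of_eventuallyEq ?_
      filter_upwards [hS.mem_nhds hcS] with q hq
      simp only [chartFunction, hg]
      rw [e.left_inv hq.2, hφ.level, hlev _ hq.1.1]
    have ha : a = 0 := by
      have := congrArg (fun L : ℝ × ℝ →L[ℝ] ℝ ↦ L (a, b)) (h2.unique h1)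
      simp only [ContinuousLinearMap.coe_fst', ContinuousLinearMap.comp_apply, hab] at this
      exact this.trans (map_zero _)
    subst ha
    have h3 : HasDerivAt (fun t : ℝ ↦ g (c₁, t)) (fderiv ℝ g (c₁, 0) (0, 1)) 0 :=
      hgd.hasFDerivAt.comp_hasDerivAt (0 : ℝ) ((hasDerivAt_const _ _).prodMk (hasDerivAt_id _))
    have h4 : HasDerivAt (fun t : ℝ ↦ g (c₁, t)) (chartVectorField Ω H p (e p)) 0 := by
      have := hφ.hasDerivAt_chart hH (p := p) (t := 0) (x := σ c₁) hcS.2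
      rwa [hφ.flow_zero] at this
    have h5 : fderiv ℝ g (c₁, 0) (0, b) = b • chartVectorField Ω H p (e p) := by
      rw [← h3.unique h4, ← map_smul]; simp
    rw [hab] at h5
    rcases smul_eq_zero.mp h5.symm with h | h
    · rw [h]; rfl
    · exact absurd h hVne
  obtain ⟨e₂, hc₂, hsrc, heq, hsm, hsm'⟩ := exists_openPartialHomeomorph_of_injective_fderiv
    (by simp) hS hgS hcS hinj
  obtain ⟨ε, hε, hball⟩ := Metric.isOpen_iff.mp e₂.open_source _ hc₂
  have hbox : ∀ c ∈ Ioo (c₁ - ε) (c₁ + ε), ∀ t ∈ Ioo (-ε) ε, (c, t) ∈ e₂.source := by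
    intro c hc t ht
    refine hball ?_
    rw [Metric.mem_ball, Prod.dist_eq, max_lt_iff, Real.dist_eq, Real.dist_eq, abs_lt, abs_lt]
    simp only [sub_zero]
    exact ⟨⟨by linarith [hc.1], by linarith [hc.2]⟩, ht⟩
  set B : Set (ℝ × ℝ) := Ioo (c₁ - ε) (c₁ + ε) ×ˢ Ioo (-ε) ε with hB
  have hBo : IsOpen B := isOpen_Ioo.prod isOpen_Ioo
  have hBs : B ⊆ e₂.source := fun q hq ↦ hbox q.1 hq.1 q.2 hq.2
  have hBt : IsOpen (e₂.target ∩ e₂.symm ⁻¹' B) := e₂.symm.isOpen_inter_preimage hBo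
  refine ⟨ε, hε, fun c hc ↦ (hsrc (hbox c hc 0 (by simpa using hε))).1.1,
    e.source ∩ e ⁻¹' (e₂.target ∩ e₂.symm ⁻¹' B), e.isOpen_inter_preimage hBt, ?_,
    fun y ↦ (e₂.symm (e y)).2, ?_, ?_, ?_⟩
  · have h0 : e p = e₂ (c₁, 0) := by rw [heq]; simp only [hg]; rw [hφ.flow_zero]
    refine ⟨mem_chart_source Plane p, ?_, ?_⟩
    · rw [h0]; exact e₂.map_source hc₂
    · simp only [mem_preimage]
      rw [h0, e₂.left_inv hc₂]
      exact ⟨by simpa using hε, by simpa using hε⟩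
  · have h1 := hsm'.contMDiffOn.comp ((contMDiffOn_chart (I := 𝓡 2) (x := p)).mono
      (inter_subset_left (t := e ⁻¹' (e₂.target ∩ e₂.symm ⁻¹' B)))) fun y hy ↦ hy.2.1
    exact contDiff_snd.contMDiff.comp_contMDiffOn h1
  · rintro y ⟨hy1, hy2, hy3⟩
    set q := e₂.symm (e y) with hq
    have h1 : φ q.2 (σ q.1) = y := by
      have h2 := e₂.right_inv hy2
      rw [← hq, heq] at h2
      exact e.injOn (hsrc (hBs hy3)).2 hy1 h2
    have h3 : H y = q.1 := by
      rw [← h1, hφ.level, hlev _ (hsrc (hBs hy3)).1.1]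
    rw [h3]
    exact ⟨hy3.1, hy3.2, h1⟩
  · intro c hc t ht
    have h1 := hbox c hc t ht
    have h2 : e (φ t (σ c)) = e₂ (c, t) := (heq (c, t)).symm
    refine ⟨⟨(hsrc h1).2, ?_, ?_⟩, ?_⟩
    · rw [h2]; exact e₂.map_source h1
    · simp only [mem_preimage]
      rw [h2, e₂.left_inv h1]; exact ⟨hc, ht⟩
    · simp only
      rw [h2, e₂.left_inv h1]

omit hφ in
/-- Through a regular point passes a section of the level sets. -/
theorem _root_.exists_level_section (hH : ContMDiff (𝓡 2) 𝓘(ℝ, ℝ) ∞ H) {z : N}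
    (hreg : hamVec Ω H z ≠ 0) :
    ∃ δ > 0, ∃ σ : ℝ → N, σ (H z) = z ∧
      ContMDiffOn 𝓘(ℝ, ℝ) (𝓡 2) ∞ σ (Ioo (H z - δ) (H z + δ)) ∧
      ∀ c ∈ Ioo (H z - δ) (H z + δ), H (σ c) = c := by
  set e := chartAt Plane z with he
  have hz := mem_chart_target Plane z
  obtain ⟨v, hv⟩ : ∃ v, fderiv ℝ (chartFunction H z) (e z) v ≠ 0 := by
    by_contra! h
    refine hreg ((hamVec_eq_zero_iff Ω H z).mpr ?_)
    ext w
    obtain ⟨a, b, rfl⟩ := chartTangent_surjective z hz w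
    have e0 := differential_chartTangent hH z hz planeE0
    have e1 := differential_chartTangent hH z hz planeE1
    rw [e.left_inv (mem_chart_source Plane z)] at e0 e1
    rw [map_add, map_smul, map_smul, e0, e1, h, h]
    simp
  -- The section is a straight line in the chart, transverse to the level and reparametrised by the
  -- value of `H`.
  set l : ℝ → Plane := fun r ↦ e z + r • v with hl
  have hlc : ContDiff ℝ ∞ l := contDiff_const.add (contDiff_id.smul contDiff_const)
  set S : Set ℝ := l ⁻¹' e.target with hSdef
  have hS : IsOpen S := e.open_target.preimage hlc.continuous
  have h0S : (0 : ℝ) ∈ S := by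
    simp only [hSdef, hl, mem_preimage, zero_smul, add_zero]; exact hz
  have hf : ContDiffOn ℝ ∞ (fun r ↦ chartFunction H z (l r)) S :=
    (contDiffOn_chartFunction hH z).comp hlc.contDiffOn fun r hr ↦ hr
  have hl0 : l 0 = e z := by simp [hl]
  have hd : HasDerivAt (fun r ↦ chartFunction H z (l r))
      (fderiv ℝ (chartFunction H z) (e z) v) 0 := by
    have h1 : HasFDerivAt (chartFunction H z) (fderiv ℝ (chartFunction H z) (e z)) (l 0) := by
      rw [hl0]
      exact (((contDiffOn_chartFunction hH z).contDiffAt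
        (e.open_target.mem_nhds hz)).differentiableAt (by simp)).hasFDerivAt
    refine h1.comp_hasDerivAt (0 : ℝ) ?_
    have := ((hasDerivAt_id (0 : ℝ)).smul_const v).const_add (e z)
    rwa [one_smul] at this
  have hinj : Function.Injective (fderiv ℝ (fun r ↦ chartFunction H z (l r)) 0) := by
    rw [injective_iff_map_eq_zero]
    intro a ha
    rw [hd.hasFDerivAt.fderiv] at ha
    simpa [hv] using ha
  obtain ⟨e₂, hc₂, hsrc, heq, hsm, hsm'⟩ := exists_openPartialHomeomorph_of_injective_fderiv
    rfl hS hf h0S hinj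
  have hz2 : e₂ 0 = H z := by
    rw [heq, hl0, chartFunction, e.left_inv (mem_chart_source Plane z)]
  obtain ⟨δ, hδ, hball⟩ := Metric.isOpen_iff.mp e₂.open_target _ (e₂.map_source hc₂)
  rw [Real.ball_eq_Ioo, hz2] at hball
  refine ⟨δ, hδ, fun c ↦ e.symm (l (e₂.symm c)), ?_, ?_, fun c hc ↦ ?_⟩
  · simp only
    rw [← hz2, e₂.left_inv hc₂, hl0, e.left_inv (mem_chart_source Plane z)]
  · exact (contMDiffOn_chart_symm (I := 𝓡 2) (x := z)).comp
      (hlc.contMDiff.comp_contMDiffOn (hsm'.mono hball).contMDiffOn)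
      fun c hc ↦ hsrc (e₂.map_target (hball hc))
  · have := e₂.right_inv (hball hc)
    rw [heq] at this
    exact this

end IsHamiltonianFlow

end FlowBox

/-! ### Smooth least periods and the structure of orbit cylinders -/

section Periods

variable {N : Type*} [TopologicalSpace N] [ChartedSpace Plane N] [IsManifold (𝓡 2) ∞ N]

theorem exists_Ioo_subset_of_mem_nhds {c : ℝ} {V : Set ℝ} (hV : V ∈ 𝓝 c) :
    ∃ δ > 0, Ioo (c - δ) (c + δ) ⊆ V := by
  obtain ⟨δ, hδ, h⟩ := Metric.mem_nhds_iff.mp hV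
  exact ⟨δ, hδ, by rwa [Real.ball_eq_Ioo] at h⟩

namespace IsHamiltonianFlow

variable {Ω : SymplecticForm N} {H : N → ℝ} {φ : ℝ → N → N} (hφ : IsHamiltonianFlow Ω H φ)
include hφ

theorem continuous_orbit (x : N) : Continuous (fun t ↦ φ t x) :=
  hφ.continuous.comp (by fun_prop : Continuous fun t : ℝ ↦ (t, x))

theorem continuous_apply (t : ℝ) : Continuous (φ t) :=
  hφ.continuous.comp (by fun_prop : Continuous fun x : N ↦ (t, x))

theorem isEmbeddedCircle {x : N} {τ : ℝ} (h : IsLeastPeriod φ x τ) :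
    IsEmbeddedCircle Ω H (H x) (range (fun t ↦ φ t x)) := by
  refine ⟨fun t ↦ φ t x, hφ.orbit x, ⟨τ, h.1, fun t ↦ ?_⟩, ⟨τ / 2, 0, ?_⟩,
    fun t ↦ hφ.level t x, rfl⟩
  · simp only
    rw [hφ.flow_add, h.2.1]
  · simp only
    rw [hφ.flow_zero]
    exact h.2.2 _ ⟨by linarith [h.1], by linarith [h.1]⟩

/-- A smooth section of the level sets consisting of periodic points with smooth least period spans
an orbit cylinder. -/
theorem isOrbitCylinder_of_section {I : Set ℝ} (hI : I.OrdConnected) {σ : ℝ → N} {τ : ℝ → ℝ}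
    (hσ : ContMDiffOn 𝓘(ℝ, ℝ) (𝓡 2) ∞ σ I) (hlev : ∀ c ∈ I, H (σ c) = c)
    (hτ : ContDiffOn ℝ ∞ τ I) (hper : ∀ c ∈ I, IsLeastPeriod φ (σ c) (τ c)) :
    IsOrbitCylinder Ω H I (fun c ↦ range (fun t ↦ φ t (σ c))) := by
  -- Time is rescaled by the least period, so that every circle has period one in the angle.
  refine ⟨hI, ⟨fun q ↦ φ (q.2 * τ q.1) (σ q.1), ?_, fun c hc ↦ ⟨?_, fun θ θ' ↦ ?_, fun θ h0 ↦ ?_⟩⟩,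
    fun c hc ↦ ?_⟩
  · refine hφ.contMDiffOn (ContDiffOn.contMDiffOn ?_)
      (hσ.comp contDiff_fst.contMDiff.contMDiffOn fun q hq ↦ hq.1)
    exact contDiff_snd.contDiffOn.mul (hτ.comp contDiff_fst.contDiffOn fun q hq ↦ hq.1)
  · have hne := (hper c hc).1.ne'
    ext y
    constructor
    · rintro ⟨t, rfl⟩
      exact ⟨t / τ c, by simp only; rw [div_mul_cancel₀ _ hne]⟩
    · rintro ⟨t, rfl⟩
      exact ⟨_, rfl⟩
  · have hpos := (hper c hc).1
    simp only
    rw [eq_comm, hφ.eq_iff, (hper c hc).period_iff hφ]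
    refine exists_congr fun n ↦ ?_
    rw [← sub_mul]
    constructor
    · intro h
      have := mul_right_cancel₀ hpos.ne' h
      linarith
    · rintro rfl
      ring
  · have hpos := (hper c hc).1
    have h1 := hφ.orbit (σ c) (θ * τ c)
    have h2 : HasDerivAt (fun θ ↦ θ * τ c) (τ c) θ := by
      simpa using (hasDerivAt_id θ).mul_const (τ c)
    have h3 := h1.comp θ h2.hasFDerivAt.hasMFDerivAt
    have h4 : mfderiv 𝓘(ℝ, ℝ) (𝓡 2) (fun s ↦ φ (s * τ c) (σ c)) θ =
      (velocityMap (hamVec Ω H (φ (θ * τ c) (σ c)))).comp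
          (ContinuousLinearMap.toSpanSingleton ℝ (τ c)) := h3.mfderiv
    have h5 : ((velocityMap (hamVec Ω H (φ (θ * τ c) (σ c)))).comp
          (ContinuousLinearMap.toSpanSingleton ℝ (τ c))) 1 = 0 := by
      rw [← h4]; exact h0
    have h6 : τ c • hamVec Ω H (φ (θ * τ c) (σ c)) = 0 := by
      rw [← h5]; simp [velocityMap]
    rcases smul_eq_zero.mp h6 with h | h
    · exact hpos.ne' h
    · exact ((hφ.isLeastPeriod_apply (hper c hc) (θ * τ c)).hamVec_ne_zero hφ) h
  · have := hφ.isEmbeddedCircle (hper c hc)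
    rwa [hlev c hc] at this

variable [T2Space N]

/-- A periodic orbit through a regular point has a least period. -/
theorem exists_isLeastPeriod (hH : ContMDiff (𝓡 2) 𝓘(ℝ, ℝ) ∞ H) {x : N}
    (hreg : hamVec Ω H x ≠ 0) {T : ℝ} (hT : 0 < T) (hx : φ T x = x) :
    ∃ τ, IsLeastPeriod φ x τ := by
  obtain ⟨δ, hδ, σ, hσx, hσ, hlev⟩ := exists_level_section hH hreg
  obtain ⟨ε, hε, -, U, hU, hxU, s, hs, hsU, hbox⟩ := hφ.exists_flowBox hH isOpen_Ioo hσ hlev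
    (c₁ := H x) (by constructor <;> linarith) (by rwa [hσx])
  have hshort : ∀ t ∈ Ioo 0 ε, φ t x ≠ x := by
    intro t ht heq
    have hc : H x ∈ Ioo (H x - ε) (H x + ε) := by constructor <;> linarith
    have h1 := (hbox _ hc t ⟨by linarith [ht.1], ht.2⟩).2
    have h2 := (hbox _ hc 0 (by simpa using hε)).2
    rw [hσx] at h1 h2
    rw [heq] at h1
    rw [hφ.flow_zero] at h2
    linarith [ht.1]
  -- The flow box forbids returns before time `ε`; with that bound the positive return times form a
  -- closed set, and its infimum is attained and positive.
  set P := {t | ε ≤ t ∧ φ t x = x} with hP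
  have hPc : IsClosed P :=
    isClosed_Ici.inter (isClosed_eq (hφ.continuous_orbit x) continuous_const)
  have hTP : T ∈ P := ⟨not_lt.mp fun h ↦ hshort T ⟨hT, h⟩ hx, hx⟩
  have hbdd : BddBelow P := ⟨ε, fun t ht ↦ ht.1⟩
  have hmem := hPc.csInf_mem ⟨T, hTP⟩ hbdd
  refine ⟨sInf P, hε.trans_le hmem.1, hmem.2, fun t ht heq ↦ ?_⟩
  have htP : t ∈ P := ⟨not_lt.mp fun h ↦ hshort t ⟨ht.1, h⟩ heq, heq⟩
  exact absurd (csInf_le hbdd htP) (not_le.mpr ht.2)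

/-- The least period is a smooth function along a section of the level sets. -/
theorem exists_contDiffOn_leastPeriod (hH : ContMDiff (𝓡 2) 𝓘(ℝ, ℝ) ∞ H) {σ : ℝ → N} {A : Set ℝ}
    (hA : IsOpen A) (hσ : ContMDiffOn 𝓘(ℝ, ℝ) (𝓡 2) ∞ σ A) (hlev : ∀ c ∈ A, H (σ c) = c)
    {c₁ : ℝ} (hc₁ : c₁ ∈ A) {τ₀ : ℝ} (hτ₀ : IsLeastPeriod φ (σ c₁) τ₀) :
    ∃ δ > 0, Ioo (c₁ - δ) (c₁ + δ) ⊆ A ∧ ∃ τ : ℝ → ℝ,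
      ContDiffOn ℝ ∞ τ (Ioo (c₁ - δ) (c₁ + δ)) ∧
      ∀ c ∈ Ioo (c₁ - δ) (c₁ + δ), IsLeastPeriod φ (σ c) (τ c) := by
  obtain ⟨ε, hε, hεA, U, hU, hxU, s, hs, hsU, hbox⟩ := hφ.exists_flowBox hH hA hσ hlev
    hc₁ (hτ₀.hamVec_ne_zero hφ)
  have hσc : ContinuousAt σ c₁ := (hσ.continuousOn).continuousAt (hA.mem_nhds hc₁)
  have hret : ContMDiffOn 𝓘(ℝ, ℝ) (𝓡 2) ∞ (fun c ↦ φ τ₀ (σ c)) A :=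
    hφ.contMDiffOn contMDiffOn_const hσ
  -- After time `τ₀` the point `σ c` lands in the flow box, still on the level `c`. The section
  -- meets that level only in `σ c`, so the landing point is `σ c` moved by its time coordinate `s`.
  -- Subtracting this time gives an exact period, smooth in `c`.
  set V : Set ℝ := A ∩ (fun c ↦ φ τ₀ (σ c)) ⁻¹' U with hV
  have hVo : IsOpen V := hret.continuousOn.isOpen_inter_preimage hA hU
  have hcV : c₁ ∈ V := ⟨hc₁, by simp only [mem_preimage]; rw [hτ₀.2.1]; exact hxU⟩
  have hτs : ContMDiffOn 𝓘(ℝ, ℝ) 𝓘(ℝ, ℝ) ∞ (fun c ↦ s (φ τ₀ (σ c))) V :=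
    hs.comp (hret.mono inter_subset_left) fun c hc ↦ hc.2
  have hτs' : ContDiffOn ℝ ∞ (fun c ↦ τ₀ - s (φ τ₀ (σ c))) V :=
    contDiffOn_const.sub (contMDiffOn_iff_contDiffOn.mp hτs)
  have hτ1 : τ₀ - s (φ τ₀ (σ c₁)) = τ₀ := by
    have h := (hbox c₁ (by constructor <;> linarith) 0 (by simpa using hε)).2
    rw [hφ.flow_zero] at h
    rw [hτ₀.2.1, h, sub_zero]
  have hτc : ContinuousAt (fun c ↦ τ₀ - s (φ τ₀ (σ c))) c₁ :=
    hτs'.continuousOn.continuousAt (hVo.mem_nhds hcV)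
  have hpos : ∀ᶠ c in 𝓝 c₁, 0 < τ₀ - s (φ τ₀ (σ c)) :=
    hτc.eventually (lt_mem_nhds (by simp only [hτ1]; exact hτ₀.1))
  have hlt : ∀ᶠ c in 𝓝 c₁, τ₀ - s (φ τ₀ (σ c)) < τ₀ + ε / 2 :=
    hτc.eventually (gt_mem_nhds (by simp only [hτ1]; linarith))
  -- No shorter period can appear for nearby `c`: intermediate times are excluded by compactness,
  -- times below `ε` by the flow box, and times above `τ₀ - ε / 2` because their difference from the
  -- new period would be a return time below `ε`.
  have hcompact : ∀ᶠ c in 𝓝 c₁, ∀ t ∈ Icc ε (τ₀ - ε / 2), φ t (σ c) ≠ σ c := by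
    refine isCompact_Icc.eventually_forall_of_forall_eventually fun t ht ↦ ?_
    have h1 : ContinuousAt (fun q : ℝ × ℝ ↦ φ q.2 (σ q.1)) (c₁, t) :=
      hφ.continuous.continuousAt.comp (x := (c₁, t)) (f := fun q : ℝ × ℝ ↦ (q.2, σ q.1))
        (continuousAt_snd.prodMk (ContinuousAt.comp (x := (c₁, t)) hσc continuousAt_fst))
    have h2 : ContinuousAt (fun q : ℝ × ℝ ↦ σ q.1) (c₁, t) :=
      ContinuousAt.comp (x := (c₁, t)) hσc continuousAt_fst
    exact (h1.ne_iff_eventually_ne h2).mp (hτ₀.2.2 t ⟨hε.trans_le ht.1, by linarith [ht.2]⟩)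
  have hclose : ∀ᶠ c in 𝓝 c₁, c ∈ Ioo (c₁ - ε) (c₁ + ε) :=
    isOpen_Ioo.mem_nhds (by constructor <;> linarith)
  obtain ⟨δ, hδ, hδs⟩ := exists_Ioo_subset_of_mem_nhds
    (((hVo.eventually_mem hcV).and hpos).and ((hlt.and hcompact).and hclose))
  refine ⟨δ, hδ, fun c hc ↦ (hδs hc).1.1.1, fun c ↦ τ₀ - s (φ τ₀ (σ c)),
    hτs'.mono fun c hc ↦ (hδs hc).1.1, fun c hc ↦ ?_⟩
  obtain ⟨⟨hcV, hcpos⟩, ⟨hclt, hccpt⟩, hcε⟩ := hδs hc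
  have hshort : ∀ t ∈ Ioo 0 ε, φ t (σ c) ≠ σ c := by
    intro t ht heq
    have h1 := (hbox _ hcε t ⟨by linarith [ht.1], ht.2⟩).2
    have h2 := (hbox _ hcε 0 (by simpa using hε)).2
    rw [heq] at h1
    rw [hφ.flow_zero] at h2
    linarith [ht.1]
  have hper : φ (τ₀ - s (φ τ₀ (σ c))) (σ c) = σ c := by
    have h := (hsU _ hcV.2).2.2
    rw [hφ.level, hlev c hcV.1] at h
    exact (hφ.eq_iff _ _ _).mp h.symm
  refine ⟨hcpos, hper, fun t ht heq ↦ ?_⟩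
  by_cases h1 : t < ε
  · exact hshort t ⟨ht.1, h1⟩ heq
  by_cases h2 : t ≤ τ₀ - ε / 2
  · exact hccpt t ⟨not_lt.mp h1, h2⟩ heq
  · refine hshort (τ₀ - s (φ τ₀ (σ c)) - t) ⟨by linarith [ht.2], by linarith⟩ ?_
    rw [← hφ.eq_iff, hper, heq]

/-- By uniqueness the circle is the flow orbit of each of its points. A critical point on it would
make the orbit constant, so `x` is regular and has a least period. -/
theorem circle_spec (hH : ContMDiff (𝓡 2) 𝓘(ℝ, ℝ) ∞ H) {c : ℝ} {L : Set N}
    (hL : IsEmbeddedCircle Ω H c L) {x : N} (hx : x ∈ L) :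
    H x = c ∧ L = range (fun t ↦ φ t x) ∧ ∃ τ, IsLeastPeriod φ x τ := by
  obtain ⟨γ, hγ, ⟨T, hT, hper⟩, hne, hlev, rfl⟩ := hL
  obtain ⟨s, rfl⟩ := hx
  have hγs : ∀ t, φ t (γ s) = γ (t + s) := fun t ↦ by
    rw [hφ.unique γ hγ (t + s), hφ.flow_add, ← hφ.unique γ hγ s]
  refine ⟨hlev s, ?_, hφ.exists_isLeastPeriod hH (fun h0 ↦ ?_) hT ?_⟩
  · ext y
    constructor
    · rintro ⟨t, rfl⟩
      exact ⟨t - s, by simp only; rw [hγs]; simp⟩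
    · rintro ⟨t, rfl⟩
      exact ⟨t + s, (hγs t).symm⟩
  · obtain ⟨a, b, hab⟩ := hne
    have hconst : ∀ a, γ a = γ s := fun a ↦ by
      have := hγs (a - s)
      rwa [hφ.fixed_of_hamVec_eq_zero h0, sub_add_cancel, eq_comm] at this
    exact hab ((hconst a).trans (hconst b).symm)
  · rw [hγs, add_comm, hper]

/-- Through every point of an orbit cylinder passes a section of the level sets, defined on a full
neighbourhood of the level, with smooth least period, that parametrises the cylinder. -/
theorem exists_section_of_cylinder (hH : ContMDiff (𝓡 2) 𝓘(ℝ, ℝ) ∞ H) {I : Set ℝ} {L : ℝ → Set N}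
    (hcyl : IsOrbitCylinder Ω H I L) {c₁ : ℝ} (hc₁ : c₁ ∈ I) {x : N} (hx : x ∈ L c₁) :
    ∃ δ > 0, ∃ (σ : ℝ → N) (τ : ℝ → ℝ), σ c₁ = x ∧
      ContMDiffOn 𝓘(ℝ, ℝ) (𝓡 2) ∞ σ (Ioo (c₁ - δ) (c₁ + δ)) ∧
      (∀ c ∈ Ioo (c₁ - δ) (c₁ + δ), H (σ c) = c) ∧
      ContDiffOn ℝ ∞ τ (Ioo (c₁ - δ) (c₁ + δ)) ∧
      (∀ c ∈ Ioo (c₁ - δ) (c₁ + δ), IsLeastPeriod φ (σ c) (τ c)) ∧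
      ∀ c ∈ Ioo (c₁ - δ) (c₁ + δ), c ∈ I → L c = range (fun t ↦ φ t (σ c)) := by
  obtain ⟨hHx, -, τ₀, hτ₀⟩ := hφ.circle_spec hH (hcyl.circle c₁ hc₁) hx
  obtain ⟨δ, hδ, σ, hσx, hσ, hlev⟩ := exists_level_section hH (hτ₀.hamVec_ne_zero hφ)
  rw [hHx] at hσx hσ hlev
  obtain ⟨ε, hε, hεA, U, hU, hxU, s, hs, hsU, hbox⟩ := hφ.exists_flowBox hH isOpen_Ioo hσ hlev
    (c₁ := c₁) (by constructor <;> linarith) (by rw [hσx]; exact hτ₀.hamVec_ne_zero hφ)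
  obtain ⟨δ₁, hδ₁, hδ₁A, τ, hτ, hper⟩ := hφ.exists_contDiffOn_leastPeriod hH isOpen_Ioo hσ hlev
    (c₁ := c₁) (by constructor <;> linarith) (by rw [hσx]; exact hτ₀)
  obtain ⟨F, hF, hFL⟩ := hcyl.isotopy
  rw [(hFL c₁ hc₁).1] at hx
  obtain ⟨θ, hθ⟩ := hx
  -- The isotopy provides a point of `L c` that stays in the flow box for `c` near `c₁`. Such a
  -- point lies on the orbit of `σ c`, so the whole circle is that orbit.
  have hcont : ContinuousWithinAt (fun c ↦ F (c, θ)) I c₁ :=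
    (hF.continuousOn (c₁, θ) ⟨hc₁, mem_univ _⟩).comp
      (f := fun c : ℝ ↦ (c, θ)) (by fun_prop) fun c hc ↦ ⟨hc, mem_univ _⟩
  have hmem : ∀ᶠ c in 𝓝[I] c₁, F (c, θ) ∈ U :=
    hcont.eventually_mem (hU.mem_nhds (by simp only at hθ ⊢; rw [hθ, ← hσx]; exact hxU))
  rw [eventually_nhdsWithin_iff] at hmem
  obtain ⟨δ₂, hδ₂, hδ₂s⟩ := exists_Ioo_subset_of_mem_nhds hmem
  have hsub : ∀ c ∈ Ioo (c₁ - min δ₁ δ₂) (c₁ + min δ₁ δ₂),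
      c ∈ Ioo (c₁ - δ₁) (c₁ + δ₁) ∧ c ∈ Ioo (c₁ - δ₂) (c₁ + δ₂) := by
    intro c hc
    have h1 := min_le_left δ₁ δ₂
    have h2 := min_le_right δ₁ δ₂
    exact ⟨⟨by linarith [hc.1], by linarith [hc.2]⟩, ⟨by linarith [hc.1], by linarith [hc.2]⟩⟩
  refine ⟨min δ₁ δ₂, lt_min hδ₁ hδ₂, σ, τ, hσx, hσ.mono fun c hc ↦ hδ₁A (hsub c hc).1,
    fun c hc ↦ hlev c (hδ₁A (hsub c hc).1), hτ.mono fun c hc ↦ (hsub c hc).1,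
    fun c hc ↦ hper c (hsub c hc).1, fun c hc hcI ↦ ?_⟩
  have hmemL : F (c, θ) ∈ L c := by rw [(hFL c hcI).1]; exact ⟨θ, rfl⟩
  obtain ⟨hlevF, hrange, -⟩ := hφ.circle_spec hH (hcyl.circle c hcI) hmemL
  rw [hrange]
  have h := (hsU _ (hδ₂s (hsub c hc).2 hcI)).2.2
  rw [hlevF] at h
  exact hφ.range_eq ⟨_, h⟩

/-- Along a resonant orbit cylinder the period is constant. -/
theorem exists_common_period (hH : ContMDiff (𝓡 2) 𝓘(ℝ, ℝ) ∞ H) {I J : Set ℝ} {L L' : ℝ → Set N}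
    (hcyl : IsOrbitCylinder Ω H I L) (hJI : J ⊆ I) (hJ : J.OrdConnected) (hJne : J.Nonempty)
    (hJL : ∀ c ∈ J, L' c = L c) (hres : IsResonantCylinder Ω H J L') :
    ∃ T, 0 < T ∧ ∀ c ∈ J, ∀ x ∈ L c, IsLeastPeriod φ x T := by
  set f : ℝ → ℝ := fun c ↦ orbitPeriod Ω H (L' c) with hf
  have hper : ∀ c ∈ J, ∀ x ∈ L c, IsLeastPeriod φ x (f c) := by
    intro c hc x hx
    obtain ⟨-, hr, τ, hτ⟩ := hφ.circle_spec hH (hcyl.circle c (hJI hc)) hx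
    rw [hf]
    simp only
    rw [hJL c hc, hr, hφ.orbitPeriod_eq hτ]
    exact hτ
  have hne : ∀ c ∈ I, (L c).Nonempty := by
    intro c hc
    obtain ⟨γ, -, -, -, -, h⟩ := hcyl.circle c hc
    exact h ▸ ⟨γ 0, 0, rfl⟩
  -- Needed before resonance says anything: `derivWithin` is also zero where the function is not
  -- differentiable.
  have hdiff : DifferentiableOn ℝ f J := by
    intro c₁ hc₁
    obtain ⟨x, hx⟩ := hne c₁ (hJI hc₁)
    obtain ⟨δ, hδ, σ, τ, hσx, hσ, hlev, hτ, hτper, hrange⟩ :=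
      hφ.exists_section_of_cylinder hH hcyl (hJI hc₁) hx
    have hmem : Ioo (c₁ - δ) (c₁ + δ) ∈ 𝓝 c₁ := isOpen_Ioo.mem_nhds (by constructor <;> linarith)
    have hd : DifferentiableWithinAt ℝ τ J c₁ :=
      ((hτ.contDiffAt hmem).differentiableAt (by simp)).differentiableWithinAt
    have heq : ∀ c ∈ Ioo (c₁ - δ) (c₁ + δ), c ∈ J → f c = τ c := by
      intro c hc hcJ
      rw [hf]
      simp only
      rw [hJL c hcJ, hrange c hc (hJI hcJ), hφ.orbitPeriod_eq (hτper c hc)]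
    refine hd.congr_of_eventuallyEq ?_ (heq c₁ (mem_of_mem_nhds hmem) hc₁)
    filter_upwards [mem_nhdsWithin_of_mem_nhds hmem, self_mem_nhdsWithin] with c hc hcJ
    exact heq c hc hcJ
  have hconst : ∀ c ∈ J, ∀ c' ∈ J, f c = f c' := by
    intro c hc c' hc'
    refine (convex_iff_ordConnected.mpr hJ).is_const_of_fderivWithin_eq_zero hdiff
      (fun a ha ↦ ?_) hc hc'
    have h1 : derivWithin f J a = 0 := not_not.mp (hres a ha)
    refine ContinuousLinearMap.ext_ring ?_
    rw [zero_apply]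
    exact h1
  obtain ⟨c₀, hc₀⟩ := hJne
  obtain ⟨x₀, hx₀⟩ := hne c₀ (hJI hc₀)
  refine ⟨f c₀, (hper c₀ hc₀ x₀ hx₀).1, fun c hc x hx ↦ ?_⟩
  rw [hconst c₀ hc₀ c hc]
  exact hper c hc x hx

/-- The union of the circles of a cylinder over an open interval is relatively clopen. -/
theorem mem_cylinder_of_isPreconnected (hH : ContMDiff (𝓡 2) 𝓘(ℝ, ℝ) ∞ H) {I : Set ℝ}
    {L : ℝ → Set N} (hcyl : IsOrbitCylinder Ω H I L) {C : Set N} (hC : IsPreconnected C)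
    (hCI : ∀ y ∈ C, H y ∈ interior I) {x : N} (hx : x ∈ C) (hxL : x ∈ L (H x)) {y : N}
    (hy : y ∈ C) : y ∈ L (H y) := by
  set W := {y | H y ∈ interior I ∧ y ∈ L (H y)} with hW
  have hHc := hH.continuous
  have hWo : IsOpen W := by
    rw [isOpen_iff_mem_nhds]
    rintro z ⟨hzI, hzL⟩
    obtain ⟨δ, hδ, σ, τ, hσx, hσ, hlev, hτ, hτper, hrange⟩ :=
      hφ.exists_section_of_cylinder hH hcyl (interior_subset hzI) hzL
    obtain ⟨ε, hε, hεA, U, hU, hxU, s, hs, hsU, hbox⟩ := hφ.exists_flowBox hH isOpen_Ioo hσ hlev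
      (c₁ := H z) (by constructor <;> linarith)
      ((hτper _ (by constructor <;> linarith)).hamVec_ne_zero hφ)
    filter_upwards [hU.mem_nhds (hσx ▸ hxU), (isOpen_interior.preimage hHc).mem_nhds hzI] with w hw hwI
    refine ⟨hwI, ?_⟩
    obtain ⟨h1, -, h3⟩ := hsU w hw
    rw [hrange _ (hεA h1) (interior_subset hwI)]
    exact ⟨_, h3⟩
  -- If a limit point `z` missed the compact circle on its own level, disjoint neighbourhoods would
  -- separate the two; by continuity of the isotopy the nearby circles would stay away from `z`.
  have hWc : closure W ∩ C ⊆ W := by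
    rintro z ⟨hz, hzC⟩
    have hzI := interior_subset (hCI z hzC)
    refine ⟨hCI z hzC, ?_⟩
    by_contra hzL
    obtain ⟨F, hF, hFL⟩ := hcyl.isotopy
    have hcomp : IsCompact (L (H z)) := by
      have : L (H z) = (fun θ ↦ F (H z, θ)) '' Icc 0 1 := by
        rw [(hFL _ hzI).1]
        refine Subset.antisymm ?_ (image_subset_range _ _)
        rintro _ ⟨θ, rfl⟩
        refine ⟨Int.fract θ, ⟨Int.fract_nonneg θ, (Int.fract_lt_one θ).le⟩, ?_⟩
        rw [((hFL _ hzI).2.1 _ _)]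
        exact ⟨⌊θ⌋, (Int.fract_add_floor θ).symm⟩
      rw [this]
      refine isCompact_Icc.image_of_continuousOn ?_
      exact hF.continuousOn.comp (f := fun θ : ℝ ↦ (H z, θ)) (by fun_prop)
        fun θ _ ↦ ⟨hzI, mem_univ _⟩
    obtain ⟨U₁, U₂, hU₁, hU₂, hzU, hLU, hdisj⟩ :=
      SeparatedNhds.of_isCompact_isCompact isCompact_singleton hcomp (by simpa using hzL)
    have hev : ∀ᶠ c in 𝓝 (H z), ∀ θ ∈ Icc (0 : ℝ) 1, c ∈ I → F (c, θ) ∈ U₂ := by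
      refine isCompact_Icc.eventually_forall_of_forall_eventually
        (P := fun c θ ↦ c ∈ I → F (c, θ) ∈ U₂) fun θ _ ↦ ?_
      have h1 := hF.continuousOn (H z, θ) ⟨hzI, mem_univ _⟩
      have h2 := h1.eventually_mem (hU₂.mem_nhds (hLU (by rw [(hFL _ hzI).1]; exact ⟨θ, rfl⟩)))
      rw [eventually_nhdsWithin_iff] at h2
      exact h2.mono fun q hq hqI ↦ hq ⟨hqI, mem_univ _⟩
    have hev' := hHc.continuousAt.eventually hev
    obtain ⟨w, hwW, hwU, hwF⟩ := ((mem_closure_iff_frequently.mp hz).and_eventually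
      ((hU₁.eventually_mem (hzU rfl)).and hev')).exists
    have hwI := interior_subset hwW.1
    have hwL := hwW.2
    rw [(hFL _ hwI).1] at hwL
    obtain ⟨θ, hθ⟩ := hwL
    have h3 : F (H w, Int.fract θ) = w := by
      refine Eq.trans ?_ hθ
      simp only
      rw [((hFL _ hwI).2.1 _ _)]
      exact ⟨⌊θ⌋, (Int.fract_add_floor θ).symm⟩
    have h4 := hwF (Int.fract θ) ⟨Int.fract_nonneg θ, (Int.fract_lt_one θ).le⟩ hwI
    rw [h3] at h4
    exact disjoint_left.mp hdisj hwU h4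
  exact (hC.subset_of_closure_inter_subset hWo ⟨x, hx, hCI x hx, hxL⟩ hWc hy).2

end IsHamiltonianFlow

end Periods

/-! ### Continuing a cylinder past a regular limit point -/

section Extension

variable {N : Type*} [TopologicalSpace N] [ChartedSpace Plane N] [IsManifold (𝓡 2) ∞ N]

namespace IsHamiltonianFlow

variable {Ω : SymplecticForm N} {H : N → ℝ} {φ : ℝ → N → N} (hφ : IsHamiltonianFlow Ω H φ)
include hφ

/-- Two sections of the same family of orbits can be joined to one section, up to a shift of the
second one along the flow. -/
theorem exists_glued_section (hH : ContMDiff (𝓡 2) 𝓘(ℝ, ℝ) ∞ H) {q σ : ℝ → N} {u v : ℝ}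
    (hq : ContMDiffOn 𝓘(ℝ, ℝ) (𝓡 2) ∞ q (Ioo u v)) (hσ : ContMDiffOn 𝓘(ℝ, ℝ) (𝓡 2) ∞ σ (Ioo u v))
    (hσlev : ∀ c ∈ Ioo u v, H (σ c) = c) (hqσ : ∀ c ∈ Ioo u v, q c ∈ range (fun t ↦ φ t (σ c)))
    {c₁ : ℝ} (hc₁ : c₁ ∈ Ioo u v) (hreg : hamVec Ω H (q c₁) ≠ 0) :
    ∃ (a b t : ℝ) (ς : ℝ → N), u < a ∧ a < b ∧ b < v ∧
      ContMDiffOn 𝓘(ℝ, ℝ) (𝓡 2) ∞ ς (Ioo u v) ∧ (∀ c ∈ Ioo u a, ς c = q c) ∧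
      (∀ c ∈ Ioo b v, ς c = φ t (σ c)) ∧ ∀ c ∈ Ioo u v, ς c ∈ range (fun t ↦ φ t (σ c)) := by
  have hqlev : ∀ c ∈ Ioo u v, H (q c) = c := fun c hc ↦ by
    obtain ⟨t, ht⟩ := hqσ c hc
    rw [← ht, hφ.level, hσlev c hc]
  obtain ⟨t, ht⟩ := hqσ c₁ hc₁
  have hσt : ContMDiffOn 𝓘(ℝ, ℝ) (𝓡 2) ∞ (fun c ↦ φ t (σ c)) (Ioo u v) :=
    hφ.contMDiffOn contMDiffOn_const hσ
  obtain ⟨ε, hε, hεA, U, hU, hxU, s, hs, hsU, hbox⟩ := hφ.exists_flowBox hH isOpen_Ioo hσt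
    (fun c hc ↦ by rw [hφ.level, hσlev c hc]) hc₁ (by simp only at ht; rwa [ht])
  simp only at ht hxU hsU
  rw [ht] at hxU
  have hVo : IsOpen (Ioo u v ∩ q ⁻¹' U) := hq.continuousOn.isOpen_inter_preimage isOpen_Ioo hU
  obtain ⟨η, hη, hηs⟩ := exists_Ioo_subset_of_mem_nhds (hVo.mem_nhds ⟨hc₁, hxU⟩)
  -- In the flow box, `q c` is reached from `φ t (σ c)` in time `s (q c)`. Flowing back by the
  -- fraction `χ c` of this time interpolates between the two sections without leaving the orbit.
  set χ : ℝ → ℝ := fun c ↦ Real.smoothTransition ((c - (c₁ - η / 4)) / (η / 2)) with hχ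
  have hχs : ContDiff ℝ ∞ χ :=
    Real.smoothTransition.contDiff.comp ((contDiff_id.sub contDiff_const).div_const _)
  have hχ0 : ∀ c, c ≤ c₁ - η / 4 → χ c = 0 := fun c hc ↦
    Real.smoothTransition.zero_of_nonpos (div_nonpos_of_nonpos_of_nonneg (by linarith) (by linarith))
  have hχ1 : ∀ c, c₁ + η / 4 ≤ c → χ c = 1 := fun c hc ↦
    Real.smoothTransition.one_of_one_le (by rw [le_div_iff₀ (by linarith)]; linarith)
  -- The time coordinate `s` has meaning only near `c₁`, hence the three pieces. The transition of
  -- `χ` ends within `η / 4` of `c₁`, so neighbouring pieces agree on open overlaps.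
  set ς : ℝ → N := fun c ↦ if c ≤ c₁ - η / 2 then q c else if c₁ + η / 2 ≤ c then φ t (σ c) else
    φ (-(χ c * s (q c))) (q c) with hς
  have hin : c₁ - η / 2 ∈ Ioo u v ∧ c₁ + η / 2 ∈ Ioo u v :=
    ⟨(hηs (by constructor <;> linarith)).1, (hηs (by constructor <;> linarith)).1⟩
  have hmid : ∀ c ∈ Ioo (c₁ - η) (c₁ + η), ς c = φ (-(χ c * s (q c))) (q c) := by
    intro c hc
    simp only [hς]
    split_ifs with h1 h2
    · rw [hχ0 c (by linarith), zero_mul, neg_zero, hφ.flow_zero]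
    · have h3 := (hsU _ (hηs hc).2).2.2
      rw [hqlev c (hηs hc).1] at h3
      rw [hχ1 c (by linarith), one_mul]
      nth_rewrite 2 [← h3]
      rw [hφ.neg_apply]
    · rfl
  have hleft : ∀ c ∈ Ioo u (c₁ - η / 4), ς c = q c := by
    intro c hc
    by_cases h1 : c ≤ c₁ - η / 2
    · simp only [hς, if_pos h1]
    · rw [hmid c ⟨by linarith, by linarith [hc.2]⟩, hχ0 c hc.2.le, zero_mul, neg_zero,
        hφ.flow_zero]
  have hright : ∀ c ∈ Ioo (c₁ + η / 4) v, ς c = φ t (σ c) := by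
    intro c hc
    by_cases h1 : c₁ + η / 2 ≤ c
    · have h2 : ¬ c ≤ c₁ - η / 2 := by linarith
      simp only [hς, if_pos h1, if_neg h2]
    · have hcη : c ∈ Ioo (c₁ - η) (c₁ + η) := ⟨by linarith [hc.1], by linarith⟩
      have h3 := (hsU _ (hηs hcη).2).2.2
      rw [hqlev c (hηs hcη).1] at h3
      rw [hmid c hcη, hχ1 c hc.1.le, one_mul]
      nth_rewrite 2 [← h3]
      rw [hφ.neg_apply]
  refine ⟨c₁ - η / 4, c₁ + η / 4, t, ς, by linarith [hin.1.1], by linarith,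
    by linarith [hin.2.2], ?_, hleft, hright, ?_⟩
  · intro c hc
    refine ContMDiffAt.contMDiffWithinAt ?_
    rcases lt_or_ge c (c₁ - η / 4) with h | h
    · refine (hq.contMDiffAt (isOpen_Ioo.mem_nhds hc)).congr_of_eventuallyEq ?_
      filter_upwards [isOpen_Ioo.mem_nhds (show c ∈ Ioo u (c₁ - η / 4) from ⟨hc.1, h⟩)] with c' hc'
      exact hleft c' hc'
    rcases lt_or_ge (c₁ + η / 4) c with h' | h'
    · refine (hσt.contMDiffAt (isOpen_Ioo.mem_nhds hc)).congr_of_eventuallyEq ?_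
      filter_upwards [isOpen_Ioo.mem_nhds (show c ∈ Ioo (c₁ + η / 4) v from ⟨h', hc.2⟩)] with c' hc'
      exact hright c' hc'
    · have hcη : c ∈ Ioo (c₁ - η) (c₁ + η) := ⟨by linarith, by linarith⟩
      have hqη : ContMDiffOn 𝓘(ℝ, ℝ) (𝓡 2) ∞ q (Ioo (c₁ - η) (c₁ + η)) :=
        hq.mono fun c hc ↦ (hηs hc).1
      have hsq : ContMDiffOn 𝓘(ℝ, ℝ) 𝓘(ℝ, ℝ) ∞ (fun c ↦ s (q c)) (Ioo (c₁ - η) (c₁ + η)) :=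
        hs.comp hqη fun c hc ↦ (hηs hc).2
      have hm : ContMDiffOn 𝓘(ℝ, ℝ) (𝓡 2) ∞ (fun c ↦ φ (-(χ c * s (q c))) (q c))
          (Ioo (c₁ - η) (c₁ + η)) := by
        refine hφ.contMDiffOn (ContDiffOn.contMDiffOn ?_) hqη
        exact (hχs.contDiffOn.mul (contMDiffOn_iff_contDiffOn.mp hsq)).neg
      refine (hm.contMDiffAt (isOpen_Ioo.mem_nhds hcη)).congr_of_eventuallyEq ?_
      filter_upwards [isOpen_Ioo.mem_nhds hcη] with c' hc'
      exact hmid c' hc'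
  · intro c hc
    have hstep : ∀ r, φ r (q c) ∈ range (fun t ↦ φ t (σ c)) := fun r ↦ by
      rw [← hφ.range_eq (hqσ c hc)]; exact ⟨r, rfl⟩
    simp only [hς]
    split_ifs with h1 h2
    · exact hqσ c hc
    · exact ⟨t, rfl⟩
    · exact hstep _

variable [T2Space N]

/-- An orbit cylinder of constant period near its upper end that accumulates at a regular point on
the level of the upper end can be continued beyond that level. -/
theorem exists_extension (hH : ContMDiff (𝓡 2) 𝓘(ℝ, ℝ) ∞ H) {I : Set ℝ} {L : ℝ → Set N}
    (hcyl : IsOrbitCylinder Ω H I L) {c₀ cp T : ℝ} (hc₀ : c₀ < cp) (hIco : Ico c₀ cp ⊆ I)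
    (hI : I ⊆ Iic cp) (hT : ∀ c ∈ Ico c₀ cp, ∀ x ∈ L c, IsLeastPeriod φ x T) {z : N}
    (hz : H z = cp) (hreg : hamVec Ω H z ≠ 0)
    (hcl : z ∈ closure {y | H y ∈ Ioo c₀ cp ∧ y ∈ L (H y)}) (hzL : cp ∈ I → z ∈ L cp) :
    ∃ (I' : Set ℝ) (L' : ℝ → Set N), IsOrbitCylinder Ω H I' L' ∧ I ⊆ I' ∧
      (∀ c ∈ I, L' c = L c) ∧ I' ≠ I := by
  obtain ⟨δ₀, hδ₀, σ, hσz, hσ, hσlev⟩ := exists_level_section hH hreg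
  rw [hz] at hσz hσ hσlev
  have hcpδ : cp ∈ Ioo (cp - δ₀) (cp + δ₀) := by constructor <;> linarith
  obtain ⟨ε, hε, hεA, U, hU, hxU, s, hs, hsU, hbox⟩ := hφ.exists_flowBox hH isOpen_Ioo hσ hσlev
    hcpδ (by rwa [hσz])
  obtain ⟨y, ⟨hyc, hyL⟩, hyU⟩ := ((mem_closure_iff_frequently.mp hcl).and_eventually
    (hU.mem_nhds (hσz ▸ hxU))).exists
  set u := max c₀ (cp - δ₀) with hu
  have hucp : u < cp := max_lt hc₀ (by linarith)
  -- One cylinder point `y` in the flow box puts the section point of its level on the cylinder;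
  -- connectedness of the section below `cp` carries this to all its points.
  have hσL : ∀ c ∈ Ioo u cp, σ c ∈ L c := by
    have hsub : ∀ c ∈ Ioo u cp, c ∈ Ioo (cp - δ₀) (cp + δ₀) := fun c hc ↦
      ⟨(le_max_right _ _).trans_lt hc.1, by linarith [hc.2]⟩
    have hC : IsPreconnected (σ '' Ioo u cp) :=
      isPreconnected_Ioo.image _ (hσ.continuousOn.mono hsub)
    obtain ⟨h1, -, h3⟩ := hsU y hyU
    have hyu : H y ∈ Ioo u cp := ⟨max_lt hyc.1 (hεA h1).1, hyc.2⟩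
    have hstart : σ (H y) ∈ L (H y) := by
      have hr := (hφ.circle_spec hH (hcyl.circle _ (hIco ⟨hyc.1.le, hyc.2⟩)) hyL).2.1
      rw [hr]
      exact ⟨-s y, by simp only; nth_rewrite 2 [← h3]; rw [hφ.neg_apply]⟩
    intro c hc
    have := hφ.mem_cylinder_of_isPreconnected hH hcyl hC (x := σ (H y)) (y := σ c) ?_
      ⟨_, hyu, rfl⟩ (by rwa [hσlev _ (hsub _ hyu)]) ⟨c, hc, rfl⟩
    · rwa [hσlev _ (hsub _ hc)] at this
    · rintro _ ⟨c, hc, rfl⟩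
      rw [hσlev _ (hsub _ hc)]
      refine interior_mono hIco ?_
      rw [interior_Ico]
      exact ⟨(le_max_left _ _).trans_lt hc.1, hc.2⟩
  have huI : Ioo u cp ⊆ I := fun c hc ↦ hIco ⟨((le_max_left _ _).trans_lt hc.1).le, hc.2⟩
  have hσper : ∀ c ∈ Ioo u cp, IsLeastPeriod φ (σ c) T := fun c hc ↦
    hT c ⟨((le_max_left _ _).trans_lt hc.1).le, hc.2⟩ _ (hσL c hc)
  have hσc : ContinuousAt σ cp := hσ.continuousOn.continuousAt (isOpen_Ioo.mem_nhds hcpδ)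
  have hzT : φ T z = z := by
    rw [← hσz]
    have h1 : Filter.Tendsto (fun c ↦ φ T (σ c)) (𝓝[<] cp) (𝓝 (φ T (σ cp))) :=
      ((hφ.continuous_apply T).continuousAt.comp hσc).tendsto.mono_left nhdsWithin_le_nhds
    refine tendsto_nhds_unique_of_eventuallyEq h1 (hσc.tendsto.mono_left nhdsWithin_le_nhds) ?_
    filter_upwards [Ioo_mem_nhdsLT hucp] with c hc
    exact (hσper c hc).2.1
  have hTpos : 0 < T := (hσper ((u + cp) / 2) ⟨by linarith, by linarith⟩).1
  -- Equality of `τ₀` with `T` is not needed: any least period at `z` continues smoothly to the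
  -- neighbouring levels.
  obtain ⟨τ₀, hτ₀⟩ := hφ.exists_isLeastPeriod hH hreg hTpos hzT
  obtain ⟨δ₁, hδ₁, hδ₁A, τ, hτ, hper⟩ := hφ.exists_contDiffOn_leastPeriod hH isOpen_Ioo hσ hσlev
    hcpδ (by rw [hσz]; exact hτ₀)
  obtain ⟨F, hF, hFL⟩ := hcyl.isotopy
  set q : ℝ → N := fun c ↦ F (c, 0) with hqdef
  have hq : ContMDiffOn 𝓘(ℝ, ℝ) (𝓡 2) ∞ q I := by
    refine hF.comp (f := fun c : ℝ ↦ (c, (0 : ℝ))) ?_ fun c hc ↦ ⟨hc, mem_univ _⟩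
    exact (contDiff_id.prodMk contDiff_const).contMDiff.contMDiffOn
  have hqL : ∀ c ∈ I, q c ∈ L c := fun c hc ↦ by rw [(hFL c hc).1]; exact ⟨0, rfl⟩
  set w := max u (cp - δ₁) with hw
  have hwcp : w < cp := max_lt hucp (by linarith)
  have hwu : ∀ c ∈ Ioo w cp, c ∈ Ioo u cp := fun c hc ↦ ⟨(le_max_left _ _).trans_lt hc.1, hc.2⟩
  have hwδ : ∀ c ∈ Ioo w (cp + δ₁), c ∈ Ioo (cp - δ₁) (cp + δ₁) := fun c hc ↦
    ⟨(le_max_right _ _).trans_lt hc.1, hc.2⟩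
  have hwδ' : ∀ c ∈ Ioo w cp, c ∈ Ioo (cp - δ₁) (cp + δ₁) := fun c hc ↦
    hwδ c ⟨hc.1, by linarith [hc.2]⟩
  have hrange : ∀ c ∈ I, w < c → L c = range (fun t ↦ φ t (σ c)) := by
    intro c hc hwc
    rcases lt_or_eq_of_le (show c ≤ cp from hI hc) with h | h
    · exact (hφ.circle_spec hH (hcyl.circle c hc) (hσL c (hwu c ⟨hwc, h⟩))).2.1
    · subst h
      rw [hσz]
      exact (hφ.circle_spec hH (hcyl.circle c hc) (hzL hc)).2.1
  have hmidw : (w + cp) / 2 ∈ Ioo w cp := ⟨by linarith, by linarith⟩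
  -- The extension must be one smooth isotopy, so the section `q` of the old cylinder is joined to a
  -- time shift of the section through `z`.
  obtain ⟨a, b, t, ς, hua, hab, hbv, hς, hςa, hςb, hςr⟩ := hφ.exists_glued_section hH
    (hq.mono fun c hc ↦ huI (hwu c hc)) (hσ.mono fun c hc ↦ hδ₁A (hwδ' c hc))
    (fun c hc ↦ hσlev c (hδ₁A (hwδ' c hc)))
    (fun c hc ↦ by rw [← hrange c (huI (hwu c hc)) hc.1]; exact hqL c (huI (hwu c hc))) hmidw (by
      obtain ⟨τ', h⟩ := (hφ.circle_spec hH (hcyl.circle _ (huI (hwu _ hmidw)))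
        (hqL _ (huI (hwu _ hmidw)))).2.2
      exact h.hamVec_ne_zero hφ)
  set I' := I ∪ Ico cp (cp + δ₁) with hI'
  set ξ : ℝ → N := fun c ↦ if c < a then q c else if c ≤ b then ς c else φ t (σ c) with hξ
  set τ' : ℝ → ℝ := fun c ↦ if c < a then orbitPeriod Ω H (L c) else τ c with hτ'
  have hξq : ∀ c, c < a → ξ c = q c := fun c hc ↦ by simp only [hξ, if_pos hc]
  have hξς : ∀ c ∈ Ioo w cp, ξ c = ς c := by
    intro c hc
    simp only [hξ]
    split_ifs with h1 h2
    · exact (hςa c ⟨hc.1, h1⟩).symm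
    · rfl
    · exact (hςb c ⟨by linarith, hc.2⟩).symm
  have hξσ : ∀ c, b < c → ξ c = φ t (σ c) := fun c hc ↦ by
    have h1 : ¬ c < a := by linarith
    have h2 : ¬ c ≤ b := by linarith
    simp only [hξ, if_neg h1, if_neg h2]
  have hξr : ∀ c ∈ Ioo w (cp + δ₁), ξ c ∈ range (fun t ↦ φ t (σ c)) := by
    intro c hc
    rcases lt_or_ge c cp with h | h
    · rw [hξς c ⟨hc.1, h⟩]; exact hςr c ⟨hc.1, h⟩
    · rw [hξσ c (by linarith)]; exact ⟨t, rfl⟩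
  have hτ'eq : ∀ c ∈ Ioo w (cp + δ₁), τ' c = τ c := by
    intro c hc
    simp only [hτ']
    split_ifs with h1
    · rw [hrange c (huI (hwu c ⟨hc.1, by linarith⟩)) hc.1, hφ.orbitPeriod_eq (hper c (hwδ c hc))]
    · rfl
  have hcase : ∀ c ∈ I', (c ∈ I ∧ c < a) ∨ c ∈ Ioo w (cp + δ₁) := by
    intro c hc
    rcases lt_or_ge c a with h | h
    · rcases hc with hc | hc
      · exact Or.inl ⟨hc, h⟩
      · exact absurd hc.1 (by linarith)
    · refine Or.inr ⟨by linarith, ?_⟩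
      rcases hc with hc | hc
      · have : c ≤ cp := hI hc
        linarith
      · exact hc.2
  have hloc : ∀ c < a, I ∈ 𝓝[I'] c := by
    intro c hc
    filter_upwards [mem_nhdsWithin_of_mem_nhds (isOpen_Iio.mem_nhds (show c ∈ Iio a from hc)),
      self_mem_nhdsWithin] with c' hc' hcI'
    rcases hcI' with h | h
    · exact h
    · exact absurd h.1 (by have : c' < a := hc'; linarith)
  have hlocIoo : ∀ c ∈ Ioo w (cp + δ₁), Ioo w (cp + δ₁) ∈ 𝓝 c := fun c hc ↦ isOpen_Ioo.mem_nhds hc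
  have hlevξ : ∀ c ∈ I', H (ξ c) = c := by
    intro c hc
    rcases hcase c hc with ⟨h1, h2⟩ | h
    · rw [hξq c h2]
      exact (hφ.circle_spec hH (hcyl.circle c h1) (hqL c h1)).1
    · obtain ⟨r, hr⟩ := hξr c h
      rw [← hr, hφ.level, hσlev c (hδ₁A (hwδ c h))]
  have hperξ : ∀ c ∈ I', IsLeastPeriod φ (ξ c) (τ' c) := by
    intro c hc
    rcases hcase c hc with ⟨h1, h2⟩ | h
    · obtain ⟨-, hr, τ₁, hτ₁⟩ := hφ.circle_spec hH (hcyl.circle c h1) (hqL c h1)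
      rw [hξq c h2]
      simp only [hτ', if_pos h2]
      rwa [hr, hφ.orbitPeriod_eq hτ₁]
    · obtain ⟨r, hr⟩ := hξr c h
      rw [← hr, hτ'eq c h]
      exact hφ.isLeastPeriod_apply (hper c (hwδ c h)) r
  have hsmξ : ContMDiffOn 𝓘(ℝ, ℝ) (𝓡 2) ∞ ξ I' := by
    intro c hc
    rcases hcase c hc with ⟨h1, h2⟩ | h
    · refine ((hq c h1).mono_of_mem_nhdsWithin (hloc c h2)).congr_of_eventuallyEq ?_ (hξq c h2)
      filter_upwards [mem_nhdsWithin_of_mem_nhds (isOpen_Iio.mem_nhds (show c ∈ Iio a from h2))]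
        with c' hc'
      exact hξq c' hc'
    · refine ContMDiffAt.contMDiffWithinAt ?_
      rcases lt_or_ge c cp with h3 | h3
      · have hn := isOpen_Ioo.mem_nhds (show c ∈ Ioo w cp from ⟨h.1, h3⟩)
        refine (hς.contMDiffAt hn).congr_of_eventuallyEq ?_
        filter_upwards [hn] with c' hc'
        exact hξς c' hc'
      · have h4 : ContMDiffAt 𝓘(ℝ, ℝ) (𝓡 2) ∞ (fun c ↦ φ t (σ c)) c :=
          (hφ.contMDiffOn contMDiffOn_const hσ).contMDiffAt
            (isOpen_Ioo.mem_nhds (hδ₁A (hwδ c h)))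
        refine h4.congr_of_eventuallyEq ?_
        filter_upwards [isOpen_Ioi.mem_nhds (show c ∈ Ioi b from by simp only [mem_Ioi]; linarith)]
          with c' hc'
        exact hξσ c' hc'
  have hsmτ : ContDiffOn ℝ ∞ τ' I' := by
    intro c hc
    rcases hcase c hc with ⟨h1, h2⟩ | h
    · obtain ⟨δ, hδ, σ₂, τ₂, hσx, hσ₂, hlev₂, hτ₂, hτper₂, hrange₂⟩ :=
        hφ.exists_section_of_cylinder hH hcyl h1 (hqL c h1)
      have hn : Ioo (c - δ) (c + δ) ∈ 𝓝 c := isOpen_Ioo.mem_nhds (by constructor <;> linarith)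
      have heq : ∀ c' ∈ Ioo (c - δ) (c + δ), c' ∈ I → c' < a → τ' c' = τ₂ c' := by
        intro c' hc' hcI hca
        simp only [hτ', if_pos hca]
        rw [hrange₂ c' hc' hcI, hφ.orbitPeriod_eq (hτper₂ c' hc')]
      refine (hτ₂.contDiffAt hn).contDiffWithinAt.congr_of_eventuallyEq ?_
        (heq c (mem_of_mem_nhds hn) h1 h2)
      filter_upwards [mem_nhdsWithin_of_mem_nhds hn, hloc c h2,
        mem_nhdsWithin_of_mem_nhds (isOpen_Iio.mem_nhds (show c ∈ Iio a from h2))]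
        with c' h3 h4 h5
      exact heq c' h3 h4 h5
    · refine ContDiffAt.contDiffWithinAt ?_
      refine (hτ.contDiffAt (isOpen_Ioo.mem_nhds (hwδ c h))).congr_of_eventuallyEq ?_
      filter_upwards [hlocIoo c h] with c' hc'
      exact hτ'eq c' hc'
  have hord : I'.OrdConnected := by
    refine ⟨fun x hx y hy r hr ↦ ?_⟩
    rcases lt_or_ge r cp with h | h
    · left
      rcases hx with hx | hx
      · rcases hy with hy | hy
        · exact hcyl.interval.out hx hy hr
        · rcases lt_or_ge r c₀ with h' | h'
          · exact hcyl.interval.out hx (hIco ⟨le_rfl, hc₀⟩) ⟨hr.1, h'.le⟩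
          · exact hIco ⟨h', h⟩
      · exact absurd (hx.1.trans hr.1) (not_le.mpr h)
    · right
      refine ⟨h, ?_⟩
      rcases hy with hy | hy
      · have h1 : y ≤ cp := hI hy
        have := hr.2
        linarith
      · exact hr.2.trans_lt hy.2
  refine ⟨I', _, hφ.isOrbitCylinder_of_section hord hsmξ hlevξ hsmτ hperξ, subset_union_left,
    fun c hc ↦ ?_, fun heq ↦ ?_⟩
  · rcases hcase c (Or.inl hc) with ⟨h1, h2⟩ | h
    · rw [hξq c h2]
      exact (hφ.circle_spec hH (hcyl.circle c h1) (hqL c h1)).2.1.symm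
    · rw [hrange c hc h.1]
      exact hφ.range_eq (hξr c h)
  · have h1 : cp + δ₁ / 2 ∈ I' := Or.inr ⟨by linarith, by linarith⟩
    rw [heq] at h1
    have : cp + δ₁ / 2 ≤ cp := hI h1
    linarith

end IsHamiltonianFlow

end Extension

/-! ### The area of a cylinder of orbits -/

section Area

theorem plane_det_eq (D : Plane →L[ℝ] Plane) :
    D.det = (D planeE0) 0 * (D planeE1) 1 - (D planeE1) 0 * (D planeE0) 1 := by
  rw [ContinuousLinearMap.det, ← LinearMap.det_toMatrix (EuclideanSpace.basisFun (Fin 2) ℝ).toBasis,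
    Matrix.det_fin_two]
  simp [LinearMap.toMatrix_apply]

theorem volume_plane_rectangle (a b a' b' : ℝ) :
    volume {u : Plane | u 0 ∈ Ioo a b ∧ u 1 ∈ Ioo a' b'} =
      ENNReal.ofReal (b - a) * ENNReal.ofReal (b' - a') := by
  have h := (PiLp.volume_preserving_ofLp (Fin 2)).measure_preimage
    (s := Set.pi univ ![Ioo a b, Ioo a' b'])
    (MeasurableSet.univ_pi fun i ↦ by fin_cases i <;> exact measurableSet_Ioo).nullMeasurableSet
  rw [volume_pi_pi, Fin.prod_univ_two] at h
  simp only [Matrix.cons_val_zero, Matrix.cons_val_one, Real.volume_Ioo] at h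
  rw [← h]
  congr 1
  ext u
  simp [Set.mem_pi, Fin.forall_fin_two]

variable {N : Type*} [TopologicalSpace N] [ChartedSpace Plane N] [IsManifold (𝓡 2) ∞ N]

namespace IsHamiltonianFlow

variable {Ω : SymplecticForm N} {H : N → ℝ} {φ : ℝ → N → N} (hφ : IsHamiltonianFlow Ω H φ)
include hφ

/-- Level and time are symplectic coordinates: `dH` takes the value one on the derivative in the
level direction, and the derivative in time is the Hamiltonian vector. Their symplectic area is
therefore one, whatever the section. -/
theorem hasFDerivAt_chart_section (hH : ContMDiff (𝓡 2) 𝓘(ℝ, ℝ) ∞ H) {q : ℝ → N} {A : Set ℝ}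
    (hA : IsOpen A) (hq : ContMDiffOn 𝓘(ℝ, ℝ) (𝓡 2) ∞ q A) (hlev : ∀ c ∈ A, H (q c) = c) (p : N)
    {u : Plane} (hu : u 0 ∈ A) (hup : φ (u 1) (q (u 0)) ∈ (chartAt Plane p).source) :
    ∃ D : Plane →L[ℝ] Plane, HasFDerivAt (fun u : Plane ↦ chartAt Plane p (φ (u 1) (q (u 0)))) D u ∧
      D.det * Ω.signedDensity p (chartAt Plane p (φ (u 1) (q (u 0)))) = 1 := by
  set e := chartAt Plane p with he
  set g : Plane → Plane := fun u ↦ e (φ (u 1) (q (u 0))) with hg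
  have hp : ∀ i : Fin 2, ContDiff ℝ ∞ (fun u : Plane ↦ u i) := fun i ↦
    (EuclideanSpace.proj (𝕜 := ℝ) i).contDiff
  set P : Set Plane := (fun u : Plane ↦ u 0) ⁻¹' A with hP
  have hPo : IsOpen P := hA.preimage (hp 0).continuous
  have hG : ContMDiffOn (𝓡 2) (𝓡 2) ∞ (fun u : Plane ↦ φ (u 1) (q (u 0))) P :=
    hφ.contMDiffOn (hp 1).contMDiff.contMDiffOn (hq.comp (hp 0).contMDiff.contMDiffOn fun u hu ↦ hu)
  set S := P ∩ (fun u : Plane ↦ φ (u 1) (q (u 0))) ⁻¹' e.source with hS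
  have hSo : IsOpen S := hG.continuousOn.isOpen_inter_preimage hPo e.open_source
  have hgS : ContDiffOn ℝ ∞ g S := by
    rw [← contMDiffOn_iff_contDiffOn]
    exact (contMDiffOn_chart (I := 𝓡 2) (x := p)).comp (hG.mono inter_subset_left) fun q hq ↦ hq.2
  have huS : u ∈ S := ⟨hu, hup⟩
  have hgd : HasFDerivAt g (fderiv ℝ g u) u :=
    ((hgS.contDiffAt (hSo.mem_nhds huS)).differentiableAt (by simp)).hasFDerivAt
  refine ⟨fderiv ℝ g u, hgd, ?_⟩
  have h1 : HasFDerivAt (fun u ↦ chartFunction H p (g u))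
      ((fderiv ℝ (chartFunction H p) (g u)).comp (fderiv ℝ g u)) u := by
    refine HasFDerivAt.comp (g := chartFunction H p) _ (DifferentiableAt.hasFDerivAt ?_) hgd
    exact ((contDiffOn_chartFunction hH p).contDiffAt
      (e.open_target.mem_nhds (e.map_source hup))).differentiableAt (by simp)
  have h2 : HasFDerivAt (fun u ↦ chartFunction H p (g u))
      (EuclideanSpace.proj (𝕜 := ℝ) (0 : Fin 2) : Plane →L[ℝ] ℝ) u := by
    refine (EuclideanSpace.proj (𝕜 := ℝ) (0 : Fin 2)).hasFDerivAt.congr_of_eventuallyEq ?_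
    filter_upwards [hSo.mem_nhds huS] with w hw
    simp only [chartFunction, hg]
    rw [e.left_inv hw.2, hφ.level, hlev _ hw.1]
    rfl
  have h3 : fderiv ℝ (chartFunction H p) (g u) (fderiv ℝ g u planeE0) = 1 := by
    have := congrArg (fun L : Plane →L[ℝ] ℝ ↦ L planeE0) (h1.unique h2)
    simpa using this
  have h4 : fderiv ℝ g u planeE1 = chartVectorField Ω H p (g u) := by
    have h5 : HasDerivAt (fun r : ℝ ↦ u + r • planeE1) planeE1 0 := by
      have := ((hasDerivAt_id (0 : ℝ)).smul_const planeE1).const_add u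
      rwa [one_smul] at this
    have h6 : HasDerivAt (fun r : ℝ ↦ g (u + r • planeE1)) (fderiv ℝ g u planeE1) 0 := by
      have h7 : HasFDerivAt g (fderiv ℝ g u) (u + (0 : ℝ) • planeE1) := by
        rw [zero_smul, add_zero]; exact hgd
      exact h7.comp_hasDerivAt (0 : ℝ) h5
    have h8 := hφ.hasDerivAt_chart hH (p := p) hup
    have h9 : HasDerivAt (fun r : ℝ ↦ e (φ (u 1 + r) (q (u 0)))) (chartVectorField Ω H p (g u)) 0 := by
      have h12 := HasDerivAt.comp_const_add (f := fun r ↦ e (φ r (q (u 0)))) (u 1) 0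
        (f' := chartVectorField Ω H p (g u)) (by rw [add_zero]; exact h8)
      exact h12
    refine h6.unique (h9.congr_of_eventuallyEq (Filter.Eventually.of_forall fun r ↦ ?_))
    simp [hg]
  have hne := Ω.signedDensity_ne_zero p (e.map_source hup)
  rw [plane_det_eq, h4]
  rw [plane_eq_smul_add_smul (fderiv ℝ g u planeE0), map_add, map_smul, map_smul, smul_eq_mul,
    smul_eq_mul] at h3
  have h10 : (chartVectorField Ω H p (g u)) 0 =
      -(fderiv ℝ (chartFunction H p) (g u) planeE1) / Ω.signedDensity p (g u) := by
    simp [chartVectorField]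
  have h11 : (chartVectorField Ω H p (g u)) 1 =
      fderiv ℝ (chartFunction H p) (g u) planeE0 / Ω.signedDensity p (g u) := by
    simp [chartVectorField]
  rw [h10, h11]
  have hne' : Ω.signedDensity p (g u) ≠ 0 := hne
  change _ * Ω.signedDensity p (g u) = 1
  field_simp
  linarith

variable [MeasurableSpace N] [BorelSpace N]

/-- In the change of variables the Jacobian cancels the density, so the image carries the Lebesgue
area of `B`. Only the lower bound is needed. -/
theorem volume_le_chartArea (hH : ContMDiff (𝓡 2) 𝓘(ℝ, ℝ) ∞ H) {q : ℝ → N} {A : Set ℝ}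
    (hA : IsOpen A) (hq : ContMDiffOn 𝓘(ℝ, ℝ) (𝓡 2) ∞ q A) (hlev : ∀ c ∈ A, H (q c) = c) (p : N)
    {B : Set Plane} (hB : MeasurableSet B) (hBA : ∀ u ∈ B, u 0 ∈ A)
    (hBp : ∀ u ∈ B, φ (u 1) (q (u 0)) ∈ (chartAt Plane p).source)
    (hinj : InjOn (fun u : Plane ↦ φ (u 1) (q (u 0))) B)
    (hm : MeasurableSet ((fun u : Plane ↦ φ (u 1) (q (u 0))) '' B)) :
    volume B ≤ Ω.chartArea (chartAt Plane p) ((fun u : Plane ↦ φ (u 1) (q (u 0))) '' B) := by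
  set e := chartAt Plane p with he
  set G : Plane → N := fun u ↦ φ (u 1) (q (u 0)) with hG
  have hex : ∀ u : Plane, ∃ D : Plane →L[ℝ] Plane, u ∈ B →
      HasFDerivAt (fun u ↦ e (G u)) D u ∧ D.det * Ω.signedDensity p (e (G u)) = 1 := by
    intro u
    by_cases hu : u ∈ B
    · obtain ⟨D, hD⟩ := hφ.hasFDerivAt_chart_section hH hA hq hlev p (hBA u hu) (hBp u hu)
      exact ⟨D, fun _ ↦ hD⟩
    · exact ⟨0, fun h ↦ absurd h hu⟩
  choose D hD using hex
  have hginj : InjOn (fun u ↦ e (G u)) B := fun u hu w hw h ↦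
    hinj hu hw (e.injOn (hBp u hu) (hBp w hw) h)
  have hgc : ContinuousOn (fun u ↦ e (G u)) B := fun u hu ↦
    (hD u hu).1.continuousAt.continuousWithinAt
  have hgm : MeasurableSet ((fun u ↦ e (G u)) '' B) := hB.image_of_continuousOn_injOn hgc hginj
  have hsub : (fun u ↦ e (G u)) '' B ⊆ e.target := by
    rintro _ ⟨u, hu, rfl⟩
    exact e.map_source (hBp u hu)
  have hsub' : (fun u ↦ e (G u)) '' B ⊆ e.symm ⁻¹' (G '' B) := by
    rintro _ ⟨u, hu, rfl⟩
    exact ⟨u, hu, (e.left_inv (hBp u hu)).symm⟩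
  -- The inverse chart is controlled only on its target, which is where the measure is concentrated.
  have haem : AEMeasurable e.symm (((volume : Measure Plane).restrict e.target).withDensity
      (fun x ↦ ENNReal.ofReal (Ω.chartDensity e x))) :=
    (e.continuousOn_symm.aemeasurable e.open_target.measurableSet).mono_ac
      (withDensity_absolutelyContinuous _ _)
  rw [SymplecticForm.chartArea, Measure.map_apply_of_aemeasurable haem hm]
  refine le_trans ?_ (measure_mono hsub')
  rw [withDensity_apply _ hgm, Measure.restrict_restrict hgm, inter_eq_self_of_subset_left hsub,
    lintegral_image_eq_lintegral_abs_det_fderiv_mul volume hB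
      (fun u hu ↦ (hD u hu).1.hasFDerivWithinAt) hginj]
  rw [setLIntegral_congr_fun (g := fun _ ↦ 1) hB]
  · simp
  · intro u hu
    simp only
    rw [← ENNReal.ofReal_mul (abs_nonneg _)]
    have h1 : Ω.chartDensity e (e (G u)) = |Ω.signedDensity p (e (G u))| := rfl
    rw [h1, ← abs_mul, (hD u hu).2, abs_one, ENNReal.ofReal_one]

variable [T2Space N] [SecondCountableTopology N]

/-- A cylinder of orbits of constant period `T` over an interval of length `b - a` has area at
least `(b - a) T`. -/
theorem mul_le_area (hH : ContMDiff (𝓡 2) 𝓘(ℝ, ℝ) ∞ H) {q : ℝ → N} {a b T : ℝ}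
    (hq : ContMDiffOn 𝓘(ℝ, ℝ) (𝓡 2) ∞ q (Ioo a b)) (hlev : ∀ c ∈ Ioo a b, H (q c) = c)
    (hT : ∀ c ∈ Ioo a b, IsLeastPeriod φ (q c) T) :
    ENNReal.ofReal (b - a) * ENNReal.ofReal T ≤ Ω.area univ := by
  have : Nonempty N := ⟨q a⟩
  set G : Plane → N := fun u ↦ φ (u 1) (q (u 0)) with hG
  set P : Set Plane := {u : Plane | u 0 ∈ Ioo a b ∧ u 1 ∈ Ioo 0 T} with hP
  have hp : ∀ i : Fin 2, ContDiff ℝ ∞ (fun u : Plane ↦ u i) := fun i ↦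
    (EuclideanSpace.proj (𝕜 := ℝ) i).contDiff
  have hPo : IsOpen P := (isOpen_Ioo.preimage (hp 0).continuous).inter
    (isOpen_Ioo.preimage (hp 1).continuous)
  have hGc : ContinuousOn G P := by
    refine ContMDiffOn.continuousOn (I := 𝓡 2) (I' := 𝓡 2) (n := ∞) ?_
    exact hφ.contMDiffOn (hp 1).contMDiff.contMDiffOn
      (hq.comp (hp 0).contMDiff.contMDiffOn fun u hu ↦ hu.1)
  -- The value of `H` recovers the level; two times in `(0, T)` differ by less than the least
  -- period.
  have hinj : InjOn G P := by
    intro u hu w hw h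
    have h0 : u 0 = w 0 := by
      have := congrArg H h
      simp only [hG] at this
      rwa [hφ.level, hφ.level, hlev _ hu.1, hlev _ hw.1] at this
    have h1 : u 1 = w 1 := by
      simp only [hG] at h
      rw [h0] at h
      rcases lt_trichotomy (u 1) (w 1) with hlt | heq | hlt
      · exact absurd ((hφ.eq_iff _ _ _).mp h.symm)
          ((hT _ hw.1).2.2 _ ⟨by linarith, by linarith [hu.2.1, hw.2.2]⟩)
      · exact heq
      · exact absurd ((hφ.eq_iff _ _ _).mp h)
          ((hT _ hw.1).2.2 _ ⟨by linarith, by linarith [hw.2.1, hu.2.2]⟩)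
    ext i; fin_cases i
    · exact h0
    · exact h1
  obtain ⟨s, hs, hsu⟩ := TopologicalSpace.countable_cover_nhds
    (fun p : N ↦ (chartAt Plane p).open_source.mem_nhds (mem_chart_source Plane p))
  have hsne : s.Nonempty := by
    by_contra h
    rw [not_nonempty_iff_eq_empty] at h
    subst h
    rw [biUnion_empty] at hsu
    exact empty_ne_univ hsu
  obtain ⟨p, rfl⟩ := hs.exists_eq_range hsne
  -- The image need not lie in one chart. The rectangle is cut into countably many disjoint pieces,
  -- each mapped into a single chart, whose chart area is dominated by the supremum defining
  -- `Ω.area`.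
  set Q : ℕ → Set Plane := fun n ↦ P ∩ G ⁻¹' (chartAt Plane (p n)).source with hQ
  have hQo : ∀ n, IsOpen (Q n) := fun n ↦
    hGc.isOpen_inter_preimage hPo (chartAt Plane (p n)).open_source
  have hQP : ⋃ n, Q n = P := by
    rw [← inter_iUnion, inter_eq_left]
    intro u _
    have : G u ∈ ⋃ x ∈ range p, (chartAt Plane x).source := hsu ▸ mem_univ _
    simpa using this
  have hdm : ∀ n, MeasurableSet (disjointed Q n) := fun n ↦
    MeasurableSet.disjointed (fun n ↦ (hQo n).measurableSet) n
  have hdsub : ∀ n, disjointed Q n ⊆ Q n := disjointed_subset Q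
  have hdP : ∀ n, disjointed Q n ⊆ P := fun n ↦ (hdsub n).trans inter_subset_left
  have him : ∀ n, MeasurableSet (G '' disjointed Q n) := fun n ↦
    (hdm n).image_of_continuousOn_injOn (hGc.mono (hdP n)) (hinj.mono (hdP n))
  have hdisj : Pairwise (Function.onFun Disjoint fun n ↦ G '' disjointed Q n) := by
    intro m n hmn
    rw [Function.onFun, disjoint_left]
    rintro _ ⟨u, hu, rfl⟩ ⟨w, hw, hwu⟩
    have := hinj (hdP n hw) (hdP m hu) hwu
    subst this
    exact disjoint_left.mp (disjoint_disjointed Q hmn) hu hw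
  calc ENNReal.ofReal (b - a) * ENNReal.ofReal T = volume P := by
        rw [hP, volume_plane_rectangle, sub_zero]
    _ = ∑' n, volume (disjointed Q n) := by
        rw [← hQP, ← iUnion_disjointed, measure_iUnion (disjoint_disjointed Q) hdm]
    _ ≤ ∑' n, Ω.area (G '' disjointed Q n) := by
        refine ENNReal.tsum_le_tsum fun n ↦ ?_
        refine (hφ.volume_le_chartArea hH isOpen_Ioo hq hlev (p n) (hdm n)
          (fun u hu ↦ (hdP n hu).1) (fun u hu ↦ (hdsub n hu).2) (hinj.mono (hdP n)) (him n)).trans ?_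
        exact (le_iSup₂ (f := fun (e : OpenPartialHomeomorph N Plane) (_ : e ∈ atlas Plane N) ↦
          Ω.chartArea e) (chartAt Plane (p n)) (chart_mem_atlas Plane (p n))) _
    _ = Ω.area (⋃ n, G '' disjointed Q n) := (measure_iUnion hdisj him).symm
    _ ≤ Ω.area univ := measure_mono (subset_univ _)

end IsHamiltonianFlow

end Area

/-! ### The Hessian at the limit point -/

section CriticalPoint

variable {N : Type*} [TopologicalSpace N] [ChartedSpace Plane N] [IsManifold (𝓡 2) ∞ N]

/-- The Hessian of `H` in the chart at `z`. -/
noncomputable def chartHessian (H : N → ℝ) (z : N) (v w : Plane) : ℝ :=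
  fderiv ℝ (fderiv ℝ (chartFunction H z)) (chartAt Plane z z) v w

omit [IsManifold (𝓡 2) ∞ N] in
theorem chartHessian_add_smul_left (H : N → ℝ) (z : N) (a b : ℝ) (v v' w : Plane) :
    chartHessian H z (a • v + b • v') w = a * chartHessian H z v w + b * chartHessian H z v' w := by
  simp only [chartHessian]
  rw [map_add, map_smul, map_smul, add_apply, smul_apply, smul_apply, smul_eq_mul, smul_eq_mul]

theorem chartHessian_comm {H : N → ℝ} (hH : ContMDiff (𝓡 2) 𝓘(ℝ, ℝ) ∞ H) (z : N) (v w : Plane) :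
    chartHessian H z v w = chartHessian H z w v := by
  have h : ContDiffAt ℝ ∞ (chartFunction H z) (chartAt Plane z z) :=
    (contDiffOn_chartFunction hH z).contDiffAt
      ((chartAt Plane z).open_target.mem_nhds (mem_chart_target Plane z))
  exact (h.isSymmSndFDerivAt (by
    rw [minSmoothness_of_isRCLikeNormedField]; exact ENat.LEInfty.out)).eq v w

theorem hasFDerivAt_fderiv_chartFunction {H : N → ℝ} (hH : ContMDiff (𝓡 2) 𝓘(ℝ, ℝ) ∞ H) (z : N)
    (w : Plane) : ∃ B : Plane →L[ℝ] ℝ,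
      HasFDerivAt (fun u ↦ fderiv ℝ (chartFunction H z) u w) B (chartAt Plane z z) ∧
      ∀ v, B v = chartHessian H z v w := by
  have h := (contDiffOn_chartFunction hH z).fderiv_of_isOpen (m := ∞)
    (chartAt Plane z).open_target le_rfl
  have h1 := ((h.contDiffAt ((chartAt Plane z).open_target.mem_nhds
    (mem_chart_target Plane z))).differentiableAt (by simp)).hasFDerivAt
  have h2 := (ContinuousLinearMap.apply ℝ ℝ w).hasFDerivAt.comp (chartAt Plane z z) h1
  exact ⟨_, h2, fun v ↦ rfl⟩

theorem fderiv_chartFunction_eq_zero {Ω : SymplecticForm N} {H : N → ℝ}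
    (hH : ContMDiff (𝓡 2) 𝓘(ℝ, ℝ) ∞ H) {z : N} (hz : hamVec Ω H z = 0) :
    fderiv ℝ (chartFunction H z) (chartAt Plane z z) = 0 := by
  have h0 := (hamVec_eq_zero_iff Ω H z).mp hz
  ext v
  rw [← differential_chartTangent hH z (mem_chart_target Plane z) v,
    (chartAt Plane z).left_inv (mem_chart_source Plane z), h0, zero_apply, zero_apply]

/-- The linearisation of the Hamiltonian vector field at a critical point squares to minus the
Hessian determinant. -/
theorem fderiv_chartVectorField_sq (Ω : SymplecticForm N) {H : N → ℝ}
    (hH : ContMDiff (𝓡 2) 𝓘(ℝ, ℝ) ∞ H) {z : N} (hz : hamVec Ω H z = 0) (v : Plane) :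
    fderiv ℝ (chartVectorField Ω H z) (chartAt Plane z z)
      (fderiv ℝ (chartVectorField Ω H z) (chartAt Plane z z) v) =
    (-(chartHessian H z planeE0 planeE0 * chartHessian H z planeE1 planeE1 -
      chartHessian H z planeE0 planeE1 ^ 2) / Ω.signedDensity z (chartAt Plane z z) ^ 2) • v := by
  set u := chartAt Plane z z with hu
  have hut : u ∈ (chartAt Plane z).target := mem_chart_target Plane z
  have hρne := Ω.signedDensity_ne_zero z hut
  set ρ := Ω.signedDensity z u with hρ
  have hd0 := fderiv_chartFunction_eq_zero hH hz
  obtain ⟨B0, hB0, hB0'⟩ := hasFDerivAt_fderiv_chartFunction hH z planeE0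
  obtain ⟨B1, hB1, hB1'⟩ := hasFDerivAt_fderiv_chartFunction hH z planeE1
  have hρd : DifferentiableAt ℝ (fun w ↦ (Ω.signedDensity z w)⁻¹) u :=
    (((Ω.contDiffOn_signedDensity z).contDiffAt
      ((chartAt Plane z).open_target.mem_nhds hut)).differentiableAt (by simp)).inv hρne
  -- The differential of `H` vanishes at `z`, so the derivative of the density drops out of the
  -- product rule.
  have hq0 : HasFDerivAt (fun w ↦ fderiv ℝ (chartFunction H z) w planeE0 / Ω.signedDensity z w)
      (ρ⁻¹ • B0) u := by
    have h := hB0.fun_mul hρd.hasFDerivAt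
    rw [← hu, hd0, zero_apply, zero_smul, zero_add] at h
    exact h
  have hq1 : HasFDerivAt (fun w ↦ -(fderiv ℝ (chartFunction H z) w planeE1) / Ω.signedDensity z w)
      (-(ρ⁻¹ • B1)) u := by
    have h := (hB1.fun_mul hρd.hasFDerivAt).neg
    rw [← hu, hd0, zero_apply, zero_smul, zero_add] at h
    refine h.congr_of_eventuallyEq (Filter.Eventually.of_forall fun w ↦ ?_)
    simp [div_eq_mul_inv]
  have hA : ∀ v, fderiv ℝ (chartVectorField Ω H z) u v =
      (-(ρ⁻¹ * chartHessian H z v planeE1)) • planeE0 +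
        (ρ⁻¹ * chartHessian H z v planeE0) • planeE1 := by
    intro v
    have h := (hq1.smul_const planeE0).add (hq0.smul_const planeE1)
    have h' : HasFDerivAt (chartVectorField Ω H z) _ u := h
    rw [h'.fderiv]
    simp [hB0', hB1']
  rw [hA, hA v, chartHessian_add_smul_left, chartHessian_add_smul_left]
  have hv := plane_eq_smul_add_smul v
  have h0 : chartHessian H z v planeE0 = v 0 * chartHessian H z planeE0 planeE0 +
      v 1 * chartHessian H z planeE0 planeE1 := by
    conv_lhs => rw [hv]
    rw [chartHessian_add_smul_left, chartHessian_comm hH z planeE1 planeE0]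
  have h1 : chartHessian H z v planeE1 = v 0 * chartHessian H z planeE0 planeE1 +
      v 1 * chartHessian H z planeE1 planeE1 := by
    conv_lhs => rw [hv]
    rw [chartHessian_add_smul_left]
  rw [h0, h1, chartHessian_comm hH z planeE1 planeE0]
  ext i
  fin_cases i
  · simp
    field_simp
    ring
  · simp
    field_simp
    ring

/-- Completing the square: with positive determinant, all diagonal values of the Hessian at non-zero
vectors have the sign of the first one. -/
theorem mul_chartHessian_self {H : N → ℝ} (hH : ContMDiff (𝓡 2) 𝓘(ℝ, ℝ) ∞ H) (z : N) (v : Plane) :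
    chartHessian H z planeE0 planeE0 * chartHessian H z v v =
      (chartHessian H z planeE0 planeE0 * v 0 + chartHessian H z planeE0 planeE1 * v 1) ^ 2 +
      (chartHessian H z planeE0 planeE0 * chartHessian H z planeE1 planeE1 -
        chartHessian H z planeE0 planeE1 ^ 2) * v 1 ^ 2 := by
  have hv := plane_eq_smul_add_smul v
  have h : chartHessian H z v v = v 0 ^ 2 * chartHessian H z planeE0 planeE0 +
      2 * (v 0 * v 1) * chartHessian H z planeE0 planeE1 +
      v 1 ^ 2 * chartHessian H z planeE1 planeE1 := by
    have h0 : ∀ w, chartHessian H z v w = v 0 * chartHessian H z planeE0 w +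
        v 1 * chartHessian H z planeE1 w := fun w ↦ by
      conv_lhs => rw [hv]
      rw [chartHessian_add_smul_left]
    rw [h0, chartHessian_comm hH z planeE0 v, chartHessian_comm hH z planeE1 v, h0, h0,
      chartHessian_comm hH z planeE1 planeE0]
    ring
  rw [h]; ring

namespace IsHamiltonianFlow

variable {Ω : SymplecticForm N} {H : N → ℝ} {φ : ℝ → N → N} (hφ : IsHamiltonianFlow Ω H φ)
include hφ

/-- A critical point that is a limit of periodic orbits of a fixed period on lower levels is a
non-degenerate maximum. -/
theorem chartHessian_neg (hH : ContMDiff (𝓡 2) 𝓘(ℝ, ℝ) ∞ H) {z : N} (hz : hamVec Ω H z = 0) {T : ℝ}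
    (hcl : z ∈ closure {y | H y < H z ∧ IsLeastPeriod φ y T}) (v : Plane) (hv : v ≠ 0) :
    chartHessian H z v v < 0 := by
  set e := chartAt Plane z with he
  have hut : e z ∈ e.target := mem_chart_target Plane z
  have hzs : z ∈ e.source := mem_chart_source Plane z
  have hfr := mem_closure_iff_frequently.mp hcl
  set Δ := chartHessian H z planeE0 planeE0 * chartHessian H z planeE1 planeE1 -
      chartHessian H z planeE0 planeE1 ^ 2 with hΔ
  have hTpos : 0 < T := by
    obtain ⟨y, hy⟩ := hfr.exists
    exact hy.2.1
  -- A non-positive determinant makes the square of the linearisation a non-negative scalar, and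
  -- then no non-constant orbit of period `T` stays near `z`.
  have hΔpos : 0 < Δ := by
    by_contra hneg
    obtain ⟨O, hO, hO'⟩ := eventually_periodic_orbit_constant e.open_target
      (contDiffOn_chartVectorField Ω hH z) hut
      (δ := -Δ / Ω.signedDensity z (e z) ^ 2) (div_nonneg (by linarith) (sq_nonneg _))
      (fun v ↦ fderiv_chartVectorField_sq Ω hH hz v) hTpos
    -- Because `z` is fixed, points near it stay near it for all times in `[0, T]`; for points of
    -- period `T` this controls the entire orbit.
    have hev : ∀ᶠ y in 𝓝 z, ∀ t ∈ Icc 0 T, φ t y ∈ e.source ∧ e (φ t y) ∈ O := by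
      refine isCompact_Icc.eventually_forall_of_forall_eventually
        (P := fun y t ↦ φ t y ∈ e.source ∧ e (φ t y) ∈ O) fun t _ ↦ ?_
      have hc : Filter.Tendsto (fun q : N × ℝ ↦ φ q.2 q.1) (𝓝 (z, t)) (𝓝 z) := by
        have := (hφ.continuous.comp continuous_swap).tendsto (z, t)
        simp only [Function.comp, Prod.swap] at this
        rwa [hφ.fixed_of_hamVec_eq_zero hz] at this
      exact hc.eventually ((e.open_source.eventually_mem hzs).and
        ((e.continuousAt hzs).eventually_mem hO))
    obtain ⟨y, ⟨hyH, hyT⟩, hyO⟩ := (hfr.and_eventually hev).exists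
    have hall : ∀ t, φ t y ∈ e.source ∧ e (φ t y) ∈ O := by
      intro t
      have h1 : φ t y = φ (t - ⌊t / T⌋ * T) y := by
        rw [hφ.eq_iff, sub_sub_cancel]
        exact hφ.periodic hyT.2.1 _
      rw [h1]
      refine hyO _ ⟨?_, ?_⟩
      · have := (le_div_iff₀ hTpos).mp (Int.floor_le (t / T))
        linarith
      · have := (div_lt_iff₀ hTpos).mp (Int.lt_floor_add_one (t / T))
        linarith
    have h2 := hO' (fun t ↦ e (φ t y)) (fun t ↦ (hall t).2)
      (fun t ↦ hφ.hasDerivAt_chart hH (hall t).1) (by rw [hyT.2.1, hφ.flow_zero])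
    simp only [hφ.flow_zero] at h2
    have hys : y ∈ e.source := by have := (hall 0).1; rwa [hφ.flow_zero] at this
    have h3 := hamVec_chart Ω hH z (e.map_source hys)
    rw [h2, map_zero, e.left_inv hys] at h3
    exact hyT.hamVec_ne_zero hφ h3
  have hself : ∀ v ≠ 0, 0 < chartHessian H z planeE0 planeE0 * chartHessian H z v v := by
    intro v hv
    have hb : chartHessian H z planeE0 planeE0 ≠ 0 := by
      intro h0
      rw [hΔ, h0] at hΔpos
      nlinarith [sq_nonneg (chartHessian H z planeE0 planeE1)]
    rw [mul_chartHessian_self hH]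
    by_cases h1 : v 1 = 0
    · have h0 : v 0 ≠ 0 := fun h0 ↦ hv (by ext i; fin_cases i <;> simp [h0, h1])
      rw [h1]
      simp only [mul_zero, add_zero, ne_eq, OfNat.ofNat_ne_zero, not_false_eq_true, zero_pow]
      positivity
    · positivity
  -- In the positive definite case the Morse lemma for `-H` makes `z` a local minimum, but points of
  -- lower level accumulate at `z`.
  have hb : chartHessian H z planeE0 planeE0 < 0 := by
    by_contra hge
    rw [not_lt] at hge
    have hpos : ∀ v ≠ 0, 0 < chartHessian H z v v := fun v hv ↦ by
      by_contra h
      have := hself v hv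
      nlinarith
    have hd : ∀ x, fderiv ℝ (fun u ↦ - chartFunction H z u) x =
      - fderiv ℝ (chartFunction H z) x := fun x ↦ fderiv_fun_neg
    obtain ⟨ψ, hψs, -, -, -, -, hψ⟩ := exists_morse_chart e.open_target
      (contDiffOn_chartFunction hH z).neg hut (by
        rw [hd, fderiv_chartFunction_eq_zero hH hz, neg_zero]) (by
        intro v hv
        have h1 : fderiv ℝ (fun u ↦ - chartFunction H z u) =
          fun x ↦ - fderiv ℝ (chartFunction H z) x := funext hd
        rw [h1, fderiv_fun_neg, _root_.neg_apply, _root_.neg_apply]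
        have := hpos v hv
        rw [chartHessian] at this
        linarith)
    have hev : ∀ᶠ y in 𝓝 z, H z ≤ H y := by
      filter_upwards [e.open_source.mem_nhds hzs,
        (e.continuousAt hzs).eventually_mem (ψ.open_source.mem_nhds hψs)] with y h1 h2
      have h3 := hψ _ h2
      simp only [chartFunction] at h3
      rw [e.left_inv h1, e.left_inv hzs] at h3
      nlinarith [sq_nonneg ‖ψ (e y)‖]
    obtain ⟨y, hy, hy'⟩ := (hfr.and_eventually hev).exists
    linarith [hy.1]
  by_contra hge
  have := hself v hv
  nlinarith

omit hφ in
/-- The Morse lemma on the surface, at a non-degenerate maximum. -/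
theorem _root_.exists_morse_chart_manifold (hH : ContMDiff (𝓡 2) 𝓘(ℝ, ℝ) ∞ H) {z : N}
    (hz : hamVec Ω H z = 0) (hneg : ∀ v ≠ 0, chartHessian H z v v < 0) :
    ∃ Ψ : OpenPartialHomeomorph N Plane, z ∈ Ψ.source ∧ Ψ z = 0 ∧
      ContMDiffOn (𝓡 2) (𝓡 2) ∞ Ψ Ψ.source ∧ ContMDiffOn (𝓡 2) (𝓡 2) ∞ Ψ.symm Ψ.target ∧
      ∀ y ∈ Ψ.source, H y = H z - ‖Ψ y‖ ^ 2 := by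
  set e := chartAt Plane z with he
  obtain ⟨ψ, hψs, hψe, hψ0, hsm, hsm', hψ⟩ := exists_morse_chart e.open_target
      (contDiffOn_chartFunction hH z) (mem_chart_target Plane z)
      (fderiv_chartFunction_eq_zero hH hz) hneg
  refine ⟨e.trans ψ, ?_, hψ0, ?_, ?_, ?_⟩
  · rw [OpenPartialHomeomorph.trans_source]
    exact ⟨mem_chart_source Plane z, hψs⟩
  · rw [OpenPartialHomeomorph.trans_source]
    exact hsm.contMDiffOn.comp ((contMDiffOn_chart (I := 𝓡 2) (x := z)).mono inter_subset_left)
      fun y hy ↦ hy.2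
  · rw [OpenPartialHomeomorph.trans_target]
    exact (contMDiffOn_chart_symm (I := 𝓡 2) (x := z)).comp
      (hsm'.contMDiffOn.mono inter_subset_left) fun y hy ↦ hy.2
  · rw [OpenPartialHomeomorph.trans_source]
    rintro y ⟨h1, h2⟩
    have h3 := hψ _ h2
    simp only [chartFunction] at h3
    rw [e.left_inv h1, e.left_inv (mem_chart_source Plane z)] at h3
    exact h3

end IsHamiltonianFlow

end CriticalPoint

/-! ### Stretching the interval of levels -/

section LevelDiffeomorphism

/-- A smooth increasing bijection of the line that maps `c₁` to `c₀` and is the identity above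
`c₂`. -/
theorem exists_level_stretch {c₀ c₁ c₂ : ℝ} (h01 : c₀ ≤ c₁) (h12 : c₁ < c₂) :
    ∃ κ : ℝ ≃ₜ ℝ, StrictMono κ ∧ ContDiff ℝ ∞ κ ∧ ContDiff ℝ ∞ κ.symm ∧ κ c₁ = c₀ ∧
      ∀ c, c₂ ≤ c → κ c = c := by
  -- A monotone function rising from `c₀ - c₁` to `0`; adding it to the identity gives derivative at
  -- least one, so the inverse is smooth.
  set f : ℝ → ℝ := fun c ↦ (c₁ - c₀) * Real.smoothTransition ((c - c₁) / (c₂ - c₁)) - (c₁ - c₀) with hf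
  have hfm : Monotone f := fun a b hab ↦ by
    have : Real.smoothTransition ((a - c₁) / (c₂ - c₁)) ≤
      Real.smoothTransition ((b - c₁) / (c₂ - c₁)) :=
      Real.smoothTransition.monotone (by
        have : 0 < c₂ - c₁ := by linarith
        gcongr)
    simp only [hf]
    have := mul_le_mul_of_nonneg_left this (show 0 ≤ c₁ - c₀ by linarith)
    linarith
  have hfs : ContDiff ℝ ∞ f := (contDiff_const.mul
    (Real.smoothTransition.contDiff.comp ((contDiff_id.sub contDiff_const).div_const _))).sub
    contDiff_const
  have hgs : ContDiff ℝ ∞ (fun c ↦ c + f c) := contDiff_id.add hfs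
  have hgm : StrictMono (fun c ↦ c + f c) := strictMono_id.add_monotone hfm
  have hf1 : f c₁ = - (c₁ - c₀) := by simp [hf]
  have hf2 : ∀ c, c₂ ≤ c → f c = 0 := fun c hc ↦ by
    simp only [hf]
    rw [Real.smoothTransition.one_of_one_le]
    · ring
    · rw [le_div_iff₀ (by linarith)]; linarith
  have hfle : ∀ c, f c ≤ 0 := fun c ↦ by
    have h := hfm (le_max_left c c₂)
    rwa [hf2 _ (le_max_right _ _)] at h
  have hfge : ∀ c, - (c₁ - c₀) ≤ f c := fun c ↦ by
    have h := Real.smoothTransition.nonneg ((c - c₁) / (c₂ - c₁))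
    have := mul_nonneg (show 0 ≤ c₁ - c₀ by linarith) h
    simp only [hf]
    linarith
  have hsurj : Function.Surjective (fun c ↦ c + f c) := by
    refine hgs.continuous.surjective ?_ ?_
    · exact Filter.tendsto_atTop_add_const_right _ (-(c₁ - c₀)) Filter.tendsto_id |>.congr'
        (Filter.EventuallyEq.rfl) |> fun h ↦ Filter.tendsto_atTop_mono
        (fun c ↦ by have := hfge c; simp only [id]; linarith) h
    · exact Filter.tendsto_atBot_mono (fun c ↦ by have := hfle c; simp only [id]; linarith)
        Filter.tendsto_id
  set κ := (hgm.orderIsoOfSurjective _ hsurj).toHomeomorph with hκ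
  have hκa : ∀ c, κ c = c + f c := fun c ↦ rfl
  refine ⟨κ, hgm, hgs, ?_, by rw [hκa, hf1]; ring, fun c hc ↦ by rw [hκa, hf2 c hc, add_zero]⟩
  refine κ.contDiff_symm_deriv (f' := fun c ↦ 1 + deriv f c) (fun c ↦ ?_) (fun c ↦ ?_) hgs
  · have : 0 ≤ deriv f c := hfm.deriv_nonneg
    positivity
  · exact (hasDerivAt_id c).add ((hfs.differentiable (by simp)) c).hasDerivAt

end LevelDiffeomorphism

/-! ### Gluing the Morse disc to the cylinder -/

section Disc

variable {N : Type*} [TopologicalSpace N] [ChartedSpace Plane N] [IsManifold (𝓡 2) ∞ N]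

open Classical in
/-- The map that moves the orbit of `q c` to the orbit of `q (k c)`, equivariantly. -/
noncomputable def levelShift (H : N → ℝ) (φ : ℝ → N → N) (q : ℝ → N) (k : ℝ → ℝ) (x : N) : N :=
  if h : ∃ t, φ t (q (H x)) = x then φ h.choose (q (k (H x))) else x

namespace IsHamiltonianFlow

variable {Ω : SymplecticForm N} {H : N → ℝ} {φ : ℝ → N → N} (hφ : IsHamiltonianFlow Ω H φ)
include hφ

/-- The time chosen in the definition is determined only up to multiples of the least period. Since
the source and target orbits have the same least period, the image does not depend on the choice. -/
theorem levelShift_apply {q : ℝ → N} {k : ℝ → ℝ} {T c : ℝ} (hc : H (q c) = c)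
    (hT : IsLeastPeriod φ (q c) T) (hT' : IsLeastPeriod φ (q (k c)) T) (t : ℝ) :
    levelShift H φ q k (φ t (q c)) = φ t (q (k c)) := by
  have hlev : H (φ t (q c)) = c := by rw [hφ.level, hc]
  have h : ∃ s, φ s (q (H (φ t (q c)))) = φ t (q c) := ⟨t, by rw [hlev]⟩
  rw [levelShift, dif_pos h]
  have h1 := h.choose_spec
  set s := h.choose
  rw [hlev] at h1 ⊢
  rw [hφ.eq_iff] at h1 ⊢
  obtain ⟨n, hn⟩ := (hT.period_iff hφ _).mp h1
  exact (hT'.period_iff hφ _).mpr ⟨n, hn⟩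

/-- The union of the orbits of a section has local coordinates: level and time. -/
theorem exists_time_coordinate (hH : ContMDiff (𝓡 2) 𝓘(ℝ, ℝ) ∞ H) {q : ℝ → N} {A : Set ℝ}
    (hA : IsOpen A) (hq : ContMDiffOn 𝓘(ℝ, ℝ) (𝓡 2) ∞ q A) (hlev : ∀ c ∈ A, H (q c) = c) {T : ℝ}
    (hT : ∀ c ∈ A, IsLeastPeriod φ (q c) T) {c : ℝ} (hc : c ∈ A) (t : ℝ) :
    ∃ U : Set N, IsOpen U ∧ φ t (q c) ∈ U ∧ ∃ s : N → ℝ, ContMDiffOn (𝓡 2) 𝓘(ℝ, ℝ) ∞ s U ∧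
      ∀ y ∈ U, H y ∈ A ∧ φ (s y) (q (H y)) = y := by
  obtain ⟨ε, hε, hεA, U, hU, hxU, s, hs, hsU, hbox⟩ := hφ.exists_flowBox hH hA
    (hφ.contMDiffOn (contMDiffOn_const (c := t)) hq) (fun c hc ↦ by rw [hφ.level, hlev c hc]) hc
    ((hφ.isLeastPeriod_apply (hT c hc) t).hamVec_ne_zero hφ)
  refine ⟨U, hU, hxU, fun y ↦ s y + t, ?_, fun y hy ↦ ?_⟩
  · exact (contDiff_id.add contDiff_const).contMDiff.comp_contMDiffOn hs
  · obtain ⟨h1, -, h3⟩ := hsU y hy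
    exact ⟨hεA h1, by rw [hφ.flow_add]; exact h3⟩

/-- In the local coordinates of level and time the shift changes the level by `k` and keeps the
time. -/
theorem contMDiffAt_levelShift (hH : ContMDiff (𝓡 2) 𝓘(ℝ, ℝ) ∞ H) {q : ℝ → N} {A : Set ℝ}
    (hA : IsOpen A) (hq : ContMDiffOn 𝓘(ℝ, ℝ) (𝓡 2) ∞ q A) (hlev : ∀ c ∈ A, H (q c) = c) {T : ℝ}
    (hT : ∀ c ∈ A, IsLeastPeriod φ (q c) T) {k : ℝ → ℝ} (hk : ContDiff ℝ ∞ k) {c : ℝ} (hc : c ∈ A)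
    (hkc : k c ∈ A) (t : ℝ) :
    ContMDiffAt (𝓡 2) (𝓡 2) ∞ (levelShift H φ q k) (φ t (q c)) := by
  have hA' : IsOpen (A ∩ k ⁻¹' A) := hA.inter (hA.preimage hk.continuous)
  obtain ⟨U, hU, hxU, s, hs, hsU⟩ := hφ.exists_time_coordinate hH hA' (hq.mono inter_subset_left)
    (fun c hc ↦ hlev c hc.1) (fun c hc ↦ hT c hc.1) ⟨hc, hkc⟩ t
  have h1 : ContMDiffOn (𝓡 2) (𝓡 2) ∞ (fun y ↦ φ (s y) (q (k (H y)))) U :=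
    hφ.contMDiffOn hs (hq.comp (hk.contMDiff.comp_contMDiffOn hH.contMDiffOn)
      fun y hy ↦ (hsU y hy).1.2)
  refine (h1.contMDiffAt (hU.mem_nhds hxU)).congr_of_eventuallyEq ?_
  filter_upwards [hU.mem_nhds hxU] with y hy
  obtain ⟨⟨h2, h3⟩, h4⟩ := hsU y hy
  nth_rewrite 1 [← h4]
  exact hφ.levelShift_apply (hlev _ h2) (hT _ h2) (hT _ h3) _

/-- The orbits of constant period around a non-degenerate maximum fill a disc. -/
theorem isEmbeddedDisc (hH : ContMDiff (𝓡 2) 𝓘(ℝ, ℝ) ∞ H) {q : ℝ → N} {c₀ cp T : ℝ}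
    (hq : ContMDiffOn 𝓘(ℝ, ℝ) (𝓡 2) ∞ q (Ioo c₀ cp)) (hlev : ∀ c ∈ Ioo c₀ cp, H (q c) = c)
    (hT : ∀ c ∈ Ioo c₀ cp, IsLeastPeriod φ (q c) T) {z : N}
    {Ψ : OpenPartialHomeomorph N Plane} (hzΨ : z ∈ Ψ.source) (hΨz : Ψ z = 0)
    (hΨ : ContMDiffOn (𝓡 2) (𝓡 2) ∞ Ψ Ψ.source) (hΨ' : ContMDiffOn (𝓡 2) (𝓡 2) ∞ Ψ.symm Ψ.target)
    (hΨH : ∀ y ∈ Ψ.source, H y = cp - ‖Ψ y‖ ^ 2) {r : ℝ} (hr : 0 < r) (hrc : c₀ ≤ cp - r ^ 2)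
    (hball : Metric.ball 0 r ⊆ Ψ.target)
    (hsub : ∀ u ∈ Metric.ball (0 : Plane) r, u ≠ 0 →
      ∃ t, φ t (q (H (Ψ.symm u))) = Ψ.symm u)
    (hsub' : ∀ c ∈ Ioo (cp - r ^ 2) cp, ∀ t,
      φ t (q c) ∈ Ψ.source ∧ Ψ (φ t (q c)) ∈ Metric.ball 0 r) :
    IsEmbeddedDisc ((⋃ c ∈ Ioo c₀ cp, range (fun t ↦ φ t (q c))) ∪ {z}) := by
  have hzH : H z = cp := by rw [hΨH z hzΨ, hΨz]; simp
  set c₁ := cp - r ^ 2 with hc₁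
  set r₂ := r / 2 with hr₂
  set c₂ := cp - r₂ ^ 2 with hc₂
  have h12 : c₁ < c₂ := by
    have : r₂ ^ 2 < r ^ 2 := by rw [hr₂]; nlinarith
    linarith
  have h2p : c₂ < cp := by
    have : 0 < r₂ ^ 2 := by positivity
    linarith
  -- The levels `(c₁, cp)` of the Morse disc are stretched onto all levels `(c₀, cp)`, while those
  -- above `c₂`, in the disc of half the radius, stay fixed. Hence the lifted map is the identity
  -- near `z`, which gives smoothness at `z`.
  obtain ⟨κ, hκm, hκs, hκs', hκ1, hκ2⟩ := exists_level_stretch hrc h12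
  have hκp : κ cp = cp := hκ2 cp h2p.le
  have hκ2' : ∀ c, c₂ ≤ c → κ.symm c = c := fun c hc ↦ by
    nth_rewrite 1 [← hκ2 c hc]; exact κ.symm_apply_apply c
  have hκmaps : ∀ c ∈ Ioo c₁ cp, κ c ∈ Ioo c₀ cp := fun c hc ↦
    ⟨by rw [← hκ1]; exact hκm hc.1, by rw [← hκp]; exact hκm hc.2⟩
  have hκmaps' : ∀ c ∈ Ioo c₀ cp, κ.symm c ∈ Ioo c₁ cp := fun c hc ↦ by
    constructor
    · rw [← hκm.lt_iff_lt, hκ1, κ.apply_symm_apply]; exact hc.1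
    · rw [← hκm.lt_iff_lt, hκp, κ.apply_symm_apply]; exact hc.2
  have hsubI : ∀ c ∈ Ioo c₁ cp, c ∈ Ioo c₀ cp := fun c hc ↦ ⟨hrc.trans_lt hc.1, hc.2⟩
  have hzW : ∀ c ∈ Ioo c₀ cp, ∀ t, φ t (q c) ≠ z := fun c hc t h ↦ by
    have := congrArg H h
    rw [hφ.level, hlev c hc, hzH] at this
    exact hc.2.ne this
  have happ : ∀ c ∈ Ioo c₁ cp, ∀ t, levelShift H φ q κ (φ t (q c)) = φ t (q (κ c)) :=
    fun c hc t ↦ hφ.levelShift_apply (hlev c (hsubI c hc)) (hT c (hsubI c hc))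
      (hT _ (hκmaps c hc)) t
  have happ' : ∀ c ∈ Ioo c₀ cp, ∀ t, levelShift H φ q κ.symm (φ t (q c)) = φ t (q (κ.symm c)) :=
    fun c hc t ↦ hφ.levelShift_apply (hlev c hc) (hT c hc) (hT _ (hsubI _ (hκmaps' c hc))) t
  -- Nothing is known about `q cp`, so both branches of the definition are considered; each returns
  -- `z`.
  have hshz : ∀ k : ℝ → ℝ, k cp = cp → levelShift H φ q k z = z := by
    intro k hk
    rw [levelShift]
    split_ifs with h
    · have hk' : k (H z) = H z := by rw [hzH, hk]
      rw [hk']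
      exact h.choose_spec
    · rfl
  have hpt : ∀ u ∈ Metric.ball (0 : Plane) r, u ≠ 0 →
      ∃ c ∈ Ioo c₁ cp, (‖u‖ ^ 2 = cp - c) ∧ ∃ t, Ψ.symm u = φ t (q c) := by
    intro u hu hu0
    obtain ⟨t, ht⟩ := hsub u hu hu0
    have h1 := hΨH _ (Ψ.map_target (hball hu))
    rw [Ψ.right_inv (hball hu)] at h1
    rw [mem_ball_zero_iff] at hu
    have h2 : 0 < ‖u‖ := norm_pos_iff.mpr hu0
    refine ⟨_, ⟨?_, ?_⟩, ?_, t, ht.symm⟩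
    · rw [h1]; nlinarith
    · rw [h1]; nlinarith
    · rw [h1]; ring
  have hsymm0 : Ψ.symm 0 = z := by rw [← hΨz, Ψ.left_inv hzΨ]
  have hnorm : ∀ c ∈ Ioo c₁ cp, ∀ t, Ψ (φ t (q c)) ≠ 0 := by
    intro c hc t h
    apply hzW c (hsubI c hc) t
    rw [← hsymm0, ← h, Ψ.left_inv (hsub' c hc t).1]
  set D := (⋃ c ∈ Ioo c₀ cp, range (fun t ↦ φ t (q c))) ∪ {z} with hD
  have hDcases : ∀ x ∈ D, x = z ∨ ∃ c ∈ Ioo c₀ cp, ∃ t, x = φ t (q c) := by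
    rintro x (hx | hx)
    · simp only [mem_iUnion] at hx
      obtain ⟨c, hc, t, rfl⟩ := hx
      exact Or.inr ⟨c, hc, t, rfl⟩
    · exact Or.inl hx
  have hDmem : ∀ c ∈ Ioo c₀ cp, ∀ t, φ t (q c) ∈ D := fun c hc t ↦
    Or.inl (mem_iUnion₂.mpr ⟨c, hc, t, rfl⟩)
  have hDz : z ∈ D := Or.inr rfl
  have hsz : Ψ.source ∩ Ψ ⁻¹' Metric.ball 0 r₂ ∈ 𝓝 z :=
    (Ψ.isOpen_inter_preimage Metric.isOpen_ball).mem_nhds ⟨hzΨ, by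
      simp only [mem_preimage, hΨz]; exact Metric.mem_ball_self (by positivity)⟩
  have hr2r : Metric.ball (0 : Plane) r₂ ⊆ Metric.ball 0 r :=
    Metric.ball_subset_ball (by rw [hr₂]; linarith)
  have hnear : ∀ u ∈ Metric.ball (0 : Plane) r₂, ∀ k : ℝ → ℝ, (∀ c, c₂ ≤ c → k c = c) →
      levelShift H φ q k (Ψ.symm u) = Ψ.symm u := by
    intro u hu k hk
    by_cases hu0 : u = 0
    · rw [hu0, hsymm0, hshz k (hk cp h2p.le)]
    · obtain ⟨c, hc, huc, t, ht⟩ := hpt u (hr2r hu) hu0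
      rw [mem_ball_zero_iff] at hu
      have hkc : k c = c := hk c (by nlinarith [norm_nonneg u])
      rw [ht, hφ.levelShift_apply (hlev c (hsubI c hc)) (hT c (hsubI c hc))
        (by rw [hkc]; exact hT c (hsubI c hc)), hkc]
  have hnear' : ∀ x ∈ Ψ.source ∩ Ψ ⁻¹' Metric.ball 0 r₂, levelShift H φ q κ.symm x = x := by
    rintro x ⟨hx, hxr⟩
    have := hnear _ hxr κ.symm hκ2'
    rwa [Ψ.left_inv hx] at this
  have hsm₁ : ∀ x ∈ D, ContMDiffAt (𝓡 2) (𝓡 2) ∞ (levelShift H φ q κ.symm) x := by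
    intro x hx
    rcases hDcases x hx with rfl | ⟨c, hc, t, rfl⟩
    · refine contMDiffAt_id.congr_of_eventuallyEq ?_
      filter_upwards [hsz] with y hy
      exact hnear' y hy
    · exact hφ.contMDiffAt_levelShift hH isOpen_Ioo hq hlev hT hκs' hc (hsubI _ (hκmaps' c hc)) t
  have hmap₁ : ∀ x ∈ D, levelShift H φ q κ.symm x ∈ Ψ.source ∧
      Ψ (levelShift H φ q κ.symm x) ∈ Metric.ball 0 r := by
    intro x hx
    rcases hDcases x hx with rfl | ⟨c, hc, t, rfl⟩
    · rw [hshz _ (hκ2' cp h2p.le), hΨz]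
      exact ⟨hzΨ, Metric.mem_ball_self hr⟩
    · rw [happ' c hc t]
      exact hsub' _ (hκmaps' c hc) t
  have hsm₂ : ∀ u ∈ Metric.ball (0 : Plane) r,
      ContMDiffAt (𝓡 2) (𝓡 2) ∞ (fun u ↦ levelShift H φ q κ (Ψ.symm u)) u := by
    intro u hu
    have hu' : ContMDiffAt (𝓡 2) (𝓡 2) ∞ Ψ.symm u :=
      hΨ'.contMDiffAt (Ψ.open_target.mem_nhds (hball hu))
    by_cases hu0 : u = 0
    · refine hu'.congr_of_eventuallyEq ?_
      have : Metric.ball (0 : Plane) r₂ ∈ 𝓝 u := by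
        rw [hu0]; exact Metric.ball_mem_nhds _ (by positivity)
      filter_upwards [this] with w hw
      exact hnear w hw κ hκ2
    · obtain ⟨c, hc, huc, t, ht⟩ := hpt u hu hu0
      have h1 := hφ.contMDiffAt_levelShift hH isOpen_Ioo hq hlev hT hκs (hsubI c hc)
        (hκmaps c hc) t
      rw [← ht] at h1
      exact h1.comp u hu'
  have hmap₂ : ∀ u ∈ Metric.ball (0 : Plane) r, levelShift H φ q κ (Ψ.symm u) ∈ D := by
    intro u hu
    by_cases hu0 : u = 0
    · rw [hu0, hsymm0, hshz κ hκp]; exact hDz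
    · obtain ⟨c, hc, huc, t, ht⟩ := hpt u hu hu0
      rw [ht, happ c hc]
      exact hDmem _ (hκmaps c hc) t
  have hleft : ∀ x ∈ D,
      levelShift H φ q κ (Ψ.symm (Ψ (levelShift H φ q κ.symm x))) = x := by
    intro x hx
    rw [Ψ.left_inv (hmap₁ x hx).1]
    rcases hDcases x hx with rfl | ⟨c, hc, t, rfl⟩
    · rw [hshz _ (hκ2' cp h2p.le), hshz κ hκp]
    · rw [happ' c hc t, happ _ (hκmaps' c hc), κ.apply_symm_apply]
  have hright : ∀ u ∈ Metric.ball (0 : Plane) r,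
      Ψ (levelShift H φ q κ.symm (levelShift H φ q κ (Ψ.symm u))) = u := by
    intro u hu
    by_cases hu0 : u = 0
    · rw [hu0, hsymm0, hshz κ hκp, hshz _ (hκ2' cp h2p.le), hΨz]
    · obtain ⟨c, hc, huc, t, ht⟩ := hpt u hu hu0
      rw [ht, happ c hc, happ' _ (hκmaps c hc), κ.symm_apply_apply, ← ht, Ψ.right_inv (hball hu)]
  have hDo : IsOpen D := by
    rw [isOpen_iff_mem_nhds]
    intro x hx
    rcases hDcases x hx with rfl | ⟨c, hc, t, rfl⟩
    · filter_upwards [hsz] with y hy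
      by_cases hy0 : Ψ y = 0
      · have : y = x := Ψ.injOn hy.1 hzΨ (hy0.trans hΨz.symm)
        rw [this]; exact hDz
      · obtain ⟨c, hc, -, t, ht⟩ := hpt _ (hr2r hy.2) hy0
        rw [Ψ.left_inv hy.1] at ht
        rw [ht]
        exact hDmem c (hsubI c hc) t
    · obtain ⟨U, hU, hxU, s, hs, hsU⟩ := hφ.exists_time_coordinate hH isOpen_Ioo hq hlev hT hc t
      filter_upwards [hU.mem_nhds hxU] with y hy
      obtain ⟨h1, h2⟩ := hsU y hy
      rw [← h2]
      exact hDmem _ h1 _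
  have hscale : ∀ u : Plane, u ∈ Metric.ball 0 1 → r • u ∈ Metric.ball 0 r := by
    intro u hu
    rw [mem_ball_zero_iff] at hu ⊢
    rw [norm_smul, Real.norm_of_nonneg hr.le]
    nlinarith
  have hfun : ContMDiffOn (𝓡 2) (𝓡 2) ∞ (fun x ↦ r⁻¹ • Ψ (levelShift H φ q κ.symm x)) D := by
    intro x hx
    refine ContMDiffAt.contMDiffWithinAt ?_
    have h1 : ContMDiffAt (𝓡 2) (𝓡 2) ∞ (fun x ↦ Ψ (levelShift H φ q κ.symm x)) x :=
      (hΨ.contMDiffAt (Ψ.open_source.mem_nhds (hmap₁ x hx).1)).comp x (hsm₁ x hx)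
    exact (contDiff_const_smul r⁻¹).contMDiff.contMDiffAt.comp x h1
  have hinv : ContMDiffOn (𝓡 2) (𝓡 2) ∞ (fun u : Plane ↦ levelShift H φ q κ (Ψ.symm (r • u)))
      (Metric.ball 0 1) := by
    intro u hu
    refine ContMDiffAt.contMDiffWithinAt ?_
    exact ContMDiffAt.comp (g := fun u ↦ levelShift H φ q κ (Ψ.symm u)) u (hsm₂ _ (hscale u hu))
      (contDiff_const_smul r).contMDiff.contMDiffAt
  -- The chart compresses the union of circles into the Morse disc, applies the Morse chart, and
  -- rescales the radius to one.
  let E : OpenPartialHomeomorph N Plane :=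
    { toFun := fun x ↦ r⁻¹ • Ψ (levelShift H φ q κ.symm x)
      invFun := fun u ↦ levelShift H φ q κ (Ψ.symm (r • u))
      source := D
      target := Metric.ball 0 1
      map_source' := fun x hx ↦ by
        have := (hmap₁ x hx).2
        rw [mem_ball_zero_iff] at this ⊢
        rw [norm_smul, norm_inv, Real.norm_of_nonneg hr.le, inv_mul_lt_iff₀ hr, mul_one]
        exact this
      map_target' := fun u hu ↦ hmap₂ _ (hscale u hu)
      left_inv' := fun x hx ↦ by
        rw [smul_inv_smul₀ hr.ne', hleft x hx]
      right_inv' := fun u hu ↦ by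
        rw [hright _ (hscale u hu), inv_smul_smul₀ hr.ne']
      open_source := hDo
      open_target := Metric.isOpen_ball
      continuousOn_toFun := hfun.continuousOn
      continuousOn_invFun := hinv.continuousOn }
  exact ⟨E, E.mem_maximalAtlas_of_contMDiffOn hfun hinv, rfl, rfl⟩

end IsHamiltonianFlow

end Disc

/-! ### The forward cylinder -/

section Forward

/-- Polar coordinates, with the circle connected because the dimension exceeds one. The result
spreads membership in the cylinder over the punctured Morse disc. -/
theorem isPreconnected_punctured_ball (r : ℝ) :
    IsPreconnected (Metric.ball (0 : Plane) r \ {0}) := by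
  have hrank : 1 < Module.rank ℝ Plane := by
    rw [← Module.finrank_eq_rank]; simp
  have h : Metric.ball (0 : Plane) r \ {0} =
      (fun p : ℝ × Plane ↦ p.1 • p.2) '' (Ioo 0 r ×ˢ Metric.sphere 0 1) := by
    ext u
    constructor
    · rintro ⟨hu, hu0⟩
      have h0 : 0 < ‖u‖ := norm_pos_iff.mpr hu0
      refine ⟨(‖u‖, ‖u‖⁻¹ • u), ⟨⟨h0, mem_ball_zero_iff.mp hu⟩, ?_⟩, ?_⟩
      · rw [mem_sphere_zero_iff_norm, norm_smul, norm_inv, norm_norm, inv_mul_cancel₀ h0.ne']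
      · simp only
        rw [smul_inv_smul₀ h0.ne']
    · rintro ⟨⟨a, v⟩, ⟨ha, hv⟩, rfl⟩
      have hv : ‖v‖ = 1 := mem_sphere_zero_iff_norm.mp hv
      have hn : ‖a • v‖ = a := by rw [norm_smul, hv, mul_one, Real.norm_of_nonneg ha.1.le]
      refine ⟨?_, ?_⟩
      · rw [mem_ball_zero_iff]; simp only; rw [hn]; exact ha.2
      · simp only [mem_singleton_iff]
        rw [← norm_eq_zero, hn]
        exact ha.1.ne'
  rw [h]
  exact (isPreconnected_Ioo.prod (isPreconnected_sphere hrank 0 1)).image _ (by fun_prop)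

variable {N : Type*} [TopologicalSpace N] [ChartedSpace Plane N] [IsManifold (𝓡 2) ∞ N] [T2Space N]

namespace IsHamiltonianFlow

variable {Ω : SymplecticForm N} {H : N → ℝ} {φ : ℝ → N → N} (hφ : IsHamiltonianFlow Ω H φ)
include hφ

/-- The part of an orbit cylinder inside a Morse disc around the limit point consists of the
concentric circles. -/
theorem cylinder_in_morse_chart (hH : ContMDiff (𝓡 2) 𝓘(ℝ, ℝ) ∞ H) {I : Set ℝ} {L : ℝ → Set N}
    (hcyl : IsOrbitCylinder Ω H I L) {c₀ cp : ℝ} (hIoo : Ioo c₀ cp ⊆ I) {z : N}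
    {Ψ : OpenPartialHomeomorph N Plane} (hzΨ : z ∈ Ψ.source) (hΨz : Ψ z = 0)
    (hΨH : ∀ y ∈ Ψ.source, H y = cp - ‖Ψ y‖ ^ 2) {r : ℝ} (hr : 0 < r) (hrc : c₀ ≤ cp - r ^ 2)
    (hball : Metric.ball 0 r ⊆ Ψ.target)
    (hcl : z ∈ closure {y | H y ∈ Ioo c₀ cp ∧ y ∈ L (H y)}) :
    (∀ u ∈ Metric.ball (0 : Plane) r, u ≠ 0 → Ψ.symm u ∈ L (H (Ψ.symm u))) ∧
    ∀ c ∈ Ioo (cp - r ^ 2) cp, ∀ x ∈ L c, x ∈ Ψ.source ∧ Ψ x ∈ Metric.ball 0 r := by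
  have hHsymm : ∀ u ∈ Metric.ball (0 : Plane) r, H (Ψ.symm u) = cp - ‖u‖ ^ 2 := fun u hu ↦ by
    have := hΨH _ (Ψ.map_target (hball hu))
    rwa [Ψ.right_inv (hball hu)] at this
  have hfirst : ∀ u ∈ Metric.ball (0 : Plane) r, u ≠ 0 → Ψ.symm u ∈ L (H (Ψ.symm u)) := by
    have hC : IsPreconnected (Ψ.symm '' (Metric.ball (0 : Plane) r \ {0})) :=
      (isPreconnected_punctured_ball r).image _
        (Ψ.continuousOn_symm.mono (sdiff_subset.trans hball))
    have hCI : ∀ y ∈ Ψ.symm '' (Metric.ball (0 : Plane) r \ {0}), H y ∈ interior I := by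
      rintro _ ⟨u, ⟨hu, hu0⟩, rfl⟩
      refine interior_mono hIoo ?_
      rw [interior_Ioo, hHsymm u hu]
      rw [mem_ball_zero_iff] at hu
      have : 0 < ‖u‖ := norm_pos_iff.mpr hu0
      constructor <;> nlinarith
    have hn : Ψ.source ∩ Ψ ⁻¹' Metric.ball 0 r ∈ 𝓝 z :=
      (Ψ.isOpen_inter_preimage Metric.isOpen_ball).mem_nhds ⟨hzΨ, by
        simp only [mem_preimage, hΨz]; exact Metric.mem_ball_self hr⟩
    obtain ⟨y, ⟨hyc, hyL⟩, hys, hyr⟩ := ((mem_closure_iff_frequently.mp hcl).and_eventually hn).exists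
    have hy0 : Ψ y ≠ 0 := fun h ↦ by
      have := hΨH y hys
      rw [h, norm_zero] at this
      have := hyc.2
      linarith
    have hyC : y ∈ Ψ.symm '' (Metric.ball (0 : Plane) r \ {0}) :=
      ⟨Ψ y, ⟨hyr, hy0⟩, Ψ.left_inv hys⟩
    exact fun u hu hu0 ↦ hφ.mem_cylinder_of_isPreconnected hH hcyl hC hCI hyC hyL ⟨u, ⟨hu, hu0⟩, rfl⟩
  refine ⟨hfirst, fun c hc x hx ↦ ?_⟩
  set ρ := √(cp - c) with hρ
  have hρ2 : ρ ^ 2 = cp - c := Real.sq_sqrt (by linarith [hc.2])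
  have hρ0 : 0 < ρ := Real.sqrt_pos.mpr (by linarith [hc.2])
  have hρr : ρ < r := by
    have := hc.1
    nlinarith
  have hu₀ : ‖ρ • planeE0‖ = ρ := by
    rw [norm_smul, Real.norm_of_nonneg hρ0.le]; simp
  have hu₀b : ρ • planeE0 ∈ Metric.ball (0 : Plane) r := by
    rw [mem_ball_zero_iff, hu₀]; exact hρr
  have hu₀0 : ρ • planeE0 ≠ 0 := by
    rw [← norm_ne_zero_iff, hu₀]; exact hρ0.ne'
  set y₀ := Ψ.symm (ρ • planeE0) with hy₀
  have hy₀H : H y₀ = c := by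
    rw [hy₀, hHsymm _ hu₀b, hu₀, hρ2]; ring
  have hcI : c ∈ I := hIoo ⟨by linarith [hc.1], hc.2⟩
  have hy₀L : y₀ ∈ L c := by
    have := hfirst _ hu₀b hu₀0
    rwa [← hy₀, hy₀H] at this
  have hrange := (hφ.circle_spec hH (hcyl.circle c hcI) hy₀L).2.1
  have hsph : Metric.sphere (0 : Plane) ρ ⊆ Metric.ball 0 r := fun u hu ↦ by
    rw [mem_ball_zero_iff, mem_sphere_zero_iff_norm.mp hu]; exact hρr
  have hK : IsCompact (Ψ.symm '' Metric.sphere (0 : Plane) ρ) :=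
    (isCompact_sphere _ _).image_of_continuousOn (Ψ.continuousOn_symm.mono (hsph.trans hball))
  -- The orbit cannot leave the small circle: the times spent on it form a closed set by
  -- compactness, and an open one because within the chart the level determines the distance to the
  -- centre.
  have huniv : (fun t ↦ φ t y₀) ⁻¹' (Ψ.symm '' Metric.sphere (0 : Plane) ρ) = univ := by
    refine IsClopen.eq_univ ⟨hK.isClosed.preimage (hφ.continuous_orbit y₀), ?_⟩ ⟨0, ?_⟩
    · rw [isOpen_iff_mem_nhds]
      rintro t ⟨u, hu, hut⟩
      simp only at hut
      have hmem : φ t y₀ ∈ Ψ.source := hut ▸ Ψ.map_target (hball (hsph hu))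
      filter_upwards [(hφ.continuous_orbit y₀).continuousAt.eventually_mem
        (Ψ.open_source.mem_nhds hmem)] with s hs
      refine ⟨Ψ (φ s y₀), ?_, Ψ.left_inv hs⟩
      have h1 := hΨH _ hs
      rw [hφ.level, hy₀H] at h1
      rw [mem_sphere_zero_iff_norm]
      have h2 : ‖Ψ (φ s y₀)‖ ^ 2 = ρ ^ 2 := by rw [hρ2]; linarith
      exact (pow_left_inj₀ (norm_nonneg _) hρ0.le two_ne_zero).mp h2
    · simp only [mem_preimage]
      rw [hφ.flow_zero]
      exact ⟨_, mem_sphere_zero_iff_norm.mpr hu₀, rfl⟩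
  rw [hrange] at hx
  obtain ⟨t, rfl⟩ := hx
  have ht : t ∈ (fun t ↦ φ t y₀) ⁻¹' (Ψ.symm '' Metric.sphere (0 : Plane) ρ) := huniv ▸ mem_univ t
  obtain ⟨u, hu, hut⟩ := ht
  simp only at hut ⊢
  rw [← hut, Ψ.right_inv (hball (hsph hu))]
  exact ⟨Ψ.map_target (hball (hsph hu)), hsph hu⟩

end IsHamiltonianFlow

/-- A resonant maximal forward cylinder ends at a non-degenerate maximum. -/
theorem resonant_forward_cylinder [SecondCountableTopology N] [MeasurableSpace N] [BorelSpace N]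
    (Ω : SymplecticForm N) (hΩ : Ω.area univ < ⊤) (H : N → ℝ)
    (hH : ContMDiff (𝓡 2) 𝓘(ℝ, ℝ) ∞ H) (hproper : IsProperMap H) (c₀ : ℝ) (J : Set ℝ)
    (L : ℝ → Set N) (hmax : IsMaximalForwardCylinder Ω H c₀ J L)
    (hres : IsResonantCylinder Ω H J L) :
    ∃ cp : ℝ, J = Ico c₀ cp ∧
      ∃ z : N, IsLocalMax H z ∧ IsNondegenerateCriticalPoint H z ∧
        IsEmbeddedDisc ((⋃ c ∈ Ioo c₀ cp, L c) ∪ {z}) ∧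
        GeneratesCircleActionWithFixedPoint Ω H ((⋃ c ∈ Ioo c₀ cp, L c) ∪ {z}) z := by
  obtain ⟨I, L', ⟨hcyl, hmaximal⟩, hc₀I, rfl, hJL⟩ := hmax
  obtain ⟨φ, hφ⟩ := exists_isHamiltonianFlow Ω hH hproper
  have hc₀ : c₀ ∈ I := interior_subset hc₀I
  obtain ⟨T, hTpos, hT⟩ := hφ.exists_common_period hH hcyl inter_subset_left
    (hcyl.interval.inter ordConnected_Ici) ⟨c₀, hc₀, self_mem_Ici⟩ hJL hres
  obtain ⟨F, hF, hFL⟩ := hcyl.isotopy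
  set q : ℝ → N := fun c ↦ F (c, 0) with hqdef
  have hq : ContMDiffOn 𝓘(ℝ, ℝ) (𝓡 2) ∞ q I := by
    refine hF.comp (f := fun c : ℝ ↦ (c, (0 : ℝ))) ?_ fun c hc ↦ ⟨hc, mem_univ _⟩
    exact (contDiff_id.prodMk contDiff_const).contMDiff.contMDiffOn
  have hqL : ∀ c ∈ I, q c ∈ L' c := fun c hc ↦ by rw [(hFL c hc).1]; exact ⟨0, rfl⟩
  have hqlev : ∀ c ∈ I, H (q c) = c := fun c hc ↦
    (hφ.circle_spec hH (hcyl.circle c hc) (hqL c hc)).1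
  have hqrange : ∀ c ∈ I, L' c = range (fun t ↦ φ t (q c)) := fun c hc ↦
    (hφ.circle_spec hH (hcyl.circle c hc) (hqL c hc)).2.1
  -- Each level `b` above `c₀` forces an area of at least `(b - c₀) * T`.
  have hbdd : BddAbove I := by
    refine ⟨max c₀ (c₀ + (Ω.area univ).toReal / T), fun b hb ↦ ?_⟩
    by_contra! hlt
    have hc₀b : c₀ < b := (le_max_left _ _).trans_lt hlt
    have hsub : Ioo c₀ b ⊆ I := Ioo_subset_Icc_self.trans (hcyl.interval.out hc₀ hb)
    have h1 := hφ.mul_le_area hH (hq.mono hsub) (fun c hc ↦ hqlev c (hsub hc))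
      (fun c hc ↦ hT c ⟨hsub hc, hc.1.le⟩ _ (hqL c (hsub hc)))
    rw [← ENNReal.ofReal_mul (by linarith), ENNReal.ofReal_le_iff_le_toReal hΩ.ne] at h1
    have h2 := (le_max_right _ _).trans_lt hlt
    have h3 : b - c₀ ≤ (Ω.area univ).toReal / T := (le_div_iff₀ hTpos).mpr h1
    linarith
  set cp := sSup I with hcp
  have hIcp : I ⊆ Iic cp := fun c hc ↦ le_csSup hbdd hc
  have hc₀cp : c₀ < cp := by
    obtain ⟨δ, hδ, hδI⟩ := exists_Ioo_subset_of_mem_nhds (mem_interior_iff_mem_nhds.mp hc₀I)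
    have : c₀ + δ / 2 ≤ cp := hIcp (hδI ⟨by linarith, by linarith⟩)
    linarith
  have hIco : Ico c₀ cp ⊆ I := fun c hc ↦ by
    obtain ⟨b, hb, hcb⟩ := exists_lt_of_lt_csSup ⟨c₀, hc₀⟩ hc.2
    exact hcyl.interval.out hc₀ hb ⟨hc.1, hcb.le⟩
  have hIoo : Ioo c₀ cp ⊆ I := Ioo_subset_Ico_self.trans hIco
  have hTIco : ∀ c ∈ Ico c₀ cp, ∀ x ∈ L' c, IsLeastPeriod φ x T :=
    fun c hc x hx ↦ hT c ⟨hIco hc, hc.1⟩ x hx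
  set W := {y | H y ∈ Ioo c₀ cp ∧ y ∈ L' (H y)} with hW
  have hqW : ∀ c ∈ Ioo c₀ cp, q c ∈ W := fun c hc ↦ by
    have := hqlev c (hIoo hc)
    exact ⟨by rwa [this], by rw [this]; exact hqL c (hIoo hc)⟩
  have hqev : ∀ᶠ c in 𝓝[<] cp, q c ∈ W := by
    filter_upwards [Ioo_mem_nhdsLT hc₀cp] with c hc
    exact hqW c hc
  have hcrit : ∀ z, H z = cp → z ∈ closure W → (cp ∈ I → z ∈ L' cp) → hamVec Ω H z = 0 := by
    intro z hz hzW hzL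
    by_contra hreg
    obtain ⟨I', L'', h1, h2, h3, h4⟩ := hφ.exists_extension hH hcyl hc₀cp hIco hIcp hTIco hz hreg
      hzW hzL
    exact h4 (hmaximal I' L'' h1 h2 h3)
  -- If the level `cp` were attained, `q cp` would be a regular limit of the cylinder, and the
  -- cylinder could be continued.
  have hcpI : cp ∉ I := by
    intro hcpI
    have hcw : Filter.Tendsto q (𝓝[<] cp) (𝓝 (q cp)) := by
      have h1 := (hq.continuousOn cp hcpI).mono hIoo
      have h2 : 𝓝[Ioo c₀ cp] cp = 𝓝[<] cp := nhdsWithin_Ioo_eq_nhdsLT hc₀cp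
      rw [← h2]
      exact h1
    obtain ⟨h1, -, τ, hτ⟩ := hφ.circle_spec hH (hcyl.circle cp hcpI) (hqL cp hcpI)
    exact hτ.hamVec_ne_zero hφ
      (hcrit (q cp) h1 (mem_closure_of_tendsto hcw hqev) fun _ ↦ hqL cp hcpI)
  have hJ : I ∩ Ici c₀ = Ico c₀ cp := by
    ext c
    constructor
    · rintro ⟨h1, h2⟩
      refine ⟨h2, lt_of_le_of_ne (hIcp h1) ?_⟩
      rintro rfl
      exact hcpI h1
    · exact fun h ↦ ⟨hIco h, h.1⟩
  have hcompact : IsCompact (H ⁻¹' Icc c₀ cp) := hproper.isCompact_preimage isCompact_Icc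
  -- A cluster point along `c → cp` from below suffices; convergence of `q c` is neither known nor
  -- needed.
  obtain ⟨z, -, hzcl⟩ := hcompact.exists_clusterPt (f := Filter.map q (𝓝[<] cp)) (by
    rw [Filter.le_principal_iff, Filter.mem_map]
    filter_upwards [Ioo_mem_nhdsLT hc₀cp] with c hc
    simp only [mem_preimage]
    rw [hqlev c (hIoo hc)]
    exact Ioo_subset_Icc_self hc)
  have hclos : ∀ S : Set N, (∀ᶠ c in 𝓝[<] cp, q c ∈ S) → z ∈ closure S := fun S hS ↦
    mem_closure_iff_clusterPt.mpr (hzcl.mono (Filter.le_principal_iff.mpr hS))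
  have hzW : z ∈ closure W := hclos W hqev
  have hHz : H z = cp := by
    have hlevels : ∀ a < cp, H z ∈ Icc a cp := by
      intro a ha
      have h1 : IsClosed (H ⁻¹' Icc a cp) := isClosed_Icc.preimage hH.continuous
      have h2 : z ∈ closure (H ⁻¹' Icc a cp) := hclos _ (by
        filter_upwards [Ioo_mem_nhdsLT hc₀cp, Ioo_mem_nhdsLT ha] with c hc hc'
        simp only [mem_preimage]
        rw [hqlev c (hIoo hc)]
        exact Ioo_subset_Icc_self hc')
      rwa [h1.closure_eq] at h2
    exact le_antisymm (hlevels c₀ hc₀cp).2 (le_of_forall_lt fun a ha ↦ by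
      obtain ⟨b, hb1, hb2⟩ := exists_between ha
      exact hb1.trans_le (hlevels b hb2).1)
  have hz0 : hamVec Ω H z = 0 := hcrit z hHz hzW fun h ↦ absurd h hcpI
  have hWsub : W ⊆ {y | H y < H z ∧ IsLeastPeriod φ y T} := fun y hy ↦
    ⟨by rw [hHz]; exact hy.1.2, hTIco _ ⟨hy.1.1.le, hy.1.2⟩ y hy.2⟩
  have hneg := hφ.chartHessian_neg hH hz0 (closure_mono hWsub hzW)
  obtain ⟨Ψ, hzΨ, hΨz, hΨ, hΨ', hΨH⟩ := exists_morse_chart_manifold hH hz0 hneg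
  rw [hHz] at hΨH
  obtain ⟨ε, hε, hεb⟩ := Metric.isOpen_iff.mp Ψ.open_target 0 (hΨz ▸ Ψ.map_source hzΨ)
  -- The second bound keeps the Morse disc above the level `c₀`.
  set r := min ε √(cp - c₀) with hr
  have hrpos : 0 < r := lt_min hε (Real.sqrt_pos.mpr (by linarith))
  have hrsq : r ^ 2 ≤ cp - c₀ := by
    calc r ^ 2 ≤ √(cp - c₀) ^ 2 := by
          have := min_le_right ε √(cp - c₀)
          gcongr
      _ = cp - c₀ := Real.sq_sqrt (by linarith)
  have hrb : Metric.ball 0 r ⊆ Ψ.target := (Metric.ball_subset_ball (min_le_left _ _)).trans hεb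
  obtain ⟨hin, hout⟩ := hφ.cylinder_in_morse_chart hH hcyl hIoo hzΨ hΨz hΨH hrpos (by linarith) hrb hzW
  have hset : (⋃ c ∈ Ioo c₀ cp, L c) = ⋃ c ∈ Ioo c₀ cp, range (fun t ↦ φ t (q c)) := by
    refine iUnion₂_congr fun c hc ↦ ?_
    rw [hJL c ⟨hIoo hc, hc.1.le⟩, hqrange c (hIoo hc)]
  have hqT : ∀ c ∈ Ioo c₀ cp, IsLeastPeriod φ (q c) T := fun c hc ↦
    hTIco c (Ioo_subset_Ico_self hc) _ (hqL c (hIoo hc))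
  have hzfix : ∀ t, φ t z = z := hφ.fixed_of_hamVec_eq_zero hz0
  refine ⟨cp, hJ, z, ?_, ⟨(hamVec_eq_zero_iff Ω H z).mp hz0, fun v hv ↦ ?_⟩, ?_, T, φ,
    ⟨hTpos, ?_, ?_, ?_, ?_, ?_, ?_⟩, ?_⟩
  · filter_upwards [Ψ.open_source.mem_nhds hzΨ] with y hy
    rw [hΨH y hy, hHz]
    have := sq_nonneg ‖Ψ y‖
    linarith
  · by_contra hv0
    have := hneg v hv0
    rw [chartHessian] at this
    exact this.ne (hv v)
  · rw [hset]
    refine hφ.isEmbeddedDisc hH (hq.mono hIoo) (fun c hc ↦ hqlev c (hIoo hc)) hqT hzΨ hΨz hΨ hΨ' hΨH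
      hrpos (by linarith) hrb (fun u hu hu0 ↦ ?_) (fun c hc t ↦ ?_)
    · have h1 := hin u hu hu0
      have h2 := hΨH _ (Ψ.map_target (hrb hu))
      rw [Ψ.right_inv (hrb hu)] at h2
      rw [mem_ball_zero_iff] at hu
      have h3 : 0 < ‖u‖ := norm_pos_iff.mpr hu0
      have h4 : H (Ψ.symm u) ∈ I := hIoo ⟨by nlinarith, by nlinarith⟩
      rw [hqrange _ h4] at h1
      exact h1
    · have h4 : c ∈ I := hIoo ⟨by linarith [hc.1], hc.2⟩
      exact hout c hc _ (by rw [hqrange c h4]; exact ⟨t, rfl⟩)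
  · exact hφ.smooth.contMDiffOn
  · intro t x hx
    rw [hset] at hx ⊢
    rcases hx with hx | hx
    · simp only [mem_iUnion] at hx
      obtain ⟨c, hc, s, rfl⟩ := hx
      exact Or.inl (mem_iUnion₂.mpr ⟨c, hc, t + s, hφ.flow_add t s _⟩)
    · rw [mem_singleton_iff] at hx
      rw [hx, hzfix]
      exact Or.inr rfl
  · exact fun x _ ↦ hφ.flow_zero x
  · exact fun s t x _ ↦ hφ.flow_add s t x
  · intro x hx
    rw [hset] at hx
    rcases hx with hx | hx
    · simp only [mem_iUnion] at hx
      obtain ⟨c, hc, s, rfl⟩ := hx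
      exact (hφ.isLeastPeriod_apply (hqT c hc) s).2.1
    · rw [mem_singleton_iff] at hx
      rw [hx, hzfix]
  · exact fun x _ ↦ hφ.orbit x
  · ext x
    constructor
    · rintro ⟨hx, hfix⟩
      rw [hset] at hx
      rcases hx with hx | hx
      · simp only [mem_iUnion] at hx
        obtain ⟨c, hc, s, rfl⟩ := hx
        -- A point on a circle is moved by the flow at half its least period.
        exact absurd (hfix (T / 2)) ((hφ.isLeastPeriod_apply (hqT c hc) s).2.2 _
          ⟨by linarith, by linarith⟩)
      · exact hx
    · rintro rfl
      exact ⟨Or.inr rfl, hzfix⟩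

end Forward

/-! ### Reversing the levels -/

section Reflection

variable {N : Type*} [TopologicalSpace N] [ChartedSpace Plane N] [IsManifold (𝓡 2) ∞ N]

/-- The opposite symplectic form. -/
noncomputable def SymplecticForm.opposite (Ω : SymplecticForm N) : SymplecticForm N where
  form z := -Ω.form z
  alternating z v := by
    rw [neg_apply, neg_apply, Ω.alternating, neg_zero]
  nondegenerate z v h := Ω.nondegenerate z v fun w ↦ by
    have := h w
    rwa [neg_apply, neg_apply, neg_eq_zero] at this
  smooth := ContMDiff.neg_section Ω.smooth

theorem SymplecticForm.area_opposite [MeasurableSpace N] (Ω : SymplecticForm N) :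
    Ω.opposite.area = Ω.area := by
  have h : ∀ (e : OpenPartialHomeomorph N Plane) (x : Plane),
      Ω.opposite.chartDensity e x = Ω.chartDensity e x := fun e x ↦ by
    simp only [SymplecticForm.chartDensity, SymplecticForm.opposite]
    rw [neg_apply, neg_apply, abs_neg]
  simp only [SymplecticForm.area, SymplecticForm.chartArea, h]

/-- The signs of the form and of the Hamiltonian cancel in the defining equation. Orbits, periods
and orbit circles are thus unchanged, only their levels are negated. -/
theorem hamiltonianVectorField_opposite (Ω : SymplecticForm N) (H : N → ℝ) :
    hamiltonianVectorField Ω.opposite (-H) = hamiltonianVectorField Ω H := by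
  funext z
  refine (Ω.existsUnique_dual z (-(mfderiv (𝓡 2) 𝓘(ℝ, ℝ) H z))).unique ?_ ?_
  · ext v
    have h : -(Ω.bilin z (hamVec Ω.opposite (-H) z) v) = -(differential (-H) z v) :=
      hamiltonianVectorField_spec Ω.opposite (-H) z v
    have h1 : differential (-H) z = -differential H z := mfderiv_neg
    have h2 : differential (-H) z v = -differential H z v := by rw [h1]; rfl
    have h3 : Ω.bilin z (hamVec Ω.opposite (-H) z) v = -differential H z v := by linarith
    exact h3
  · ext v
    exact hamiltonianVectorField_spec Ω H z v

variable {Ω Ω' : SymplecticForm N} {H H' : N → ℝ}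

theorem IsEmbeddedCircle.reflect
    (horb : ∀ γ, IsHamiltonianOrbit Ω H γ → IsHamiltonianOrbit Ω' H' γ) (hH' : ∀ z, H' z = -H z)
    {c : ℝ} {L : Set N} (h : IsEmbeddedCircle Ω H c L) : IsEmbeddedCircle Ω' H' (-c) L := by
  obtain ⟨γ, h1, h2, h3, h4, h5⟩ := h
  exact ⟨γ, horb γ h1, h2, h3, fun t ↦ by rw [hH', h4], h5⟩

theorem IsOrbitCylinder.reflect
    (horb : ∀ γ, IsHamiltonianOrbit Ω H γ → IsHamiltonianOrbit Ω' H' γ) (hH' : ∀ z, H' z = -H z)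
    {I : Set ℝ} {L : ℝ → Set N} (h : IsOrbitCylinder Ω H I L) :
    IsOrbitCylinder Ω' H' (Neg.neg ⁻¹' I) (fun c ↦ L (-c)) := by
  refine ⟨⟨fun x hx y hy r hr ↦ h.interval.out hy hx ⟨neg_le_neg hr.2, neg_le_neg hr.1⟩⟩, ?_,
    fun c hc ↦ ?_⟩
  · obtain ⟨F, hF, hFL⟩ := h.isotopy
    refine ⟨fun p ↦ F (-p.1, p.2), ?_, fun c hc ↦ hFL (-c) hc⟩
    exact hF.comp (f := fun p : ℝ × ℝ ↦ (-p.1, p.2))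
      (contDiff_fst.neg.prodMk contDiff_snd).contMDiff.contMDiffOn fun p hp ↦ ⟨hp.1, mem_univ _⟩
  · have := (h.circle (-c) hc).reflect horb hH'
    rwa [neg_neg] at this

theorem IsMaximalOrbitCylinder.reflect
    (horb : ∀ γ, IsHamiltonianOrbit Ω H γ ↔ IsHamiltonianOrbit Ω' H' γ) (hH' : ∀ z, H' z = -H z)
    {I : Set ℝ} {L : ℝ → Set N} (h : IsMaximalOrbitCylinder Ω H I L) :
    IsMaximalOrbitCylinder Ω' H' (Neg.neg ⁻¹' I) (fun c ↦ L (-c)) := by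
  refine ⟨h.1.reflect (fun γ ↦ (horb γ).mp) hH', fun I' L' hcyl hII' hL' ↦ ?_⟩
  have h1 := h.2 _ _ (hcyl.reflect (fun γ ↦ (horb γ).mpr) fun z ↦ by rw [hH', neg_neg])
    (fun c hc ↦ hII' (show - -c ∈ I by rwa [neg_neg]))
    (fun c hc ↦ by
      have := hL' (-c) (show - -c ∈ I by rwa [neg_neg])
      simpa only [neg_neg] using this)
  rw [← h1]
  ext c
  simp

theorem IsResonantCylinder.reflect
    (horb : ∀ γ, IsHamiltonianOrbit Ω H γ ↔ IsHamiltonianOrbit Ω' H' γ)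
    {J : Set ℝ} {L : ℝ → Set N} (h : IsResonantCylinder Ω H J L) :
    IsResonantCylinder Ω' H' (Neg.neg ⁻¹' J) (fun c ↦ L (-c)) := by
  intro c hc
  have h1 : derivWithin (fun c' ↦ orbitPeriod Ω H (L c')) J (-c) = 0 := not_not.mp (h (-c) hc)
  have h2 : ∀ S : Set N, orbitPeriod Ω' H' S = orbitPeriod Ω H S := fun S ↦ by
    simp only [orbitPeriod, horb]
  simp only [IsNonResonantCircle, h2, not_not]
  have h3 := derivWithin_comp_neg (f := fun c' ↦ orbitPeriod Ω H (L c')) (s := Neg.neg ⁻¹' J) (x := c)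
  have h4 : (Neg.neg ⁻¹' (Neg.neg ⁻¹' J) : Set ℝ) = J := by ext; simp
  have h5 : derivWithin (fun c' ↦ orbitPeriod Ω H (L (-c'))) (Neg.neg ⁻¹' J) c =
      -derivWithin (fun c' ↦ orbitPeriod Ω H (L c')) (Neg.neg ⁻¹' (Neg.neg ⁻¹' J)) (-c) := h3
  rw [h5, h4, h1, neg_zero]

omit [IsManifold (𝓡 2) ∞ N] in
theorem IsNondegenerateCriticalPoint.of_neg {z : N} (h : IsNondegenerateCriticalPoint (-H) z) :
    IsNondegenerateCriticalPoint H z := by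
  obtain ⟨h1, h2⟩ := h
  refine ⟨?_, fun v hv ↦ h2 v fun w ↦ ?_⟩
  · have h3 : differential (-H) z = -differential H z := mfderiv_neg
    have h4 : differential (-H) z = 0 := h1
    rw [h4, eq_comm, neg_eq_zero] at h3
    exact h3
  · have h3 : fderiv ℝ ((-H) ∘ (chartAt Plane z).symm) =
        fun x ↦ -fderiv ℝ (H ∘ (chartAt Plane z).symm) x := by
      funext x
      exact fderiv_neg (f := H ∘ (chartAt Plane z).symm)
    rw [h3, fderiv_fun_neg, neg_apply, neg_apply, hv, neg_zero]

end Reflection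

theorem lemma2p8 {N : Type*} [TopologicalSpace N] [T2Space N] [SecondCountableTopology N]
    [ChartedSpace Plane N] [IsManifold (𝓡 2) ∞ N] [MeasurableSpace N] [BorelSpace N]
    (Ω : SymplecticForm N) (hΩ : Ω.area univ < ⊤)
    (H : N → ℝ) (hH : ContMDiff (𝓡 2) 𝓘(ℝ, ℝ) ∞ H) (hproper : IsProperMap H) :
    (∀ (c₀ : ℝ) (J : Set ℝ) (L : ℝ → Set N),
      IsMaximalForwardCylinder Ω H c₀ J L → IsResonantCylinder Ω H J L →
      ∃ cp : ℝ, J = Ico c₀ cp ∧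
        ∃ z : N, IsLocalMax H z ∧ IsNondegenerateCriticalPoint H z ∧
          IsEmbeddedDisc ((⋃ c ∈ Ioo c₀ cp, L c) ∪ {z}) ∧
          GeneratesCircleActionWithFixedPoint Ω H ((⋃ c ∈ Ioo c₀ cp, L c) ∪ {z}) z) ∧
    (∀ (c₀ : ℝ) (J : Set ℝ) (L : ℝ → Set N),
      IsMaximalBackwardCylinder Ω H c₀ J L → IsResonantCylinder Ω H J L →
      ∃ cm : ℝ, J = Ioc cm c₀ ∧
        ∃ z : N, IsLocalMin H z ∧ IsNondegenerateCriticalPoint H z ∧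
          IsEmbeddedDisc ((⋃ c ∈ Ioo cm c₀, L c) ∪ {z}) ∧
          GeneratesCircleActionWithFixedPoint Ω H ((⋃ c ∈ Ioo cm c₀, L c) ∪ {z}) z) := by
  -- The backward statement is the forward one for `Ω.opposite` and `-H`, with the cylinder
  -- reparametrised by `c ↦ -c`; a local maximum of `-H` is a local minimum of `H`.
  refine ⟨resonant_forward_cylinder Ω hΩ H hH hproper, fun c₀ J L hmax hres ↦ ?_⟩
  have hX := hamiltonianVectorField_opposite Ω H
  have horb : ∀ γ, IsHamiltonianOrbit Ω H γ ↔ IsHamiltonianOrbit Ω.opposite (-H) γ := fun γ ↦ by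
    rw [IsHamiltonianOrbit, IsHamiltonianOrbit, hX]
  have hneg : ∀ z, (-H) z = -H z := fun z ↦ rfl
  have hmax' : IsMaximalForwardCylinder Ω.opposite (-H) (-c₀) (Neg.neg ⁻¹' J) (fun c ↦ L (-c)) := by
    obtain ⟨I, L', hI, hc₀, rfl, hL⟩ := hmax
    refine ⟨_, _, hI.reflect horb hneg, ?_, ?_, fun c hc ↦ hL (-c) hc⟩
    · rw [mem_interior_iff_mem_nhds] at hc₀ ⊢
      exact continuous_neg.continuousAt.preimage_mem_nhds (by rwa [neg_neg])
    · ext c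
      simp
  have hproper' : IsProperMap (-H) := (Homeomorph.neg ℝ).isProperMap.comp hproper
  obtain ⟨cp, hJ, z, h1, h2, h3, τ, Φ, h4, h5⟩ := resonant_forward_cylinder Ω.opposite
    (by rwa [SymplecticForm.area_opposite]) (-H) hH.neg hproper' (-c₀) _ _ hmax'
    (hres.reflect horb)
  have hset : (⋃ c ∈ Ioo (-c₀) cp, L (-c)) = ⋃ c ∈ Ioo (-cp) c₀, L c := by
    ext x
    simp only [mem_iUnion, mem_Ioo, exists_prop]
    constructor
    · rintro ⟨c, hc, hx⟩
      exact ⟨-c, ⟨by linarith [hc.2], by linarith [hc.1]⟩, hx⟩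
    · rintro ⟨c, hc, hx⟩
      exact ⟨-c, ⟨by linarith [hc.2], by linarith [hc.1]⟩, by rwa [neg_neg]⟩
  rw [hset] at h3 h4 h5
  refine ⟨-cp, ?_, z, ?_, h2.of_neg, h3, τ, Φ,
    ⟨h4.pos, h4.smooth, h4.mapsTo, h4.map_zero, h4.map_add, h4.periodic,
      fun x hx ↦ (horb _).mpr (h4.orbit x hx)⟩, h5⟩
  · ext c
    have h6 : -c ∈ (Neg.neg ⁻¹' J : Set ℝ) ↔ -c ∈ Ico (-c₀) cp := by rw [hJ]
    simp only [mem_preimage, neg_neg] at h6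
    rw [h6, mem_Ico, mem_Ioc]
    constructor <;> rintro ⟨ha, hb⟩ <;> constructor <;> linarith
  · filter_upwards [h1] with y hy
    simp only [Pi.neg_apply] at hy
    linarith
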